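/- **Setting.** Let $k_1,k_2\ge 1$ be fixed integers and consider the two-way matrix factor model $$X_t=RF_tC'+E_t,\qquad t=1,\dots,T,$$ where $X_t$ and $E_t=(e_{ij,t})$ are $p_1\times p_2$, $R$ ($p_1\times k_1$) and $C$ ($p_2\times k_2$) are deterministic loading matrices, and $F_t=(F_{hl,t})$ is a random $k_1\times k_2$ matrix. The rows of $R$, the rows of $C$, the $F_t$ and the $e_{ij,t}$ are taken from fixed infinite arrays (so that all $p_1,p_2,T$ live on one probability space). $\|\cdot\|$ is the spectral norm, $\|\cdot\|_{\max}$ the maximal absolute entry, $\lambda_j(A)$ the $j$-th largest eigenvalue. Constants $c_0,c_1$ below are finite, may differ from line to line, and do not depend on $p_1,p_2,T$ or on the indices; covariances are assumed to exist. **(B1)** $E F_t=0$, $E\|F_t\|^{4+\epsilon}\le c_0$ for some $\epsilon>0$; $T^{-1}\sum_{t\le T}F_tF_t'\to\Sigma_1$ and $T^{-1}\sum_{t\le T}F_t'F_t\to\Sigma_2$ a.s., with $\Sigma_i$ a $k_i\times k_i$ positive definite matrix with distinct eigenvalues; and for all $h_1,l_1\le k_1$, $h_2,l_2\le k_2$,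 $E\max_{\tilde t\le T}\big(\sum_{t\le\tilde t}(F_{h_1h_2,t}F_{l_1l_2,t}-E F_{h_1h_2,t}F_{l_1l_2,t})\big)^2\le c_0T$. **(B2)** $\|R\|_{\max}\le c_0$, $\|C\|_{\max}\le c_1$, and $\|p_1^{-1}R'R-I_{k_1}\|\to0$, $\|p_2^{-1}C'C-I_{k_2}\|\to0$ as $\min\{p_1,p_2\}\to\infty$. **(B3)** $E e_{ij,t}=0$, $E e_{ij,t}^8\le c_0$; for all $t\le T$, $i,l_1\le p_1$, $j,h_1\le p_2$ (in every sum $s$ runs over $1,\dots,T$; $l,l_2$ over $1,\dots,p_1$; $h,h_2$ over $1,\dots,p_2$): $\sum_{s,l,h}|E(e_{ij,t}e_{lh,s})|\le c_0$; $\sum_{l,h}|E(e_{lj,t}e_{ih,t})|\le c_0$; $\sum_{s,l_2,h}|Cov(e_{ij,t}e_{l_1j,t},e_{ih,s}e_{l_2h,s})|\le c_0$; $\sum_{s,l,h_2}|Cov(e_{ij,t}e_{ih_1,t},e_{lj,s}e_{lh_2,s})|\le c_0$; $\sum_{s,l,h}|Cov(e_{ij,t}^2,e_{lh,s}^2)|\le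 c_0$; $\sum_{s,l_2,h_2}|Cov(e_{ij,t}e_{l_1h_1,t},e_{ij,s}e_{l_2h_2,s})+Cov(e_{l_1j,t}e_{ih_1,t},e_{l_2j,s}e_{ih_2,s})|\le c_0$; and $\lambda_{\min}\big[E\big(\tfrac1{p_2T}\sum_{t\le T}E_tE_t'\big)\big]>0$. **(B4)** $E\big\|T^{-1/2}\sum_{t\le T}F_t\,v'E_tw\big\|^2\le c_0$ for all deterministic unit vectors $v,w$; and with $\bar\zeta_{ij}=\mathrm{Vec}(T^{-1/2}\sum_{t\le T}F_te_{ij,t})$, for all $i,l_1\le p_1$, $j,h_1\le p_2$: $\|\sum_{h}E(\bar\zeta_{ij}\otimes\bar\zeta_{ih})\|_{\max}\le c_0$, $\|\sum_{l}E(\bar\zeta_{ij}\otimes\bar\zeta_{lj})\|_{\max}\le c_0$, $\|\sum_{l,h_2}Cov(\bar\zeta_{ij}\otimes\bar\zeta_{ih_1},\bar\zeta_{lj}\otimes\bar\zeta_{lh_2})\|_{\max}\le c_0$, $\|\sum_{l_2,h}Cov(\bar\zeta_{ij}\otimes\bar\zeta_{l_1j},\bar\zeta_{ih}\otimes\bar\zeta_{l_2h})\|_{\max}\le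 c_0$. **(C1)** $dF$ is a (nonnegative) measure on $\mathbb R$ and $U\subseteq\mathbb R$ is measurable with $\int_UdF(u)=1$ and $\int_Uu^2dF(u)<\infty$. **Statistics.** Let $M_c=\frac1{Tp_2}\sum_tX_tX_t'$, $M_r=\frac1{Tp_1}\sum_tX_t'X_t$, $\widehat C=\sqrt{p_2}\,Q$ where the columns of $Q$ are orthonormal eigenvectors of $M_r$ for its $k_2$ largest eigenvalues (any choice), $\widetilde Y_t=X_t\widehat C/p_2$, $\widetilde M_1=\frac1T\sum_t\widetilde Y_t\widetilde Y_t'$. Write $\lambda_j,\widehat\lambda_j,\widetilde\lambda_j$ for the $j$-th largest eigenvalues of $E(M_c)$, $M_c$, $\widetilde M_1$, and $\bar\lambda=p_1^{-1}\sum_{j\le p_1}\lambda_j$. Fix $\varepsilon>0$; with $\beta=\ln p_1/\ln(p_2T)$ put $\delta=\varepsilon$ if $\beta\le1/2$ and $\delta=1-1/(2\beta)+\varepsilon$ if $\beta>1/2$. Fix an integer $k_1^0\ge1$ and put $$\widehat\phi=\exp\Big\{\frac{p_1^{-\delta}\widehat\lambda_{k_1^0}}{p_1^{-1}\sum_{j\le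 p_1}\widehat\lambda_j}\Big\}-1,\qquad \widetilde\phi=\exp\Big\{\frac{p_1^{-\delta}\widetilde\lambda_{k_1^0}}{p_1^{-1}\sum_{j\le p_1}\widetilde\lambda_j}\Big\}-1.$$ Let $\eta^{(1)},\eta^{(2)},\dots$ be i.i.d. $N(0,1)$, independent of the data, and $$\widehat\nu(u)=\frac2{\sqrt M}\sum_{m=1}^M\Big(I\big[\widehat\phi^{1/2}\eta^{(m)}\le u\big]-\tfrac12\Big),\qquad \widehat\Psi=\int_U\widehat\nu(u)^2dF(u),$$ and define $\widetilde\nu,\widetilde\Psi$ in the same way from $\widetilde\phi$. Let $P^*$ be the law conditional on the sample. **Proposition.** Assume (B1)–(B4) and (C1). (1) If $H_0:k_1\ge k_1^0$ holds then, for almost all realisations of the data, $\widehat\Psi\to\chi^2_1$ and $\widetilde\Psi\to\chi^2_1$ in distribution under $P^*$ along every sequence with $\min\{p_1,p_2,T,M\}\to\infty$ for which $$M\exp\{-\epsilon_0p_1^{1-\delta}\}\to0\quad\text{for some fixed }0<\epsilon_0<c_0/\bar\lambda,$$ where $c_0>0$ is a constant with $\lambda_{k_1^0}\ge c_0p_1$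 eventually; since $\bar\lambda$ varies along the sequence, $\epsilon_0<c_0/\bar\lambda$ means that $c_0/\bar\lambda\ge\kappa$ eventually for some fixed $\kappa>\epsilon_0$. (2) Suppose that $H_1$ holds, i.e. $k_1<k_1^0$ or, in its eigenvalue form, $\lambda_{k_1^0}$ stays bounded as $\min\{p_1,p_2,T\}\to\infty$; and suppose that $dF$ gives no mass to $\{0\}\cap U$. Then there is a constant $0<c_1<\infty$ such that, for almost all realisations of the data, $M^{-1}\widehat\Psi\to c_1$ and $M^{-1}\widetilde\Psi\to c_1$ in $P^*$-probability along every sequence with $\min\{p_1,p_2,T,M\}\to\infty$. The claim for $\widehat\Psi$ holds also in the absence of factors ($k_1=k_2=0$, $X_t=E_t$, with the conditions on $e_{ij,t}$ in (B3)) if $\lambda_{\min}\big[E\big(\tfrac1{p_2T}\sum_tE_tE_t'\big)\big]$ is eventually bounded away from $0$. -/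

import Mathlib

open MeasureTheory ProbabilityTheory Filter Topology

noncomputable section

/-- The spectral norm `‖A‖` of a (rectangular) real matrix. -/
def specNorm {m n : Type*} [Fintype m] [Fintype n] [DecidableEq n] (A : Matrix m n ℝ) : ℝ :=
  ‖LinearMap.toContinuousLinearMap (Matrix.toEuclideanLin A)‖

/-- `kthEig A j` is the `j`-th largest eigenvalue of the symmetric matrix `A`, counted with
multiplicity, for `1 ≤ j ≤ n` (and `0` outside of this range). -/
def kthEig {n : ℕ} (A : Matrix (Fin n) (Fin n) ℝ) (j : ℕ) : ℝ :=
  open Classical in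
  if h : A.IsHermitian ∧ 1 ≤ j ∧ j ≤ n then
    h.1.eigenvalues₀ ⟨j - 1, by rw [Fintype.card_fin]; omega⟩
  else 0

/-- The columns of `Q` are orthonormal eigenvectors of `A` for its `k` largest eigenvalues. -/
def IsLeadingEigenvectors {n k : ℕ} (A : Matrix (Fin n) (Fin n) ℝ)
    (Q : Matrix (Fin n) (Fin k) ℝ) : Prop :=
  Q.transpose * Q = 1 ∧
    A * Q = Q * Matrix.diagonal (fun a : Fin k => kthEig A ((a : ℕ) + 1))

/-- The entrywise expectation of a random matrix. -/
def expMat {Ω : Type*} [MeasurableSpace Ω] {m n : ℕ} (P : Measure Ω)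
    (A : Ω → Matrix (Fin m) (Fin n) ℝ) : Matrix (Fin m) (Fin n) ℝ :=
  Matrix.of fun i j => ∫ ω, A ω i j ∂P

/-- The ingredients of the two-way matrix factor model: the rows of the loading matrices `R`
and `C`, the factor matrices `F t`, and the idiosyncratic terms `e i j t`.  For each
`p₁, p₂, T` the observed matrices are built from the first `p₁` rows of `R`, the first `p₂` rows
of `C`, and the `p₁ × p₂` corner of `e`, for the first `T` periods (all indices start at `0`). -/
structure FactorModel (Ω : Type*) (k₁ k₂ : ℕ) where
  /-- row loadings -/
  R : ℕ → Fin k₁ → ℝ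
  /-- column loadings -/
  C : ℕ → Fin k₂ → ℝ
  /-- common factors -/
  F : ℕ → Ω → Matrix (Fin k₁) (Fin k₂) ℝ
  /-- idiosyncratic components -/
  e : ℕ → ℕ → ℕ → Ω → ℝ

namespace FactorModel

variable {Ω : Type*} {k₁ k₂ : ℕ} (S : FactorModel Ω k₁ k₂)

/-- The `p₁ × k₁` row loading matrix. -/
def rowLoad (p₁ : ℕ) : Matrix (Fin p₁) (Fin k₁) ℝ := Matrix.of fun i a => S.R i a

/-- The `p₂ × k₂` column loading matrix. -/
def colLoad (p₂ : ℕ) : Matrix (Fin p₂) (Fin k₂) ℝ := Matrix.of fun j b => S.C j b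

/-- The `p₁ × p₂` idiosyncratic matrix `E_t`. -/
def err (p₁ p₂ t : ℕ) (ω : Ω) : Matrix (Fin p₁) (Fin p₂) ℝ := Matrix.of fun i j => S.e i j t ω

/-- The observed matrix `X_t = R F_t C' + E_t`. -/
def obs (p₁ p₂ t : ℕ) (ω : Ω) : Matrix (Fin p₁) (Fin p₂) ℝ :=
  S.rowLoad p₁ * S.F t ω * (S.colLoad p₂).transpose + S.err p₁ p₂ t ω

/-- `M_c = (T p₂)⁻¹ ∑ₜ X_t X_t'`. -/
def Mc (p₁ p₂ T : ℕ) (ω : Ω) : Matrix (Fin p₁) (Fin p₁) ℝ :=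
  ((T : ℝ) * p₂)⁻¹ • ∑ t ∈ Finset.range T, S.obs p₁ p₂ t ω * (S.obs p₁ p₂ t ω).transpose

/-- `M_r = (T p₁)⁻¹ ∑ₜ X_t' X_t`. -/
def Mr (p₁ p₂ T : ℕ) (ω : Ω) : Matrix (Fin p₂) (Fin p₂) ℝ :=
  ((T : ℝ) * p₁)⁻¹ • ∑ t ∈ Finset.range T, (S.obs p₁ p₂ t ω).transpose * S.obs p₁ p₂ t ω

/-- The projected observation `Ỹ_t = X_t Ĉ / p₂`, where `Ĉ = √p₂ Q`. -/
def projObs (p₁ p₂ t : ℕ) (Q : Matrix (Fin p₂) (Fin k₂) ℝ) (ω : Ω) :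
    Matrix (Fin p₁) (Fin k₂) ℝ :=
  (p₂ : ℝ)⁻¹ • (S.obs p₁ p₂ t ω * (Real.sqrt p₂ • Q))

/-- `M̃₁ = T⁻¹ ∑ₜ Ỹ_t Ỹ_t'`. -/
def Mtilde (p₁ p₂ T : ℕ) (Q : Matrix (Fin p₂) (Fin k₂) ℝ) (ω : Ω) :
    Matrix (Fin p₁) (Fin p₁) ℝ :=
  (T : ℝ)⁻¹ • ∑ t ∈ Finset.range T,
    S.projObs p₁ p₂ t Q ω * (S.projObs p₁ p₂ t Q ω).transpose

variable [MeasurableSpace Ω]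

/-- The `j`-th largest eigenvalue `λ_j` of `E(M_c)`. -/
def popEig (P : Measure Ω) (p₁ p₂ T j : ℕ) : ℝ := kthEig (expMat P (S.Mc p₁ p₂ T)) j

/-- The average `λ̄ = p₁⁻¹ ∑_{j ≤ p₁} λ_j` of the eigenvalues of `E(M_c)`. -/
def popEigMean (P : Measure Ω) (p₁ p₂ T : ℕ) : ℝ :=
  (p₁ : ℝ)⁻¹ * ∑ j ∈ Finset.Icc 1 p₁, S.popEig P p₁ p₂ T j

/-- The smallest eigenvalue of `E((p₂ T)⁻¹ ∑ₜ E_t E_t')`. -/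
def errMinEig (P : Measure Ω) (p₁ p₂ T : ℕ) : ℝ :=
  kthEig (expMat P fun ω => ((p₂ : ℝ) * T)⁻¹ •
    ∑ t ∈ Finset.range T, S.err p₁ p₂ t ω * (S.err p₁ p₂ t ω).transpose) p₁

/-- The `(a, b)` entry of `T^{-1/2} ∑_{t ≤ T} F_t e_{ij,t}`. -/
def zeta (T i j : ℕ) (ab : Fin k₁ × Fin k₂) (ω : Ω) : ℝ :=
  (Real.sqrt T)⁻¹ * ∑ t ∈ Finset.range T, S.F t ω ab.1 ab.2 * S.e i j t ω

/-- A positive definite matrix with pairwise distinct eigenvalues. -/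
def PosDefDistinct {k : ℕ} (A : Matrix (Fin k) (Fin k) ℝ) : Prop :=
  A.PosDef ∧ Set.InjOn (kthEig A) (Set.Icc 1 k)

/-- Conditions on the common factors. -/
structure FactorCond (P : Measure Ω) : Prop where
  meas : ∀ t a b, Measurable fun ω => S.F t ω a b
  mean_zero : ∀ t a b, ∫ ω, S.F t ω a b ∂P = 0
  moment : ∃ ε > 0, ∃ c : ℝ, ∀ t,
    Integrable (fun ω => specNorm (S.F t ω) ^ (4 + ε : ℝ)) P ∧
      ∫ ω, specNorm (S.F t ω) ^ (4 + ε : ℝ) ∂P ≤ c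
  limit_row : ∃ Sig : Matrix (Fin k₁) (Fin k₁) ℝ, PosDefDistinct Sig ∧
    ∀ᵐ ω ∂P, Tendsto
      (fun T : ℕ => (T : ℝ)⁻¹ • ∑ t ∈ Finset.range T, S.F t ω * (S.F t ω).transpose)
      atTop (𝓝 Sig)
  limit_col : ∃ Sig : Matrix (Fin k₂) (Fin k₂) ℝ, PosDefDistinct Sig ∧
    ∀ᵐ ω ∂P, Tendsto
      (fun T : ℕ => (T : ℝ)⁻¹ • ∑ t ∈ Finset.range T, (S.F t ω).transpose * S.F t ω)
      atTop (𝓝 Sig)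
  maximal : ∃ c : ℝ, ∀ (T : ℕ) (h₁ l₁ : Fin k₁) (h₂ l₂ : Fin k₂),
    ∫ ω, (⨆ s : Fin T, (∑ t ∈ Finset.range ((s : ℕ) + 1),
      (S.F t ω h₁ h₂ * S.F t ω l₁ l₂ - ∫ ω', S.F t ω' h₁ h₂ * S.F t ω' l₁ l₂ ∂P)) ^ 2) ∂P
      ≤ c * T

/-- Conditions on the (deterministic) loadings. -/
structure LoadingCond : Prop where
  row_bdd : ∃ c : ℝ, ∀ i a, |S.R i a| ≤ c
  col_bdd : ∃ c : ℝ, ∀ j b, |S.C j b| ≤ c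
  row_lim : Tendsto (fun p₁ : ℕ =>
    specNorm ((p₁ : ℝ)⁻¹ • ((S.rowLoad p₁).transpose * S.rowLoad p₁) - 1)) atTop (𝓝 0)
  col_lim : Tendsto (fun p₂ : ℕ =>
    specNorm ((p₂ : ℝ)⁻¹ • ((S.colLoad p₂).transpose * S.colLoad p₂) - 1)) atTop (𝓝 0)

/-- Conditions on the idiosyncratic terms. -/
structure ErrorCond (P : Measure Ω) : Prop where
  meas : ∀ i j t, Measurable (S.e i j t)
  mean_zero : ∀ i j t, ∫ ω, S.e i j t ω ∂P = 0
  moment : ∃ c : ℝ, ∀ i j t,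
    Integrable (fun ω => S.e i j t ω ^ 8) P ∧ ∫ ω, S.e i j t ω ^ 8 ∂P ≤ c
  weak_all : ∃ c : ℝ, ∀ p₁ p₂ T, ∀ i < p₁, ∀ j < p₂, ∀ t < T,
    ∑ s ∈ Finset.range T, ∑ l ∈ Finset.range p₁, ∑ h ∈ Finset.range p₂,
      |∫ ω, S.e i j t ω * S.e l h s ω ∂P| ≤ c
  weak_cross : ∃ c : ℝ, ∀ p₁ p₂, ∀ i < p₁, ∀ j < p₂, ∀ t,
    ∑ l ∈ Finset.range p₁, ∑ h ∈ Finset.range p₂,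
      |∫ ω, S.e l j t ω * S.e i h t ω ∂P| ≤ c
  cov_row : ∃ c : ℝ, ∀ p₁ p₂ T, ∀ i < p₁, ∀ l₁ < p₁, ∀ j < p₂, ∀ t < T,
    ∑ s ∈ Finset.range T, ∑ l₂ ∈ Finset.range p₁, ∑ h ∈ Finset.range p₂,
      |covariance (fun ω => S.e i j t ω * S.e l₁ j t ω)
        (fun ω => S.e i h s ω * S.e l₂ h s ω) P| ≤ c
  cov_col : ∃ c : ℝ, ∀ p₁ p₂ T, ∀ i < p₁, ∀ j < p₂, ∀ h₁ < p₂, ∀ t < T,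
    ∑ s ∈ Finset.range T, ∑ l ∈ Finset.range p₁, ∑ h₂ ∈ Finset.range p₂,
      |covariance (fun ω => S.e i j t ω * S.e i h₁ t ω)
        (fun ω => S.e l j s ω * S.e l h₂ s ω) P| ≤ c
  cov_sq : ∃ c : ℝ, ∀ p₁ p₂ T, ∀ i < p₁, ∀ j < p₂, ∀ t < T,
    ∑ s ∈ Finset.range T, ∑ l ∈ Finset.range p₁, ∑ h ∈ Finset.range p₂,
      |covariance (fun ω => S.e i j t ω * S.e i j t ω)
        (fun ω => S.e l h s ω * S.e l h s ω) P| ≤ c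
  cov_mixed : ∃ c : ℝ, ∀ p₁ p₂ T, ∀ i < p₁, ∀ l₁ < p₁, ∀ j < p₂, ∀ h₁ < p₂, ∀ t < T,
    ∑ s ∈ Finset.range T, ∑ l₂ ∈ Finset.range p₁, ∑ h₂ ∈ Finset.range p₂,
      |covariance (fun ω => S.e i j t ω * S.e l₁ h₁ t ω)
          (fun ω => S.e i j s ω * S.e l₂ h₂ s ω) P
        + covariance (fun ω => S.e l₁ j t ω * S.e i h₁ t ω)
          (fun ω => S.e l₂ j s ω * S.e i h₂ s ω) P| ≤ c
  min_eig : ∀ p₁ p₂ T : ℕ, 0 < p₁ → 0 < p₂ → 0 < T → 0 < S.errMinEig P p₁ p₂ T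

/-- Conditions on the dependence between factors and idiosyncratic terms. The fourth moments in
`zeta_memLp` are those that make the covariances below exist. -/
structure FactorErrorCond (P : Measure Ω) : Prop where
  proj : ∃ c : ℝ, ∀ (p₁ p₂ T : ℕ) (v : Fin p₁ → ℝ) (w : Fin p₂ → ℝ),
    ∑ i, v i ^ 2 = 1 → ∑ j, w j ^ 2 = 1 →
      ∫ ω, specNorm ((Real.sqrt T)⁻¹ • ∑ t ∈ Finset.range T,
        (v ⬝ᵥ (S.err p₁ p₂ t ω).mulVec w) • S.F t ω) ^ 2 ∂P ≤ c
  zeta_memLp : ∀ T i j ab, MemLp (S.zeta T i j ab) 4 P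
  mean_col : ∃ c : ℝ, ∀ p₁ p₂ T, ∀ i < p₁, ∀ j < p₂, ∀ ab cd : Fin k₁ × Fin k₂,
    |∑ h ∈ Finset.range p₂, ∫ ω, S.zeta T i j ab ω * S.zeta T i h cd ω ∂P| ≤ c
  mean_row : ∃ c : ℝ, ∀ p₁ p₂ T, ∀ i < p₁, ∀ j < p₂, ∀ ab cd : Fin k₁ × Fin k₂,
    |∑ l ∈ Finset.range p₁, ∫ ω, S.zeta T i j ab ω * S.zeta T l j cd ω ∂P| ≤ c
  cov_col : ∃ c : ℝ, ∀ p₁ p₂ T, ∀ i < p₁, ∀ j < p₂, ∀ h₁ < p₂,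
    ∀ ab cd ab' cd' : Fin k₁ × Fin k₂,
    |∑ l ∈ Finset.range p₁, ∑ h₂ ∈ Finset.range p₂,
      covariance (fun ω => S.zeta T i j ab ω * S.zeta T i h₁ cd ω)
        (fun ω => S.zeta T l j ab' ω * S.zeta T l h₂ cd' ω) P| ≤ c
  cov_row : ∃ c : ℝ, ∀ p₁ p₂ T, ∀ i < p₁, ∀ l₁ < p₁, ∀ j < p₂,
    ∀ ab cd ab' cd' : Fin k₁ × Fin k₂,
    |∑ l₂ ∈ Finset.range p₁, ∑ h ∈ Finset.range p₂,
      covariance (fun ω => S.zeta T i j ab ω * S.zeta T l₁ j cd ω)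
        (fun ω => S.zeta T i h ab' ω * S.zeta T l₂ h cd' ω) P| ≤ c

end FactorModel

/-- The exponent `δ`, with `β = ln p₁ / ln (p₂ T)`. -/
def deltaExp (ε : ℝ) (p₁ p₂ T : ℕ) : ℝ :=
  if Real.log p₁ / Real.log (p₂ * T) ≤ 1 / 2 then ε
  else 1 - 1 / (2 * (Real.log p₁ / Real.log (p₂ * T))) + ε

/-- `φ = exp {p₁^{-δ} λ_k(A) / (p₁⁻¹ ∑_{j ≤ p₁} λ_j(A))} - 1` for a symmetric `p₁ × p₁`
matrix `A`. -/
def phiStat {p₁ : ℕ} (δ : ℝ) (A : Matrix (Fin p₁) (Fin p₁) ℝ) (k : ℕ) : ℝ :=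
  Real.exp ((p₁ : ℝ) ^ (-δ) * kthEig A k
    / ((p₁ : ℝ)⁻¹ * ∑ j ∈ Finset.Icc 1 p₁, kthEig A j)) - 1

/-- `ν(u) = (2 / √M) ∑_{m ≤ M} (I[√φ η^{(m)} ≤ u] - 1/2)`. -/
def nuStat (φ : ℝ) (M : ℕ) (η : ℕ → ℝ) (u : ℝ) : ℝ :=
  2 / Real.sqrt M * ∑ m ∈ Finset.range M,
    ((if Real.sqrt φ * η m ≤ u then (1 : ℝ) else 0) - 1 / 2)

/-- The randomised statistic `Ψ = ∫_U ν(u)² dF(u)`; `W` is the measure `dF`. -/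
def psiStat (W : Measure ℝ) (U : Set ℝ) (φ : ℝ) (M : ℕ) (η : ℕ → ℝ) : ℝ :=
  ∫ u in U, nuStat φ M η u ^ 2 ∂W

/-- Conditions on the weight: `∫_U dF = 1` and `∫_U u² dF(u) < ∞`. -/
structure WeightCond (W : Measure ℝ) (U : Set ℝ) : Prop where
  meas : MeasurableSet U
  mass : W U = 1
  second : IntegrableOn (fun u : ℝ => u ^ 2) U W

namespace FactorModel

variable {Ω : Type*} {k₁ k₂ : ℕ} (S : FactorModel Ω k₁ k₂)

/-- The statistic `Ψ̂_k` built on `M_c`, at the sample point `ω` and the artificial sample `η`. -/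
def psiHat (W : Measure ℝ) (U : Set ℝ) (ε : ℝ) (k p₁ p₂ T M : ℕ) (ω : Ω) (η : ℕ → ℝ) : ℝ :=
  psiStat W U (phiStat (deltaExp ε p₁ p₂ T) (S.Mc p₁ p₂ T ω) k) M η

/-- The statistic `Ψ̃_k` built on `M̃₁`, where `Q` holds the chosen leading eigenvectors. -/
def psiTilde (W : Measure ℝ) (U : Set ℝ) (ε : ℝ) (k p₁ p₂ T M : ℕ)
    (Q : Matrix (Fin p₂) (Fin k₂) ℝ) (ω : Ω) (η : ℕ → ℝ) : ℝ :=
  psiStat W U (phiStat (deltaExp ε p₁ p₂ T) (S.Mtilde p₁ p₂ T Q ω) k) M η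

/-- The growth restriction under which the null limit holds, along the index sequence
`(p₁ n, p₂ n, T n, M n)`:  `M exp(-ε₀ p₁^{1-δ}) → 0` for some fixed `0 < ε₀ < c₀ / λ̄`, where
`c₀ > 0` is a constant with `λ_k ≥ c₀ p₁`. As `λ̄` varies with the index, `ε₀ < c₀ / λ̄` means
that `c₀ / λ̄` eventually stays above some `κ > ε₀`. -/
def GrowthRestriction [MeasurableSpace Ω] (P : Measure Ω) (ε : ℝ) (k : ℕ)
    (p₁ p₂ T M : ℕ → ℕ) : Prop :=
  ∃ c₀ ε₀ κ : ℝ, 0 < c₀ ∧ 0 < ε₀ ∧ ε₀ < κ ∧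
    (∀ᶠ n in atTop, c₀ * p₁ n ≤ S.popEig P (p₁ n) (p₂ n) (T n) k) ∧
    (∀ᶠ n in atTop, κ ≤ c₀ / S.popEigMean P (p₁ n) (p₂ n) (T n)) ∧
    Tendsto (fun n => (M n : ℝ) *
      Real.exp (-ε₀ * (p₁ n : ℝ) ^ (1 - deltaExp ε (p₁ n) (p₂ n) (T n)))) atTop (𝓝 0)

end FactorModel

end

noncomputable section

/-! Conditionally on the data, `psiStat` depends on the sample only through the number φ, so the
proof splits into a statement about the artificial sample for a deterministic sequence φ and a
statement about the almost sure size of φ.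

Artificial sample. At u = 0 the scale √φ drops out, and ν(0) is a normalised sum of independent
signs, to which the central limit theorem applies. For large φ the indicators in ν(u) and ν(0)
differ only when η lies between 0 and u/√φ, so that E(ν(u) - ν(0))² ≤ 4(|u|/√φ + M u²/φ). If φ → ∞
and M/φ → 0, integrating over u gives the χ² limit (`tendstoInDistribution_psiStat`). If φ → 0, each
indicator agrees with I[0 ≤ u] unless |u| ≤ √φ|η|, so ν(u)²/M → 1 for u ≠ 0, and the limit constant
is 1 (`tendstoInMeasure_psiStat`).

Errors. Rademacher–Menshov chaining over dyadic boxes in (p₁, p₂, T) turns the covariance bounds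
into almost sure bounds with an arbitrarily small power loss, valid for all sizes on one null set
(`ae_exists_bound_of_dominating`). Comparing a Gram matrix of the errors in Frobenius norm with its
mean, which has bounded row sums, then bounds the top eigenvalue of the error part: it is o(p₁)
(`ae_errForm_isLittleO`) and o(p₁^δ) (`ae_errForm_deltaExp`). The exponent δ is what p₁/√(p₂T)
dictates, up to ε.

Signal. Young's inequality absorbs the cross terms, so the quadratic forms of both `Mc` and its
expectation differ from that of RΣ₁R' by o(p₁) (`exists_form_approx`). Hence the sample λ_k is at
least the population one minus o(p₁). A similar argument for traces, with a strong law for the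
average squared error, compares the eigenvalue means (`ae_exists_eigenvalue_bounds`). Under the
growth restriction this yields φ ≥ exp(ε₀ p₁^{1-δ}) - 1, so φ dominates M. If k > k₁, the signal
vanishes on a space of codimension k₁, so λ_k is at most twice the error bound; the denominator
stays away from 0, and φ → 0.

Projection. `Mtilde` is dominated by `Mc`, and also dominates it up to o(p₁), because the part of
the column loadings outside the leading eigenspace of `Mr` is negligible (`residual_le`,
`exists_Mc_le_Mtilde`). Its trace is a sum of leading eigenvalues of `Mr`, which grow like p₂. -/

lemma tendstoInMeasure_zero_of_integral_abs {α : Type*} [MeasurableSpace α] {μ : Measure α}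
    {Y : ℕ → α → ℝ} (hY : ∀ n, Integrable (Y n) μ)
    (h : Tendsto (fun n => ∫ x, |Y n x| ∂μ) atTop (𝓝 0)) : TendstoInMeasure μ Y atTop 0 := by
  refine tendstoInMeasure_of_tendsto_eLpNorm one_ne_zero (fun n => (hY n).1)
    aestronglyMeasurable_zero ?_
  have : ∀ n, eLpNorm (Y n - 0) 1 μ = ENNReal.ofReal (∫ x, |Y n x| ∂μ) := by
    intro n
    rw [sub_zero, eLpNorm_one_eq_lintegral_enorm, ← ofReal_integral_norm_eq_lintegral_enorm (hY n)]
    simp [Real.norm_eq_abs]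
  simp only [this]
  simpa using ENNReal.tendsto_ofReal h

/-- The standard normal density is at most 1, since 2π ≥ 1. -/
lemma gaussianReal_uIcc_le (x : ℝ) : (gaussianReal 0 1).real (Set.uIcc 0 x) ≤ |x| := by
  have h1 : gaussianReal 0 1 (Set.uIcc 0 x) ≤ ENNReal.ofReal |x| := by
    rw [gaussianReal_apply 0 one_ne_zero]
    calc ∫⁻ y in Set.uIcc 0 x, gaussianPDF 0 1 y ≤ ∫⁻ y in Set.uIcc 0 x, 1 := by
          refine lintegral_mono fun y => ?_
          rw [gaussianPDF, gaussianPDFReal]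
          rw [← ENNReal.ofReal_one]
          refine ENNReal.ofReal_le_ofReal ?_
          have h2 : (1 : ℝ) ≤ √(2 * Real.pi * (1 : NNReal)) := by
            rw [Real.one_le_sqrt]; have := Real.pi_gt_three; push_cast; linarith
          have h3 : (√(2 * Real.pi * (1 : NNReal)))⁻¹ ≤ 1 := inv_le_one_of_one_le₀ h2
          have h4 : Real.exp (-(y - 0) ^ 2 / (2 * (1 : NNReal))) ≤ 1 := by
            rw [Real.exp_le_one_iff]; push_cast; nlinarith [sq_nonneg (y - 0)]
          exact mul_le_one₀ h3 (Real.exp_pos _).le h4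
      _ = ENNReal.ofReal |x| := by
          simp [Set.uIcc, Real.volume_Icc, max_sub_min_eq_abs]
  rw [Measure.real]
  exact ENNReal.toReal_le_of_le_ofReal (abs_nonneg x) h1

/-- Variance plus squared mean: |X| ≤ 1 gives X² ≤ |X|, so each variance is at most q. The variables
need not be centred, whence the M²q² term. -/
lemma integral_sq_sum_indep_le {Ω' : Type*} [MeasurableSpace Ω'] {P' : Measure Ω'}
    [IsProbabilityMeasure P'] {X : ℕ → Ω' → ℝ} (hX : ∀ m, Measurable (X m))
    (hb : ∀ m ω, |X m ω| ≤ 1) (hi : iIndepFun X P') {q : ℝ}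
    (hq : ∀ m, ∫ ω, |X m ω| ∂P' ≤ q) (M : ℕ) :
    ∫ ω, (∑ m ∈ Finset.range M, X m ω) ^ 2 ∂P' ≤ M * q + M ^ 2 * q ^ 2 := by
  have hL : ∀ m, MemLp (X m) 2 P' := fun m =>
    MemLp.of_bound (hX m).aestronglyMeasurable 1 (Eventually.of_forall fun ω => by
      simpa using hb m ω)
  have hint : ∀ m, Integrable (X m) P' := fun m => (hL m).integrable (by norm_num)
  have hS : MemLp (∑ m ∈ Finset.range M, X m) 2 P' := memLp_finsetSum' _ fun m _ => hL m
  have hq0 : 0 ≤ q := (integral_nonneg fun ω => abs_nonneg _).trans (hq 0)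
  have h1 := variance_eq_sub hS
  have h2 : variance (∑ m ∈ Finset.range M, X m) P' ≤ M * q := by
    rw [IndepFun.variance_sum (fun m _ => hL m) (fun i _ j _ hij => hi.indepFun hij)]
    calc _ ≤ ∑ m ∈ Finset.range M, q := by
          refine Finset.sum_le_sum fun m _ => ?_
          refine (variance_le_expectation_sq (hX m).aestronglyMeasurable).trans ?_
          refine le_trans (integral_mono (hL m).integrable_sq (hint m).abs fun ω => ?_) (hq m)
          have := hb m ω
          simp only [Pi.pow_apply]
          rw [← sq_abs]; nlinarith [abs_nonneg (X m ω)]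
      _ = M * q := by simp
  have h3 : |∫ ω, (∑ m ∈ Finset.range M, X m) ω ∂P'| ≤ M * q := by
    simp only [Finset.sum_apply]
    rw [integral_finsetSum _ fun m _ => hint m]
    calc _ ≤ ∑ m ∈ Finset.range M, |∫ ω, X m ω ∂P'| := Finset.abs_sum_le_sum_abs _ _
      _ ≤ ∑ m ∈ Finset.range M, q :=
          Finset.sum_le_sum fun m _ => abs_integral_le_integral_abs.trans (hq m)
      _ = M * q := by simp
  have h4 : (∫ ω, (∑ m ∈ Finset.range M, X m) ω ∂P') ^ 2 ≤ (M * q) ^ 2 := by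
    rw [← sq_abs]; exact pow_le_pow_left₀ (abs_nonneg _) h3 2
  have h5 : ∫ ω, (∑ m ∈ Finset.range M, X m ω) ^ 2 ∂P' =
      ∫ ω, ((∑ m ∈ Finset.range M, X m) ^ 2) ω ∂P' := by simp
  rw [h5]; nlinarith

/-! ### The randomised statistic for given φ. -/

section Randomisation

variable {Ω' : Type*} [MeasurableSpace Ω'] {P' : Measure Ω'} [IsProbabilityMeasure P']
  {η : ℕ → Ω' → ℝ}

lemma nuStat_sq_le (φ : ℝ) (M : ℕ) (x : ℕ → ℝ) (u : ℝ) : nuStat φ M x u ^ 2 ≤ M := by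
  have h : |∑ m ∈ Finset.range M, ((if Real.sqrt φ * x m ≤ u then (1 : ℝ) else 0) - 1 / 2)|
      ≤ M * (1 / 2) := by
    refine (Finset.abs_sum_le_sum_abs _ _).trans ?_
    calc _ ≤ ∑ m ∈ Finset.range M, (1 / 2 : ℝ) := Finset.sum_le_sum fun m _ => by
          split_ifs <;> norm_num [abs_le]
      _ = M * (1 / 2) := by simp
  rw [nuStat, mul_pow, div_pow, Real.sq_sqrt (Nat.cast_nonneg M), ← sq_abs (∑ m ∈ _, _)]
  rcases Nat.eq_zero_or_pos M with rfl | hM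
  · simp
  have hM' : (0 : ℝ) < M := by exact_mod_cast hM
  calc _ ≤ 2 ^ 2 / (M : ℝ) * (M * (1 / 2)) ^ 2 := by gcongr
    _ = M := by field_simp

lemma measurable_nuStat (hη : ∀ m, Measurable (η m)) (φ : ℝ) (M : ℕ) :
    Measurable fun p : Ω' × ℝ => nuStat φ M (fun m => η m p.1) p.2 := by
  unfold nuStat
  refine measurable_const.mul (Finset.measurable_fun_sum _ fun m _ => ?_)
  refine Measurable.sub ?_ measurable_const
  exact Measurable.ite (measurableSet_le (measurable_const.mul ((hη m).comp measurable_fst))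
    measurable_snd) measurable_const measurable_const

lemma measurable_psiStat (hη : ∀ m, Measurable (η m)) {W : Measure ℝ} {U : Set ℝ}
    (hW : WeightCond W U) (φ : ℝ) (M : ℕ) :
    Measurable fun ω => psiStat W U φ M (fun m => η m ω) := by
  have : IsFiniteMeasure (W.restrict U) := ⟨by simp [hW.mass]⟩
  unfold psiStat
  exact (((measurable_nuStat hη φ M).pow_const 2).stronglyMeasurable.integral_prod_right
    (ν := W.restrict U)).measurable

lemma WeightCond.isProbabilityMeasure {W : Measure ℝ} {U : Set ℝ} (hW : WeightCond W U) :
    IsProbabilityMeasure (W.restrict U) := ⟨by simp [hW.mass]⟩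

lemma integrable_nuStat_sq (hη : ∀ m, Measurable (η m)) {W : Measure ℝ} {U : Set ℝ}
    (hW : WeightCond W U) (φ : ℝ) (M : ℕ) (ω : Ω') :
    Integrable (fun u => nuStat φ M (fun m => η m ω) u ^ 2) (W.restrict U) := by
  have := hW.isProbabilityMeasure
  refine Integrable.of_bound
    (((measurable_nuStat hη φ M).comp measurable_prodMk_left).pow_const 2).aestronglyMeasurable
    (M : ℝ) (Eventually.of_forall fun u => ?_)
  rw [Real.norm_eq_abs, abs_of_nonneg (sq_nonneg _)]
  exact nuStat_sq_le φ M _ u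

lemma psiStat_nonneg_le {W : Measure ℝ} {U : Set ℝ} (hη : ∀ m, Measurable (η m))
    (hW : WeightCond W U) (φ : ℝ) (M : ℕ) (ω : Ω') :
    0 ≤ psiStat W U φ M (fun m => η m ω) ∧ psiStat W U φ M (fun m => η m ω) ≤ M := by
  have := hW.isProbabilityMeasure
  refine ⟨integral_nonneg fun u => sq_nonneg _, ?_⟩
  calc psiStat W U φ M (fun m => η m ω) ≤ ∫ u in U, (M : ℝ) ∂W :=
        integral_mono (integrable_nuStat_sq hη hW φ M ω) (integrable_const _)
          fun u => nuStat_sq_le φ M _ u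
    _ = M := by simp

lemma integrable_psiStat {W : Measure ℝ} {U : Set ℝ} (hη : ∀ m, Measurable (η m))
    (hW : WeightCond W U) (φ : ℝ) (M : ℕ) :
    Integrable (fun ω => psiStat W U φ M (fun m => η m ω)) P' := by
  refine Integrable.of_bound (measurable_psiStat hη hW φ M).aestronglyMeasurable (M : ℝ)
    (Eventually.of_forall fun ω => ?_)
  rw [Real.norm_eq_abs, abs_of_nonneg (psiStat_nonneg_le hη hW φ M ω).1]
  exact (psiStat_nonneg_le hη hW φ M ω).2

/-- The sign of a standard normal variable, as it enters `ν(0)`. -/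
def signStat (x : ℝ) : ℝ := 2 * ((if x ≤ 0 then (1 : ℝ) else 0) - 1 / 2)

lemma measurable_signStat : Measurable signStat :=
  measurable_const.mul ((Measurable.ite measurableSet_Iic measurable_const
    measurable_const).sub measurable_const)

lemma signStat_sq (x : ℝ) : signStat x ^ 2 = 1 := by
  unfold signStat; split_ifs <;> norm_num

/-- Off the null set {0} the function is odd, and the law is symmetric. -/
lemma integral_signStat : ∫ x, signStat x ∂(gaussianReal 0 1) = 0 := by
  have h1 : ∫ x, signStat x ∂(gaussianReal 0 1) = ∫ x, signStat (-x) ∂(gaussianReal 0 1) := by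
    conv_lhs => rw [show gaussianReal 0 1 = (gaussianReal 0 1).map (fun x => -x) by
      rw [gaussianReal_map_neg]; simp]
    rw [integral_map measurable_neg.aemeasurable measurable_signStat.aestronglyMeasurable]
  have h2 : ∀ᵐ x ∂(gaussianReal 0 1), signStat (-x) = -signStat x := by
    have : NullSingletonClass (gaussianReal 0 1) := nullSingletonClass_gaussianReal one_ne_zero
    have h0 : ∀ᵐ x ∂(gaussianReal 0 1), x ≠ 0 := by
      simp [ae_iff]
    filter_upwards [h0] with x hx
    unfold signStat
    rcases lt_or_gt_of_ne hx with h | h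
    · rw [if_neg (by linarith), if_pos h.le]; norm_num
    · rw [if_pos (by linarith), if_neg (by linarith)]; norm_num
  rw [integral_congr_ae h2, integral_neg] at h1
  linarith

/-- A positive scale does not affect the sign, so φ disappears at u = 0; this is the source of the
pivotal limit. -/
lemma nuStat_zero {φ : ℝ} (hφ : 0 < φ) (M : ℕ) (x : ℕ → ℝ) :
    nuStat φ M x 0 = (√M)⁻¹ * ∑ m ∈ Finset.range M, signStat (x m) := by
  have : ∀ m, (√φ * x m ≤ 0 ↔ x m ≤ 0) := fun m => by
    rw [mul_nonpos_iff]
    have := Real.sqrt_pos.2 hφ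
    constructor
    · rintro (h | h)
      · exact h.2
      · linarith [h.1]
    · intro h; exact Or.inl ⟨this.le, h⟩
  unfold nuStat signStat
  simp only [this]
  rw [← Finset.mul_sum]; ring

/-- The two indicators differ only if η lies between 0 and u/√φ, an event of probability at most
|u|/√φ. -/
lemma integral_nuStat_sub_sq_le (hη : ∀ m, Measurable (η m)) (hi : iIndepFun η P')
    (hl : ∀ m, P'.map (η m) = gaussianReal 0 1) {φ : ℝ} (hφ : 0 < φ) (M : ℕ) (u : ℝ) :
    ∫ ω, (nuStat φ M (fun m => η m ω) u - nuStat φ M (fun m => η m ω) 0) ^ 2 ∂P' ≤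
      4 * (|u| / √φ + M / φ * u ^ 2) := by
  let g : ℝ → ℝ := fun x => (if √φ * x ≤ u then (1 : ℝ) else 0) - (if √φ * x ≤ 0 then 1 else 0)
  have hs := Real.sqrt_pos.2 hφ
  have hg : Measurable g :=
    (Measurable.ite (measurableSet_le (measurable_const.mul measurable_id) measurable_const)
      measurable_const measurable_const).sub
    (Measurable.ite (measurableSet_le (measurable_const.mul measurable_id) measurable_const)
      measurable_const measurable_const)
  have hgb : ∀ x, |g x| ≤ 1 := fun x => by
    simp only [g]; split_ifs <;> norm_num
  have hgi : ∀ x, |g x| ≤ (Set.uIcc 0 (u / √φ)).indicator (fun _ => (1 : ℝ)) x := by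
    intro x
    by_cases hx : x ∈ Set.uIcc 0 (u / √φ)
    · rw [Set.indicator_of_mem hx]; exact hgb x
    · rw [Set.indicator_of_notMem hx]
      rw [Set.mem_uIcc, not_or] at hx
      simp only [g]
      have e1 : √φ * x ≤ u ↔ x ≤ u / √φ := by rw [le_div_iff₀ hs, mul_comm]
      have e2 : √φ * x ≤ 0 ↔ x ≤ 0 := by
        constructor
        · intro h; by_contra h'; push Not at h'; nlinarith [mul_pos hs h']
        · intro h; nlinarith
      simp only [e1, e2]
      by_cases a1 : x ≤ u / √φ <;> by_cases a2 : x ≤ 0 <;> simp [a1, a2]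
      · exact (hx.1 ⟨by linarith, a1⟩).elim
      · exact (hx.2 ⟨by linarith, a2⟩).elim
  have hq : ∀ m, ∫ ω, |g (η m ω)| ∂P' ≤ |u| / √φ := by
    intro m
    have e1 : ∫ ω, |g (η m ω)| ∂P' = ∫ x, |g x| ∂(gaussianReal 0 1) := by
      rw [← hl m, integral_map (hη m).aemeasurable hg.abs.aestronglyMeasurable]
    rw [e1]
    calc _ ≤ ∫ x, (Set.uIcc 0 (u / √φ)).indicator (fun _ => (1 : ℝ)) x ∂(gaussianReal 0 1) := by
          refine integral_mono ?_ ?_ hgi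
          · exact Integrable.of_bound hg.abs.aestronglyMeasurable 1
              (Eventually.of_forall fun x => by simpa using hgb x)
          · exact (integrable_const (1 : ℝ)).indicator measurableSet_uIcc
      _ = (gaussianReal 0 1).real (Set.uIcc 0 (u / √φ)) := by
          rw [integral_indicator measurableSet_uIcc]; simp
      _ ≤ |u / √φ| := gaussianReal_uIcc_le _
      _ = |u| / √φ := by rw [abs_div, abs_of_pos hs]
  have hkey := integral_sq_sum_indep_le (fun m => hg.comp (hη m)) (fun m ω => hgb (η m ω))
    (hi.comp (fun _ => g) fun _ => hg) hq M
  have e : ∀ ω, (nuStat φ M (fun m => η m ω) u - nuStat φ M (fun m => η m ω) 0) ^ 2 =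
      4 / M * (∑ m ∈ Finset.range M, (g ∘ η m) ω) ^ 2 := by
    intro ω
    have : nuStat φ M (fun m => η m ω) u - nuStat φ M (fun m => η m ω) 0 =
        2 / √M * ∑ m ∈ Finset.range M, (g ∘ η m) ω := by
      unfold nuStat
      rw [← mul_sub, ← Finset.sum_sub_distrib]
      congr 1
      exact Finset.sum_congr rfl fun m _ => by simp [g]
    rw [this, mul_pow, div_pow, Real.sq_sqrt (Nat.cast_nonneg M)]; norm_num
  simp only [e]
  rw [integral_const_mul]
  rcases Nat.eq_zero_or_pos M with rfl | hM
  · simp; positivity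
  have hM' : (0 : ℝ) < M := by exact_mod_cast hM
  calc _ ≤ 4 / M * (M * (|u| / √φ) + M ^ 2 * (|u| / √φ) ^ 2) := by gcongr
    _ = 4 * (|u| / √φ + M / φ * u ^ 2) := by
        rw [div_pow, sq_abs, Real.sq_sqrt hφ.le]; field_simp

lemma WeightCond.integrable_abs {W : Measure ℝ} {U : Set ℝ} (hW : WeightCond W U) :
    Integrable (fun u : ℝ => |u|) (W.restrict U) := by
  have := hW.isProbabilityMeasure
  refine Integrable.mono' ((integrable_const (1 : ℝ)).add hW.second)
    continuous_abs.aestronglyMeasurable (Eventually.of_forall fun u => ?_)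
  simp only [Real.norm_eq_abs, abs_abs, Pi.add_apply]
  nlinarith [sq_abs u, sq_nonneg (|u| - 1), abs_nonneg u]

set_option maxHeartbeats 1000000 in
-- Write a² - b² = (a - b)² + 2b(a - b) with a = ν(u), b = ν(0), and split the product by Young's
-- inequality. The parameter θ stays free: its term is small only by choice, since E ν(0)² ≤ 1 does
-- not vanish.
lemma integral_abs_psiStat_sub_le (hη : ∀ m, Measurable (η m)) (hi : iIndepFun η P')
    (hl : ∀ m, P'.map (η m) = gaussianReal 0 1) {W : Measure ℝ} {U : Set ℝ}
    (hW : WeightCond W U) {φ : ℝ} (hφ : 0 < φ) {M : ℕ} (hM : 0 < M) {θ : ℝ} (hθ : 0 < θ) :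
    ∫ ω, |psiStat W U φ M (fun m => η m ω)
        - ((√M)⁻¹ * ∑ m ∈ Finset.range M, signStat (η m ω)) ^ 2| ∂P' ≤
      (1 + 1 / θ) * (4 * ((∫ u in U, |u| ∂W) / √φ + M / φ * ∫ u in U, u ^ 2 ∂W)) + θ := by
  have := hW.isProbabilityMeasure
  set ν : ℝ → Ω' → ℝ := fun u ω => nuStat φ M (fun m => η m ω) u with hν
  have hmeas : Measurable fun p : Ω' × ℝ => ν p.2 p.1 := measurable_nuStat hη φ M
  have hm0 : Measurable fun p : Ω' × ℝ => ν 0 p.1 :=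
    (measurable_nuStat hη φ M).comp (measurable_fst.prodMk measurable_const)
  have hd : Measurable fun p : Ω' × ℝ => (ν p.2 p.1 - ν 0 p.1) ^ 2 := (hmeas.sub hm0).pow_const 2
  have hdb : ∀ u ω, |(ν u ω - ν 0 ω) ^ 2| ≤ 4 * M := by
    intro u ω
    rw [abs_of_nonneg (sq_nonneg _)]
    have h1 := nuStat_sq_le φ M (fun m => η m ω) u
    have h2 := nuStat_sq_le φ M (fun m => η m ω) 0
    simp only [hν]
    nlinarith [sq_nonneg (nuStat φ M (fun m => η m ω) u + nuStat φ M (fun m => η m ω) 0)]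
  have hint : Integrable (fun p : Ω' × ℝ => (ν p.2 p.1 - ν 0 p.1) ^ 2)
      (P'.prod (W.restrict U)) :=
    Integrable.of_bound hd.aestronglyMeasurable (4 * M)
      (Eventually.of_forall fun p => hdb p.2 p.1)
  have hν0 : ∀ ω, ν 0 ω = (√M)⁻¹ * ∑ m ∈ Finset.range M, signStat (η m ω) := fun ω =>
    nuStat_zero hφ M _
  have hν0m : Measurable (ν 0) := (measurable_nuStat hη φ M).comp
    (measurable_id.prodMk measurable_const)
  have hν0i : Integrable (fun ω => ν 0 ω ^ 2) P' :=
    Integrable.of_bound (hν0m.pow_const 2).aestronglyMeasurable (M : ℝ)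
      (Eventually.of_forall fun ω => by
        rw [Real.norm_eq_abs, abs_of_nonneg (sq_nonneg _)]; exact nuStat_sq_le _ _ _ _)
  have hpt : ∀ ω, |psiStat W U φ M (fun m => η m ω) - ν 0 ω ^ 2| ≤
      (1 + 1 / θ) * (∫ u in U, (ν u ω - ν 0 ω) ^ 2 ∂W) + θ * ν 0 ω ^ 2 := by
    intro ω
    have i1 : Integrable (fun u => ν u ω ^ 2) (W.restrict U) := integrable_nuStat_sq hη hW φ M ω
    have i2 : Integrable (fun u => (ν u ω - ν 0 ω) ^ 2) (W.restrict U) :=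
      Integrable.of_bound (hd.comp measurable_prodMk_left).aestronglyMeasurable (4 * M)
        (Eventually.of_forall fun u => hdb u ω)
    have e : psiStat W U φ M (fun m => η m ω) - ν 0 ω ^ 2 =
        ∫ u in U, (ν u ω ^ 2 - ν 0 ω ^ 2) ∂W := by
      rw [integral_sub i1 (integrable_const _)]
      simp [psiStat, hν]
    rw [e]
    refine abs_integral_le_integral_abs.trans ?_
    calc _ ≤ ∫ u in U, ((1 + 1 / θ) * (ν u ω - ν 0 ω) ^ 2 + θ * ν 0 ω ^ 2) ∂W := by
          refine integral_mono (i1.sub (integrable_const _)).abs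
            ((i2.const_mul _).add (integrable_const _)) fun u => ?_
          have h1 : ν u ω ^ 2 - ν 0 ω ^ 2 = (ν u ω - ν 0 ω) ^ 2
              + 2 * (ν 0 ω * (ν u ω - ν 0 ω)) := by ring
          have h2 : |2 * (ν 0 ω * (ν u ω - ν 0 ω))| ≤
              1 / θ * (ν u ω - ν 0 ω) ^ 2 + θ * ν 0 ω ^ 2 := by
            set a := ν 0 ω
            set b := ν u ω - a
            -- Young's inequality by completing squares, one for each sign.
            have hk : 1 / θ * b ^ 2 + θ * a ^ 2 - 2 * (a * b) = (b - θ * a) ^ 2 / θ := by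
              field_simp; ring
            have hk' : 1 / θ * b ^ 2 + θ * a ^ 2 + 2 * (a * b) = (b + θ * a) ^ 2 / θ := by
              field_simp; ring
            have p1 : 0 ≤ (b - θ * a) ^ 2 / θ := by positivity
            have p2 : 0 ≤ (b + θ * a) ^ 2 / θ := by positivity
            rw [abs_le]; constructor <;> linarith
          simp only
          rw [h1]
          refine (abs_add_le _ _).trans ?_
          rw [abs_of_nonneg (sq_nonneg (ν u ω - ν 0 ω))]
          linarith
      _ = _ := by
          rw [integral_add (i2.const_mul _) (integrable_const _), integral_const_mul,
            integral_const, probReal_univ, one_smul]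
  -- Fubini moves the expectation inside, where the pointwise bound in u applies.
  have hEd : ∫ ω, ∫ u in U, (ν u ω - ν 0 ω) ^ 2 ∂W ∂P' ≤
      4 * ((∫ u in U, |u| ∂W) / √φ + M / φ * ∫ u in U, u ^ 2 ∂W) := by
    rw [integral_integral_swap hint]
    calc _ ≤ ∫ u in U, 4 * (|u| / √φ + M / φ * u ^ 2) ∂W := by
          refine integral_mono hint.integral_prod_right ?_ fun u =>
            integral_nuStat_sub_sq_le hη hi hl hφ M u
          exact ((hW.integrable_abs.div_const _).add (hW.second.const_mul _)).const_mul 4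
      _ = _ := by
          rw [integral_const_mul, integral_add (hW.integrable_abs.div_const _)
            (hW.second.const_mul _), integral_div, integral_const_mul]
  have hE0 : ∫ ω, ν 0 ω ^ 2 ∂P' ≤ 1 := by
    have hX2 : ∀ m, MemLp (fun ω => signStat (η m ω)) 2 P' := fun m =>
      MemLp.of_bound (measurable_signStat.comp (hη m)).aestronglyMeasurable 1
        (Eventually.of_forall fun ω => by
          have := signStat_sq (η m ω)
          rw [Real.norm_eq_abs]; nlinarith [sq_abs (signStat (η m ω)), abs_nonneg (signStat (η m ω))])
    have hmean : ∀ m, ∫ ω, signStat (η m ω) ∂P' = 0 := fun m => by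
      rw [← integral_signStat, ← hl m, integral_map (hη m).aemeasurable
        measurable_signStat.aestronglyMeasurable]
    have hv : variance (∑ m ∈ Finset.range M, fun ω => signStat (η m ω)) P' ≤ M := by
      rw [IndepFun.variance_sum (fun m _ => hX2 m)
        (fun i _ j _ hij => (hi.indepFun hij).comp measurable_signStat measurable_signStat)]
      calc _ ≤ ∑ m ∈ Finset.range M, (1 : ℝ) := Finset.sum_le_sum fun m _ => by
            refine (variance_le_expectation_sq
              (measurable_signStat.comp (hη m)).aestronglyMeasurable).trans ?_
            simp [signStat_sq]
        _ = M := by simp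
    rw [variance_eq_sub (memLp_finsetSum' _ fun m _ => hX2 m)] at hv
    have hz : ∫ ω, (∑ m ∈ Finset.range M, fun ω => signStat (η m ω)) ω ∂P' = 0 := by
      simp only [Finset.sum_apply]
      rw [integral_finsetSum _ fun m _ => (hX2 m).integrable (by norm_num)]
      simp [hmean]
    rw [hz] at hv
    have e : ∫ ω, ν 0 ω ^ 2 ∂P' = (M : ℝ)⁻¹ *
        ∫ ω, ((∑ m ∈ Finset.range M, fun ω => signStat (η m ω)) ^ 2) ω ∂P' := by
      rw [← integral_const_mul]
      congr 1; ext ω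
      rw [hν0, mul_pow, inv_pow, Real.sq_sqrt (Nat.cast_nonneg M)]
      simp
    have hM' : (0 : ℝ) < M := by exact_mod_cast hM
    rw [e]
    calc _ ≤ (M : ℝ)⁻¹ * M := by gcongr; linarith
      _ = 1 := inv_mul_cancel₀ hM'.ne'
  simp only [← hν0]
  calc _ ≤ ∫ ω, ((1 + 1 / θ) * (∫ u in U, (ν u ω - ν 0 ω) ^ 2 ∂W) + θ * ν 0 ω ^ 2) ∂P' :=
        integral_mono ((integrable_psiStat hη hW φ M).sub hν0i).abs
          ((hint.integral_prod_left.const_mul _).add (hν0i.const_mul _)) hpt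
    _ = (1 + 1 / θ) * (∫ ω, ∫ u in U, (ν u ω - ν 0 ω) ^ 2 ∂W ∂P') + θ * ∫ ω, ν 0 ω ^ 2 ∂P' := by
        rw [integral_add (hint.integral_prod_left.const_mul _) (hν0i.const_mul _),
          integral_const_mul, integral_const_mul]
    _ ≤ _ := by
        have : 0 ≤ 1 + 1 / θ := by positivity
        have := mul_le_mul_of_nonneg_left hEd this
        nlinarith

/-- The central limit theorem for the signs, squared by the continuous mapping theorem, transfers to
`psiStat` because their difference tends to 0 in L¹. -/
theorem tendstoInDistribution_psiStat (hη : ∀ m, Measurable (η m)) (hi : iIndepFun η P')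
    (hl : ∀ m, P'.map (η m) = gaussianReal 0 1) {W : Measure ℝ} {U : Set ℝ}
    (hW : WeightCond W U) {φ : ℕ → ℝ} {M : ℕ → ℕ} (hφ : Tendsto φ atTop atTop)
    (hM : Tendsto M atTop atTop) (hMφ : Tendsto (fun n => (M n : ℝ) / φ n) atTop (𝓝 0)) :
    TendstoInDistribution (fun n ω => psiStat W U (φ n) (M n) (fun m => η m ω)) atTop
      (fun z : ℝ => z ^ 2) (fun _ => P') (gaussianReal 0 1) := by
  have hmap : ∀ m, IdentDistrib (fun ω => signStat (η m ω)) (fun ω => signStat (η 0 ω)) P' P' :=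
    fun m => (IdentDistrib.mk (hη m).aemeasurable (hη 0).aemeasurable
      ((hl m).trans (hl 0).symm)).comp measurable_signStat
  have hclt := tendstoInDistribution_inv_sqrt_mul_sum (P := P') (P' := gaussianReal 0 1)
    (X := fun m ω => signStat (η m ω)) (Y := id) ⟨aemeasurable_id, Measure.map_id⟩
    (by
      rw [← integral_signStat, ← hl 0, integral_map (hη 0).aemeasurable
        measurable_signStat.aestronglyMeasurable])
    (by simp [signStat_sq])
    (hi.comp (fun _ => signStat) fun _ => measurable_signStat) hmap
  have hcltM : TendstoInDistribution
      (fun n ω => (√(M n))⁻¹ * ∑ m ∈ Finset.range (M n), signStat (η m ω)) atTop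
      (id : ℝ → ℝ) (fun _ => P') (gaussianReal 0 1) :=
    ⟨fun n => hclt.forall_aemeasurable (M n), hclt.aemeasurable_limit, hclt.tendsto.comp hM⟩
  have hsq := hcltM.continuous_comp (g := fun x : ℝ => x ^ 2) (by fun_prop)
  have hsm : ∀ n, Measurable fun ω => (√(M n))⁻¹ * ∑ m ∈ Finset.range (M n), signStat (η m ω) :=
    fun n => measurable_const.mul (Finset.measurable_fun_sum _ fun m _ =>
      measurable_signStat.comp (hη m))
  refine tendstoInDistribution_of_tendstoInMeasure_sub _ _ hsq ?_
    fun n => (measurable_psiStat hη hW _ _).aemeasurable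
  refine tendstoInMeasure_zero_of_integral_abs (fun n => ?_) ?_
  · refine (integrable_psiStat hη hW _ _).sub ?_
    refine Integrable.of_bound ((hsm n).pow_const 2).aestronglyMeasurable (M n : ℝ)
      (Eventually.of_forall fun ω => ?_)
    simp only [Function.comp]
    -- The normalised sign sum is ν(0) for any positive φ; φ = 1 is taken only to reuse the bound by
    -- M.
    rw [← nuStat_zero one_pos, Real.norm_eq_abs, abs_of_nonneg (sq_nonneg _)]
    exact nuStat_sq_le _ _ _ _
  · have hc : Tendsto (fun n => 4 * ((∫ u in U, |u| ∂W) / √(φ n)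
        + M n / φ n * ∫ u in U, u ^ 2 ∂W)) atTop (𝓝 0) := by
      have h1 : Tendsto (fun n => (∫ u in U, |u| ∂W) / √(φ n)) atTop (𝓝 0) :=
        Tendsto.div_atTop tendsto_const_nhds (Real.tendsto_sqrt_atTop.comp hφ)
      have h2 := hMφ.mul_const (∫ u in U, u ^ 2 ∂W)
      simpa using (h1.add h2).const_mul 4
    rw [Metric.tendsto_atTop]
    intro ε hε
    -- θ is half the tolerance; for this fixed θ the remaining term tends to 0.
    have hθ : 0 < ε / 2 := by positivity
    have hc' := hc.const_mul (1 + 1 / (ε / 2))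
    rw [mul_zero] at hc'
    have := (hc'.eventually_lt_const hθ).and
      ((hφ.eventually_gt_atTop 0).and (hM.eventually_gt_atTop 0))
    obtain ⟨N, hN⟩ := eventually_atTop.1 this
    refine ⟨N, fun n hn => ?_⟩
    obtain ⟨h1, h2, h3⟩ := hN n hn
    have h4 := integral_abs_psiStat_sub_le hη hi hl hW h2 h3 hθ
    rw [Real.dist_eq, sub_zero, abs_of_nonneg (integral_nonneg fun _ => abs_nonneg _)]
    refine lt_of_le_of_lt h4 ?_
    linarith

/-- If A of the M indicators equal 1, the left side is 4A(M - A)/M². All indicators agree with the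
common value I[0 ≤ u] except at most B of them, those with |u| ≤ √φ|x m|; so A ≤ B or M - A ≤ B. -/
lemma one_sub_nuStat_sq_le {φ u : ℝ} {M : ℕ} (hM : 0 < M) (x : ℕ → ℝ) :
    1 - (M : ℝ)⁻¹ * nuStat φ M x u ^ 2 ≤
      4 * (M : ℝ)⁻¹ * ∑ m ∈ Finset.range M, (if |u| ≤ √φ * |x m| then (1 : ℝ) else 0) := by
  have hM' : (0 : ℝ) < M := by exact_mod_cast hM
  set a : ℕ → ℝ := fun m => if √φ * x m ≤ u then (1 : ℝ) else 0
  set b : ℕ → ℝ := fun m => if |u| ≤ √φ * |x m| then (1 : ℝ) else 0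
  set s : ℝ := if 0 ≤ u then 1 else 0
  have hab : ∀ m, |a m - s| ≤ b m := by
    intro m
    simp only [a, b, s]
    have hs := Real.sqrt_nonneg φ
    by_cases h : |u| ≤ √φ * |x m|
    · rw [if_pos h]; split_ifs <;> norm_num
    · rw [if_neg h]
      push Not at h
      have h1 : |√φ * x m| < |u| := by rwa [abs_mul, abs_of_nonneg hs]
      by_cases h2 : 0 ≤ u
      · rw [abs_of_nonneg h2] at h1
        rw [if_pos h2, if_pos (abs_lt.1 h1).2.le]; simp
      · push Not at h2
        rw [abs_of_neg h2, abs_lt] at h1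
        rw [if_neg (by linarith), if_neg (by linarith)]; simp
  set B := ∑ m ∈ Finset.range M, b m
  set A := ∑ m ∈ Finset.range M, a m
  have hAB : |A - M * s| ≤ B := by
    have : A - M * s = ∑ m ∈ Finset.range M, (a m - s) := by
      rw [Finset.sum_sub_distrib]; simp [A]
    rw [this]
    exact (Finset.abs_sum_le_sum_abs _ _).trans (Finset.sum_le_sum fun m _ => hab m)
  have hA0 : 0 ≤ A := Finset.sum_nonneg fun m _ => by simp only [a]; split_ifs <;> norm_num
  have hAM : A ≤ M := by
    calc A ≤ ∑ m ∈ Finset.range M, (1 : ℝ) :=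
          Finset.sum_le_sum fun m _ => by simp only [a]; split_ifs <;> norm_num
      _ = M := by simp
  have hν : nuStat φ M x u ^ 2 = 4 / M * (A - M / 2) ^ 2 := by
    have : ∑ m ∈ Finset.range M, ((if √φ * x m ≤ u then (1 : ℝ) else 0) - 1 / 2) = A - M / 2 := by
      rw [Finset.sum_sub_distrib]; simp [A, a, div_eq_mul_inv]
    rw [nuStat, this, mul_pow, div_pow, Real.sq_sqrt hM'.le]; norm_num
  rw [hν]
  have key : 4 * (A * (M - A)) ≤ 4 * (M * B) := by
    have hB : 0 ≤ B := (abs_nonneg _).trans hAB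
    have hs : s = 0 ∨ s = 1 := by simp only [s]; split_ifs <;> simp
    rw [abs_le] at hAB
    rcases hs with h | h <;> rw [h] at hAB <;> nlinarith
  have e1 : 1 - (M : ℝ)⁻¹ * (4 / M * (A - M / 2) ^ 2) = 4 * (A * (M - A)) / M ^ 2 := by
    field_simp; ring
  have e2 : 4 * (M : ℝ)⁻¹ * B = 4 * (M * B) / M ^ 2 := by field_simp
  rw [e1, e2]
  gcongr

/-- The L¹ distance to 1 is at most 4 times the mass of {|u| ≤ √φ|x|} under the product of the
Gaussian law and the weight. This tends to 0 by dominated convergence because u ≠ 0 almost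
everywhere. Only the marginal laws enter, and M cancels. -/
theorem tendstoInMeasure_psiStat (hη : ∀ m, Measurable (η m))
    (hl : ∀ m, P'.map (η m) = gaussianReal 0 1) {W : Measure ℝ} {U : Set ℝ}
    (hW : WeightCond W U) (hW0 : W ({0} ∩ U) = 0) {φ : ℕ → ℝ} {M : ℕ → ℕ}
    (hφ : Tendsto φ atTop (𝓝 0)) (hM : Tendsto M atTop atTop) :
    TendstoInMeasure P' (fun n ω => (M n : ℝ)⁻¹ * psiStat W U (φ n) (M n) (fun m => η m ω)) atTop
      (fun _ => 1) := by
  have := hW.isProbabilityMeasure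
  let r : ℕ → ℝ × ℝ → ℝ := fun n p => if |p.2| ≤ √(φ n) * |p.1| then (1 : ℝ) else 0
  have hrm : ∀ n, Measurable (r n) := fun n =>
    Measurable.ite (measurableSet_le measurable_snd.abs
      (measurable_const.mul measurable_fst.abs)) measurable_const measurable_const
  have hrb : ∀ n p, ‖r n p‖ ≤ 1 := fun n p => by
    simp only [r]; split_ifs <;> simp
  have hrlim : Tendsto (fun n => ∫ p, r n p ∂((gaussianReal 0 1).prod (W.restrict U))) atTop
      (𝓝 0) := by
    have h0 : Tendsto (fun n => ∫ p, r n p ∂((gaussianReal 0 1).prod (W.restrict U))) atTop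
        (𝓝 (∫ p, (0 : ℝ) ∂((gaussianReal 0 1).prod (W.restrict U)))) := by
      refine tendsto_integral_of_dominated_convergence (fun _ => 1)
        (fun n => (hrm n).aestronglyMeasurable) (integrable_const _)
        (fun n => Eventually.of_forall (hrb n)) ?_
      have hne : ∀ᵐ p ∂((gaussianReal 0 1).prod (W.restrict U)), p.2 ≠ 0 := by
        refine Measure.quasiMeasurePreserving_snd.ae (p := fun u : ℝ => u ≠ 0) ?_
        rw [ae_iff]
        simpa [Measure.restrict_apply] using hW0
      filter_upwards [hne] with p hp
      have h1 : Tendsto (fun n => √(φ n) * |p.1|) atTop (𝓝 0) := by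
        have := ((Real.continuous_sqrt.tendsto 0).comp hφ).mul_const |p.1|
        simpa using this
      refine tendsto_const_nhds.congr' ?_
      filter_upwards [h1.eventually_lt_const (abs_pos.2 hp)] with n hn
      simp only [r]; rw [if_neg (not_le.2 hn)]
    simpa using h0
  have hbound : ∀ n, 0 < M n → ∫ ω, |(M n : ℝ)⁻¹ * psiStat W U (φ n) (M n) (fun m => η m ω) - 1| ∂P'
      ≤ 4 * ∫ p, r n p ∂((gaussianReal 0 1).prod (W.restrict U)) := by
    intro n hn
    have hM' : (0 : ℝ) < M n := by exact_mod_cast hn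
    have hri : ∀ ω m, Integrable (fun u => r n (η m ω, u)) (W.restrict U) := fun ω m =>
      Integrable.of_bound ((hrm n).comp measurable_prodMk_left).aestronglyMeasurable 1
        (Eventually.of_forall fun u => hrb n _)
    have hri2 : Integrable (r n) ((gaussianReal 0 1).prod (W.restrict U)) :=
      Integrable.of_bound (hrm n).aestronglyMeasurable 1 (Eventually.of_forall (hrb n))
    have hpt : ∀ ω, |(M n : ℝ)⁻¹ * psiStat W U (φ n) (M n) (fun m => η m ω) - 1| ≤
        4 * (M n : ℝ)⁻¹ * ∑ m ∈ Finset.range (M n), ∫ u in U, r n (η m ω, u) ∂W := by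
      intro ω
      have h1 := (psiStat_nonneg_le hη hW (φ n) (M n) ω).2
      have h2 : (M n : ℝ)⁻¹ * psiStat W U (φ n) (M n) (fun m => η m ω) ≤ 1 := by
        rw [inv_mul_le_iff₀ hM']; linarith
      rw [abs_sub_comm, abs_of_nonneg (by linarith)]
      have e1 : 1 - (M n : ℝ)⁻¹ * psiStat W U (φ n) (M n) (fun m => η m ω) =
          ∫ u in U, (1 - (M n : ℝ)⁻¹ * nuStat (φ n) (M n) (fun m => η m ω) u ^ 2) ∂W := by
        rw [integral_sub (integrable_const _)
          ((integrable_nuStat_sq hη hW _ _ ω).const_mul _), integral_const_mul]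
        simp [psiStat]
      rw [e1, ← integral_finsetSum _ fun m _ => hri ω m, ← integral_const_mul]
      refine integral_mono ((integrable_const _).sub
          ((integrable_nuStat_sq hη hW _ _ ω).const_mul _))
        ((integrable_finsetSum _ fun m _ => hri ω m).const_mul _) fun u => ?_
      exact one_sub_nuStat_sq_le hn _
    have hi1 : Integrable (fun x => ∫ u in U, r n (x, u) ∂W) (gaussianReal 0 1) :=
      hri2.integral_prod_left
    have hi2 : ∀ m, Integrable (fun ω => ∫ u in U, r n (η m ω, u) ∂W) P' := fun m => by
      have := hi1
      rw [← hl m] at this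
      exact this.comp_measurable (hη m)
    calc _ ≤ ∫ ω, 4 * (M n : ℝ)⁻¹ * ∑ m ∈ Finset.range (M n), ∫ u in U, r n (η m ω, u) ∂W ∂P' :=
          integral_mono (((integrable_psiStat hη hW _ _).const_mul _).sub
            (integrable_const _)).abs
            ((integrable_finsetSum _ fun m _ => hi2 m).const_mul _) hpt
      _ = 4 * ∫ p, r n p ∂((gaussianReal 0 1).prod (W.restrict U)) := by
          rw [integral_const_mul, integral_finsetSum _ fun m _ => hi2 m]
          have : ∀ m, ∫ ω, ∫ u in U, r n (η m ω, u) ∂W ∂P' =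
              ∫ p, r n p ∂((gaussianReal 0 1).prod (W.restrict U)) := fun m => by
            rw [integral_prod _ hri2]
            have h3 : AEStronglyMeasurable (fun x => ∫ u in U, r n (x, u) ∂W) (P'.map (η m)) := by
              rw [hl m]; exact hi1.1
            rw [← integral_map (hη m).aemeasurable h3, hl m]
          simp only [this]
          simp; field_simp
  have h0 : TendstoInMeasure P'
      (fun n ω => (M n : ℝ)⁻¹ * psiStat W U (φ n) (M n) (fun m => η m ω) - 1) atTop 0 := by
    refine tendstoInMeasure_zero_of_integral_abs
      (fun n => ((integrable_psiStat hη hW _ _).const_mul _).sub (integrable_const _)) ?_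
    have hr4 := hrlim.const_mul 4
    rw [mul_zero] at hr4
    refine tendsto_of_tendsto_of_tendsto_of_le_of_le' tendsto_const_nhds hr4
      (Eventually.of_forall fun n => integral_nonneg fun _ => abs_nonneg _) ?_
    filter_upwards [hM.eventually_gt_atTop 0] with n hn using hbound n hn
  intro ε hε
  refine (h0 ε hε).congr fun n => ?_
  congr 1; ext ω
  simp [edist_dist, Real.dist_eq]

end Randomisation

/-! ### Min-max inequalities for ordered eigenvalues. -/

section Spectral

open Matrix

variable {n : ℕ} {A B : Matrix (Fin n) (Fin n) ℝ}

lemma kthEig_eq (hA : A.IsHermitian) (i : Fin n) :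
    kthEig A ((i : ℕ) + 1) = hA.eigenvalues₀ (Fin.cast (Fintype.card_fin n).symm i) := by
  rw [kthEig, dif_pos ⟨hA, by omega, by omega⟩]
  rfl

lemma kthEig_antitone (hA : A.IsHermitian) : Antitone fun i : Fin n => kthEig A ((i : ℕ) + 1) := by
  intro i j hij
  simp only [kthEig_eq hA]
  exact hA.eigenvalues₀_antitone hij

/-- Reindexing the eigenvectors in decreasing order of eigenvalue reduces every min-max argument
below to the vanishing of initial or final coordinates of V x. -/
lemma exists_orthogonal_diagonalization (hA : A.IsHermitian) :
    ∃ V : Matrix (Fin n) (Fin n) ℝ, V * Vᵀ = 1 ∧ Vᵀ * V = 1 ∧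
      A = Vᵀ * diagonal (fun i : Fin n => kthEig A ((i : ℕ) + 1)) * V := by
  -- σ matches the sorted index with the index used by `eigenvalues`.
  let σ : Fin n ≃ Fin n := (finCongr (Fintype.card_fin n).symm).trans
    (Fintype.equivOfCardEq (Fintype.card_fin _))
  let W : Matrix (Fin n) (Fin n) ℝ := hA.eigenvectorUnitary
  have hW : W * Wᵀ = 1 := by
    have := hA.eigenvectorUnitary.2
    rw [mem_unitaryGroup_iff] at this
    simpa [star_eq_conjTranspose, conjTranspose_eq_transpose_of_trivial] using this
  have hσ : ∀ i, hA.eigenvalues (σ i) = kthEig A ((i : ℕ) + 1) := by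
    intro i
    rw [kthEig_eq hA, IsHermitian.eigenvalues]
    simp [σ]
  have hAW : A = W * diagonal hA.eigenvalues * Wᵀ := by
    have := hA.spectral_theorem
    rw [Unitary.conjStarAlgAut_apply] at this
    simpa [star_eq_conjTranspose, conjTranspose_eq_transpose_of_trivial, Function.comp_def]
      using this
  have hWW : Wᵀ * W = 1 := mul_eq_one_comm.1 hW
  have h1 : (Wᵀ.submatrix σ id) * (Wᵀ.submatrix σ id)ᵀ = 1 := by
    rw [transpose_submatrix, transpose_transpose,
      ← submatrix_mul Wᵀ W σ id σ Function.bijective_id, hWW, submatrix_one_equiv]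
  refine ⟨Wᵀ.submatrix σ id, h1, mul_eq_one_comm.1 h1, ?_⟩
  rw [transpose_submatrix, transpose_transpose]
  have : diagonal (fun i : Fin n => kthEig A ((i : ℕ) + 1)) =
      (diagonal hA.eigenvalues).submatrix σ σ := by
    rw [submatrix_diagonal_equiv]
    congr 1; ext i; exact (hσ i).symm
  rw [this]
  have e := submatrix_mul_equiv W (diagonal hA.eigenvalues) (id : Fin n → Fin n) σ σ
  rw [e]
  have e2 := submatrix_mul_equiv (W * diagonal hA.eigenvalues) Wᵀ (id : Fin n → Fin n) σ id
  rw [e2, ← hAW, submatrix_id_id]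

lemma dotProduct_orthogonal {V : Matrix (Fin n) (Fin n) ℝ} (hV : Vᵀ * V = 1) (x : Fin n → ℝ) :
    x ⬝ᵥ x = ∑ i, (V *ᵥ x) i ^ 2 := by
  have : (V *ᵥ x) ⬝ᵥ (V *ᵥ x) = x ⬝ᵥ x := by
    rw [dotProduct_mulVec, vecMul_mulVec, ← dotProduct_mulVec, hV, one_mulVec]
  rw [← this]; simp [dotProduct, sq]

lemma dotProduct_diagonalization {V : Matrix (Fin n) (Fin n) ℝ} {d : Fin n → ℝ}
    (hA : A = Vᵀ * diagonal d * V) (x : Fin n → ℝ) :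
    x ⬝ᵥ A *ᵥ x = ∑ i, d i * (V *ᵥ x) i ^ 2 := by
  rw [hA, ← mulVec_mulVec, ← mulVec_mulVec, dotProduct_mulVec, vecMul_transpose]
  simp only [dotProduct, mulVec_diagonal]
  exact Finset.sum_congr rfl fun i _ => by ring

lemma exists_ne_zero_mem_of_lt_finrank {m : ℕ} {V : Submodule ℝ (Fin n → ℝ)}
    (f : (Fin n → ℝ) →ₗ[ℝ] (Fin m → ℝ)) (h : m < Module.finrank ℝ V) :
    ∃ x ∈ V, x ≠ 0 ∧ f x = 0 := by
  have h1 : LinearMap.ker (f.comp V.subtype) ≠ ⊥ :=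
    LinearMap.ker_ne_bot_of_finrank_lt (by simpa using h)
  obtain ⟨x, hx, hx0⟩ := Submodule.exists_mem_ne_zero_of_ne_bot h1
  exact ⟨x, x.2, by simpa using hx0, by simpa using hx⟩

lemma dotProduct_self_pos {x : Fin n → ℝ} (hx : x ≠ 0) : 0 < x ⬝ᵥ x := by
  obtain ⟨i, hi⟩ := Function.ne_iff.1 hx
  exact Finset.sum_pos' (fun i _ => mul_self_nonneg (x i))
    ⟨i, Finset.mem_univ _, mul_self_pos.2 hi⟩

lemma dotProduct_self_nonneg' {ι : Type*} [Fintype ι] (x : ι → ℝ) : 0 ≤ x ⬝ᵥ x :=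
  Finset.sum_nonneg fun i _ => mul_self_nonneg (x i)

/-- A lower bound of the quadratic form on a `j`-dimensional space bounds `λ_j` from below. -/
lemma le_kthEig (hA : A.IsHermitian) {j : ℕ} (hj : 1 ≤ j) (hjn : j ≤ n)
    (V : Submodule ℝ (Fin n → ℝ)) (hV : j ≤ Module.finrank ℝ V) {m : ℝ}
    (h : ∀ x ∈ V, m * (x ⬝ᵥ x) ≤ x ⬝ᵥ A *ᵥ x) : m ≤ kthEig A j := by
  obtain ⟨W, -, hW, hAW⟩ := exists_orthogonal_diagonalization hA
  -- V has dimension at least j, so it contains a nonzero x whose first j - 1 eigencoordinates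
  -- vanish; only eigenvalues at most λ_j act on x.
  let f : (Fin n → ℝ) →ₗ[ℝ] (Fin (j - 1) → ℝ) :=
    (LinearMap.funLeft ℝ ℝ (Fin.castLE (by omega : j - 1 ≤ n))).comp W.mulVecLin
  obtain ⟨x, hxV, hx0, hfx⟩ := exists_ne_zero_mem_of_lt_finrank (V := V) f (by omega)
  have hx := h x hxV
  have hz : ∀ i : Fin n, (i : ℕ) < j - 1 → (W *ᵥ x) i = 0 := fun i hi => by
    have := congrFun hfx ⟨i, hi⟩
    simpa [f, LinearMap.funLeft] using this
  have hle : x ⬝ᵥ A *ᵥ x ≤ kthEig A j * (x ⬝ᵥ x) := by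
    rw [dotProduct_diagonalization hAW, dotProduct_orthogonal hW, Finset.mul_sum]
    refine Finset.sum_le_sum fun i _ => ?_
    by_cases hi : (i : ℕ) < j - 1
    · simp [hz i hi]
    · refine mul_le_mul_of_nonneg_right ?_ (sq_nonneg _)
      have := kthEig_antitone hA (a := ⟨j - 1, by omega⟩) (b := i) (by
        rw [Fin.le_def]; simp; omega)
      simpa [Nat.sub_add_cancel hj] using this
  exact le_of_mul_le_mul_right (hx.trans hle) (dotProduct_self_pos hx0)

/-- Dual to `le_kthEig`: V is large enough to contain a nonzero vector whose last n - j
eigencoordinates vanish, and only eigenvalues at least λ_j act on it. -/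
lemma kthEig_le_of_finrank (hA : A.IsHermitian) {j : ℕ} (hj : 1 ≤ j) (hjn : j ≤ n)
    (V : Submodule ℝ (Fin n → ℝ)) (hV : n < Module.finrank ℝ V + j) {m : ℝ}
    (h : ∀ x ∈ V, x ⬝ᵥ A *ᵥ x ≤ m * (x ⬝ᵥ x)) : kthEig A j ≤ m := by
  obtain ⟨W, -, hW, hAW⟩ := exists_orthogonal_diagonalization hA
  let f : (Fin n → ℝ) →ₗ[ℝ] (Fin (n - j) → ℝ) :=
    (LinearMap.funLeft ℝ ℝ (fun i : Fin (n - j) => (⟨j + i, by omega⟩ : Fin n))).comp W.mulVecLin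
  obtain ⟨x, hxV, hx0, hfx⟩ := exists_ne_zero_mem_of_lt_finrank (V := V) f (by omega)
  have hx := h x hxV
  have hz : ∀ i : Fin n, j ≤ (i : ℕ) → (W *ᵥ x) i = 0 := fun i hi => by
    have := congrFun hfx ⟨i - j, by omega⟩
    simpa [f, LinearMap.funLeft, Nat.add_sub_cancel' hi] using this
  have hle : kthEig A j * (x ⬝ᵥ x) ≤ x ⬝ᵥ A *ᵥ x := by
    rw [dotProduct_diagonalization hAW, dotProduct_orthogonal hW, Finset.mul_sum]
    refine Finset.sum_le_sum fun i _ => ?_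
    by_cases hi : j ≤ (i : ℕ)
    · simp [hz i hi]
    · refine mul_le_mul_of_nonneg_right ?_ (sq_nonneg _)
      have := kthEig_antitone hA (a := i) (b := ⟨j - 1, by omega⟩) (by
        rw [Fin.le_def]; simp; omega)
      simpa [Nat.sub_add_cancel hj] using this
  exact le_of_mul_le_mul_right (hle.trans hx) (dotProduct_self_pos hx0)

/-- An upper bound of the quadratic form on a space cut out by fewer than `j` equations bounds
`λ_j` from above. -/
lemma kthEig_le (hA : A.IsHermitian) {j k : ℕ} (hkj : k < j) (hjn : j ≤ n)
    (f : (Fin n → ℝ) →ₗ[ℝ] (Fin k → ℝ)) {m : ℝ}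
    (h : ∀ x, f x = 0 → x ⬝ᵥ A *ᵥ x ≤ m * (x ⬝ᵥ x)) : kthEig A j ≤ m := by
  refine kthEig_le_of_finrank hA (by omega) hjn (LinearMap.ker f) ?_ fun x hx => h x (by simpa using hx)
  have h1 := LinearMap.finrank_range_add_finrank_ker f
  have h2 : Module.finrank ℝ (LinearMap.range f) ≤ k := by
    simpa using Submodule.finrank_le (LinearMap.range f)
  simp only [Module.finrank_fin_fun] at h1
  omega

/-- Weyl's inequality. On the span of the first j eigenvectors of A, which is the kernel of f below,
the form of B is at least λ_j(A) - m. -/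
lemma kthEig_le_add (hA : A.IsHermitian) (hB : B.IsHermitian) {j : ℕ} (hj : 1 ≤ j) (hjn : j ≤ n)
    {m : ℝ} (h : ∀ x, x ⬝ᵥ A *ᵥ x ≤ x ⬝ᵥ B *ᵥ x + m * (x ⬝ᵥ x)) :
    kthEig A j ≤ kthEig B j + m := by
  obtain ⟨W, -, hW, hAW⟩ := exists_orthogonal_diagonalization hA
  let f : (Fin n → ℝ) →ₗ[ℝ] (Fin (n - j) → ℝ) :=
    (LinearMap.funLeft ℝ ℝ (fun i : Fin (n - j) => (⟨j + i, by omega⟩ : Fin n))).comp W.mulVecLin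
  have h1 := LinearMap.finrank_range_add_finrank_ker f
  have h2 : Module.finrank ℝ (LinearMap.range f) ≤ n - j := by
    simpa using Submodule.finrank_le (LinearMap.range f)
  simp only [Module.finrank_fin_fun] at h1
  have := le_kthEig (m := kthEig A j - m) hB hj hjn (LinearMap.ker f) (by omega) fun x hx => by
    have hz : ∀ i : Fin n, j ≤ (i : ℕ) → (W *ᵥ x) i = 0 := fun i hi => by
      have := congrFun (LinearMap.mem_ker.1 hx) ⟨i - j, by omega⟩
      simpa [f, LinearMap.funLeft, Nat.add_sub_cancel' hi] using this
    have hle : kthEig A j * (x ⬝ᵥ x) ≤ x ⬝ᵥ A *ᵥ x := by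
      rw [dotProduct_diagonalization hAW, dotProduct_orthogonal hW, Finset.mul_sum]
      refine Finset.sum_le_sum fun i _ => ?_
      by_cases hi : j ≤ (i : ℕ)
      · simp [hz i hi]
      · refine mul_le_mul_of_nonneg_right ?_ (sq_nonneg _)
        have := kthEig_antitone hA (a := i) (b := ⟨j - 1, by omega⟩) (by
          rw [Fin.le_def]; simp; omega)
        simpa [Nat.sub_add_cancel hj] using this
    have := h x
    linarith
  linarith

lemma kthEig_nonneg (hA : A.IsHermitian) (h : ∀ x, 0 ≤ x ⬝ᵥ A *ᵥ x) (j : ℕ) :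
    0 ≤ kthEig A j := by
  by_cases hj : 1 ≤ j ∧ j ≤ n
  · refine le_kthEig hA hj.1 hj.2 ⊤ (by simpa using hj.2) fun x _ => ?_
    simpa using h x
  · rw [kthEig, dif_neg]
    tauto

/-- This replaces the eigenvalue averages in the statistics by normalised traces. -/
lemma sum_kthEig (hA : A.IsHermitian) : ∑ j ∈ Finset.Icc 1 n, kthEig A j = A.trace := by
  obtain ⟨W, hWW, -, hAW⟩ := exists_orthogonal_diagonalization hA
  have e1 : ∑ j ∈ Finset.Icc 1 n, kthEig A j = ∑ i ∈ Finset.range n, kthEig A (i + 1) := by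
    rw [Finset.range_eq_Ico, Finset.sum_Ico_add' (fun i => kthEig A i) 0 n 1]
    congr 1
  rw [e1, Finset.sum_range]
  conv_rhs => rw [hAW, trace_mul_comm, ← mul_assoc, hWW, one_mul, trace_diagonal]

end Spectral

/-! ### Maximal inequalities by dyadic chaining. -/

section Chaining

/-- Index set of the dyadic subintervals of `[0, 2 ^ a)`: the pair `(k, r)` stands for
`[r * 2 ^ k, (r + 1) * 2 ^ k)`. -/
def dyadicIndex (a : ℕ) : Finset ((_ : ℕ) × ℕ) :=
  (Finset.range (a + 1)).sigma fun k => Finset.range (2 ^ (a - k))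

def dyadicBlock (q : (_ : ℕ) × ℕ) : Finset ℕ := Finset.Ico (q.2 * 2 ^ q.1) ((q.2 + 1) * 2 ^ q.1)

lemma dyadicBlock_subset {a : ℕ} {q : (_ : ℕ) × ℕ} (hq : q ∈ dyadicIndex a) :
    dyadicBlock q ⊆ Finset.range (2 ^ a) := by
  obtain ⟨k, r⟩ := q
  simp only [dyadicIndex, Finset.mem_sigma, Finset.mem_range] at hq
  intro i hi
  simp only [dyadicBlock, Finset.mem_Ico] at hi
  rw [Finset.mem_range]
  calc i < (r + 1) * 2 ^ k := hi.2
    _ ≤ 2 ^ (a - k) * 2 ^ k := Nat.mul_le_mul_right _ hq.2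
    _ = 2 ^ a := by rw [← pow_add]; congr 1; omega

/-- At each of the a + 1 levels the blocks tile [0, 2^a). -/
lemma sum_card_dyadicBlock (a : ℕ) :
    ∑ q ∈ dyadicIndex a, ((dyadicBlock q).card : ℝ) = (a + 1) * 2 ^ a := by
  rw [dyadicIndex, Finset.sum_sigma]
  have : ∀ k ∈ Finset.range (a + 1), ∑ r ∈ Finset.range (2 ^ (a - k)),
      ((dyadicBlock ⟨k, r⟩).card : ℝ) = 2 ^ a := by
    intro k hk
    have hk' : k ≤ a := by simpa [Nat.lt_succ_iff] using hk
    have : ∀ r, ((dyadicBlock ⟨k, r⟩).card : ℝ) = 2 ^ k := fun r => by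
      simp [dyadicBlock, ← Nat.sub_mul]
    simp only [this]
    simp [← pow_add, Nat.sub_add_cancel hk']
  rw [Finset.sum_congr rfl this]
  simp

/-- Rounding n down to an even number costs at most one increment of the finest level; the even
points form the same problem at depth a. One increment is bounded by the ℓ² sum over its whole
level, so the bound does not depend on n. -/
lemma abs_le_sum_sqrt_dyadic (a : ℕ) : ∀ (S : ℕ → ℝ), S 0 = 0 → ∀ n ≤ 2 ^ a,
    |S n| ≤ ∑ k ∈ Finset.range (a + 1),
      √(∑ r ∈ Finset.range (2 ^ (a - k)), (S ((r + 1) * 2 ^ k) - S (r * 2 ^ k)) ^ 2) := by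
  induction a with
  | zero =>
    intro S hS n hn
    have : n = 0 ∨ n = 1 := by omega
    rcases this with rfl | rfl <;> simp [hS, Real.sqrt_sq_eq_abs]
  | succ a ih =>
    intro S hS n hn
    have h1 := ih (fun m => S (2 * m)) (by simpa using hS) (n / 2) (by
      rw [pow_succ] at hn; omega)
    rw [Finset.sum_range_succ']
    have e : ∀ k ∈ Finset.range (a + 1),
        √(∑ r ∈ Finset.range (2 ^ (a + 1 - (k + 1))),
          (S ((r + 1) * 2 ^ (k + 1)) - S (r * 2 ^ (k + 1))) ^ 2) =
        √(∑ r ∈ Finset.range (2 ^ (a - k)),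
          (S (2 * ((r + 1) * 2 ^ k)) - S (2 * (r * 2 ^ k))) ^ 2) := by
      intro k _
      have : a + 1 - (k + 1) = a - k := by omega
      rw [this]
      congr 1
      refine Finset.sum_congr rfl fun r _ => ?_
      congr 3 <;> ring
    rw [Finset.sum_congr rfl e]
    have h2 : |S n - S (2 * (n / 2))| ≤ √(∑ r ∈ Finset.range (2 ^ (a + 1 - 0)),
        (S ((r + 1) * 2 ^ 0) - S (r * 2 ^ 0)) ^ 2) := by
      rcases Nat.even_or_odd n with h | h
      · rw [Nat.two_mul_div_two_of_even h]; simp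
      · have h3 : 2 * (n / 2) + 1 = n := Nat.two_mul_div_two_add_one_of_odd h
        rw [← Real.sqrt_sq_eq_abs]
        refine Real.sqrt_le_sqrt ?_
        have hm : 2 * (n / 2) ∈ Finset.range (2 ^ (a + 1 - 0)) := by
          rw [Finset.mem_range]; simp only [Nat.sub_zero]; omega
        have := Finset.single_le_sum (f := fun r => (S ((r + 1) * 2 ^ 0) - S (r * 2 ^ 0)) ^ 2)
          (fun r _ => sq_nonneg _) hm
        simpa [h3] using this
    calc |S n| = |S (2 * (n / 2)) + (S n - S (2 * (n / 2)))| := by ring_nf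
      _ ≤ _ := (abs_add_le _ _).trans (add_le_add h1 h2)

/-- Rademacher–Menshov chaining. -/
lemma sq_sum_le_dyadic (x : ℕ → ℝ) {a n : ℕ} (hn : n ≤ 2 ^ a) :
    (∑ i ∈ Finset.range n, x i) ^ 2 ≤
      (a + 1) * ∑ q ∈ dyadicIndex a, (∑ i ∈ dyadicBlock q, x i) ^ 2 := by
  have h := abs_le_sum_sqrt_dyadic a (fun n => ∑ i ∈ Finset.range n, x i) (by simp) n hn
  rw [dyadicIndex, Finset.sum_sigma, ← sq_abs]
  refine (pow_le_pow_left₀ (abs_nonneg _) h 2).trans ?_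
  refine (sq_sum_le_card_mul_sum_sq).trans ?_
  rw [Finset.card_range]
  push_cast
  refine mul_le_mul_of_nonneg_left (Finset.sum_le_sum fun k _ => ?_) (by positivity)
  rw [Real.sq_sqrt (Finset.sum_nonneg fun _ _ => sq_nonneg _)]
  refine Finset.sum_le_sum fun r _ => ?_
  rw [dyadicBlock, Finset.sum_Ico_eq_sub _ (Nat.mul_le_mul_right _ (Nat.le_succ r))]

/-- Chain in one index at a time, exchanging sums so that the index being chained is outermost. -/
lemma sq_sum_le_dyadic_three (x : ℕ → ℕ → ℕ → ℝ) {a b c n₁ n₂ n₃ : ℕ} (h₁ : n₁ ≤ 2 ^ a)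
    (h₂ : n₂ ≤ 2 ^ b) (h₃ : n₃ ≤ 2 ^ c) :
    (∑ i ∈ Finset.range n₁, ∑ j ∈ Finset.range n₂, ∑ t ∈ Finset.range n₃, x i j t) ^ 2 ≤
      (a + 1) * ∑ q₁ ∈ dyadicIndex a, (b + 1) * ∑ q₂ ∈ dyadicIndex b,
        (c + 1) * ∑ q₃ ∈ dyadicIndex c,
          (∑ i ∈ dyadicBlock q₁, ∑ j ∈ dyadicBlock q₂, ∑ t ∈ dyadicBlock q₃, x i j t) ^ 2 := by
  refine (sq_sum_le_dyadic _ h₁).trans ?_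
  gcongr with q₁ _
  rw [Finset.sum_comm]
  refine (sq_sum_le_dyadic _ h₂).trans ?_
  gcongr with q₂ _
  have : ∑ j ∈ dyadicBlock q₂, ∑ i ∈ dyadicBlock q₁, ∑ t ∈ Finset.range n₃, x i j t =
      ∑ t ∈ Finset.range n₃, ∑ i ∈ dyadicBlock q₁, ∑ j ∈ dyadicBlock q₂, x i j t := by
    rw [Finset.sum_comm, Finset.sum_comm (s := Finset.range n₃)]
    exact Finset.sum_congr rfl fun i _ => Finset.sum_comm
  rw [this]
  refine (sq_sum_le_dyadic _ h₃).trans ?_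
  refine mul_le_mul_of_nonneg_left (Finset.sum_le_sum fun q₃ _ =>
    le_of_eq (congrArg (· ^ 2) ?_)) (by positivity)
  rw [Finset.sum_comm]
  exact Finset.sum_congr rfl fun i _ => Finset.sum_comm

variable {Ω : Type*} [MeasurableSpace Ω] {P : Measure Ω}

lemma integral_sq_sum_le {ι : Type*} {s : Finset ι} {X : ι → Ω → ℝ}
    (hX : ∀ q ∈ s, MemLp (X q) 2 P) {C : ℝ}
    (h : ∀ q ∈ s, ∑ r ∈ s, |∫ ω, X q ω * X r ω ∂P| ≤ C) :
    ∫ ω, (∑ q ∈ s, X q ω) ^ 2 ∂P ≤ C * s.card := by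
  have e : ∀ ω, (∑ q ∈ s, X q ω) ^ 2 = ∑ q ∈ s, ∑ r ∈ s, X q ω * X r ω := fun ω => by
    rw [sq, Finset.sum_mul_sum]
  have hi : ∀ q ∈ s, ∀ r ∈ s, Integrable (fun ω => X q ω * X r ω) P := fun q hq r hr =>
    (hX q hq).integrable_mul (hX r hr)
  simp only [e]
  rw [integral_finsetSum _ fun q hq => integrable_finsetSum _ fun r hr => hi q hq r hr]
  calc _ ≤ ∑ q ∈ s, C := Finset.sum_le_sum fun q hq => by
        rw [integral_finsetSum _ fun r hr => hi q hq r hr]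
        exact (Finset.sum_le_sum fun r _ => le_abs_self _).trans (h q hq)
    _ = C * s.card := by simp [mul_comm]

/-- A maximal inequality over all rectangles `[0, n₁) × [0, n₂) × [0, n₃)` inside a dyadic box. -/
lemma exists_dominating_sq_sum {X : ℕ → ℕ → ℕ → Ω → ℝ} (hX : ∀ i j t, MemLp (X i j t) 2 P)
    {C : ℝ} {a b c : ℕ}
    (h : ∀ s₁ ⊆ Finset.range (2 ^ a), ∀ s₂ ⊆ Finset.range (2 ^ b), ∀ s₃ ⊆ Finset.range (2 ^ c),
      ∫ ω, (∑ i ∈ s₁, ∑ j ∈ s₂, ∑ t ∈ s₃, X i j t ω) ^ 2 ∂P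
        ≤ C * (s₁.card * s₂.card * s₃.card)) :
    ∃ D : Ω → ℝ, Integrable D P ∧ (∀ ω, 0 ≤ D ω) ∧
      ∫ ω, D ω ∂P ≤ C * ((a + 1) ^ 2 * (b + 1) ^ 2 * (c + 1) ^ 2 * 2 ^ (a + b + c)) ∧
      ∀ ω n₁ n₂ n₃, n₁ ≤ 2 ^ a → n₂ ≤ 2 ^ b → n₃ ≤ 2 ^ c →
        (∑ i ∈ Finset.range n₁, ∑ j ∈ Finset.range n₂, ∑ t ∈ Finset.range n₃, X i j t ω) ^ 2
          ≤ D ω := by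
  have hi : ∀ s₁ s₂ s₃ : Finset ℕ,
      Integrable (fun ω => (∑ i ∈ s₁, ∑ j ∈ s₂, ∑ t ∈ s₃, X i j t ω) ^ 2) P := fun s₁ s₂ s₃ =>
    (memLp_finsetSum _ fun i _ => memLp_finsetSum _ fun j _ =>
      memLp_finsetSum _ fun t _ => hX i j t).integrable_sq
  have hi3 : ∀ q₁ q₂, Integrable (fun ω => ∑ q₃ ∈ dyadicIndex c,
      (∑ i ∈ dyadicBlock q₁, ∑ j ∈ dyadicBlock q₂, ∑ t ∈ dyadicBlock q₃, X i j t ω) ^ 2) P :=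
    fun q₁ q₂ => integrable_finsetSum _ fun q₃ _ => hi _ _ _
  have hi2 : ∀ q₁, Integrable (fun ω => ∑ q₂ ∈ dyadicIndex b, (c + 1) * ∑ q₃ ∈ dyadicIndex c,
      (∑ i ∈ dyadicBlock q₁, ∑ j ∈ dyadicBlock q₂, ∑ t ∈ dyadicBlock q₃, X i j t ω) ^ 2) P :=
    fun q₁ => integrable_finsetSum _ fun q₂ _ => (hi3 q₁ q₂).const_mul _
  have hi1 : Integrable (fun ω => ∑ q₁ ∈ dyadicIndex a, (b + 1) * ∑ q₂ ∈ dyadicIndex b,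
      (c + 1) * ∑ q₃ ∈ dyadicIndex c,
      (∑ i ∈ dyadicBlock q₁, ∑ j ∈ dyadicBlock q₂, ∑ t ∈ dyadicBlock q₃, X i j t ω) ^ 2) P :=
    integrable_finsetSum _ fun q₁ _ => (hi2 q₁).const_mul _
  -- The chained sum itself dominates, since it involves only the dyadic box and not n₁, n₂, n₃.
  refine ⟨_, hi1.const_mul (a + 1), fun ω => by positivity, ?_,
    fun ω n₁ n₂ n₃ h₁ h₂ h₃ => sq_sum_le_dyadic_three _ h₁ h₂ h₃⟩
  rw [integral_const_mul, integral_finsetSum _ fun q₁ _ => (hi2 q₁).const_mul _]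
  have step : ∀ q₁ ∈ dyadicIndex a, ∫ ω, (b + 1) * ∑ q₂ ∈ dyadicIndex b,
      (c + 1) * ∑ q₃ ∈ dyadicIndex c,
      (∑ i ∈ dyadicBlock q₁, ∑ j ∈ dyadicBlock q₂, ∑ t ∈ dyadicBlock q₃, X i j t ω) ^ 2 ∂P ≤
      (b + 1) * ∑ q₂ ∈ dyadicIndex b, (c + 1) * ∑ q₃ ∈ dyadicIndex c,
        C * ((dyadicBlock q₁).card * (dyadicBlock q₂).card * (dyadicBlock q₃).card) := by
    intro q₁ hq₁
    rw [integral_const_mul, integral_finsetSum _ fun q₂ _ => (hi3 q₁ q₂).const_mul _]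
    gcongr with q₂ hq₂
    rw [integral_const_mul, integral_finsetSum _ fun q₃ _ => hi _ _ _]
    gcongr with q₃ hq₃
    exact h _ (dyadicBlock_subset hq₁) _ (dyadicBlock_subset hq₂) _ (dyadicBlock_subset hq₃)
  -- Each index gives the square (a + 1)²: one factor from Cauchy–Schwarz over levels, one from the
  -- number of levels covering the interval.
  refine (mul_le_mul_of_nonneg_left (Finset.sum_le_sum step) (by positivity)).trans (le_of_eq ?_)
  simp only [← Finset.mul_sum, sum_card_dyadicBlock]
  simp only [← Finset.sum_mul, ← Finset.mul_sum, sum_card_dyadicBlock]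
  ring

/-- Moment bounds for dominating variables on dyadic boxes give an almost sure bound with an
arbitrarily small power loss. -/
lemma ae_exists_bound_of_dominating (γ : ℕ) (δ₁ δ₂ δ₃ : ℕ) (hδ₁ : δ₁ ≤ γ) (hδ₂ : δ₂ ≤ γ)
    (hδ₃ : δ₃ ≤ γ)
    {Y : ℕ → ℕ → ℕ → Ω → ℝ} {C : ℝ}
    (h : ∀ a b c : ℕ, ∃ D : Ω → ℝ, Integrable D P ∧ (∀ ω, 0 ≤ D ω) ∧
      ∫ ω, D ω ∂P ≤ C * ((a + 1) ^ 2 * (b + 1) ^ 2 * (c + 1) ^ 2 *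
        ((2 ^ a) ^ δ₁ * (2 ^ b) ^ δ₂ * (2 ^ c) ^ δ₃)) ∧
      ∀ ω n₁ n₂ n₃, n₁ ≤ 2 ^ a → n₂ ≤ 2 ^ b → n₃ ≤ 2 ^ c → Y n₁ n₂ n₃ ω ≤ D ω)
    {s : ℝ} (hs : 0 < s) :
    ∀ᵐ ω ∂P, ∃ K : ℝ, 0 ≤ K ∧ ∀ n₁ n₂ n₃ : ℕ, 0 < n₁ → 0 < n₂ → 0 < n₃ →
      Y n₁ n₂ n₃ ω ≤ K * ((n₁ : ℝ) ^ δ₁ * (n₂ : ℝ) ^ δ₂ * (n₃ : ℝ) ^ δ₃) *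
        ((n₁ : ℝ) * n₂ * n₃) ^ s := by
  choose D hDi hD0 hDint hYD using h
  have hr0 : (0 : ℝ) < 2 ^ (-s) := by positivity
  have hr1 : (2 : ℝ) ^ (-s) < 1 := Real.rpow_lt_one_of_one_lt_of_neg one_lt_two (by linarith)
  set r : ℝ := 2 ^ (-s) with hr
  -- The weight is the expected size inflated by 2^{s(a+b+c)}; the surplus beats the polynomial
  -- factors, so the expectations of D/w are summable over all boxes and the sum is finite almost
  -- surely.
  let w : ℕ × ℕ × ℕ → ℝ := fun p => ((2 ^ p.1) ^ δ₁ * (2 ^ p.2.1) ^ δ₂ * (2 ^ p.2.2) ^ δ₃)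
    * ((r ^ p.1)⁻¹ * ((r ^ p.2.1)⁻¹ * (r ^ p.2.2)⁻¹))
  have hw : ∀ p, 0 < w p := fun p => by positivity
  let f : ℕ → ℝ := fun a => ((a : ℝ) + 1) ^ 2 * r ^ a
  have hf : Summable f := by
    have h1 := (summable_nat_add_iff 1).2
      (summable_pow_mul_geometric_of_norm_lt_one (R := ℝ) 2 (r := r)
        (by rw [Real.norm_eq_abs, abs_of_pos hr0]; exact hr1))
    have h2 := h1.mul_left r⁻¹
    refine h2.congr fun a => ?_
    simp only [f]; push_cast; field_simp; ring
  have hf0 : ∀ a, 0 ≤ f a := fun a => by positivity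
  have hfff : Summable fun p : ℕ × ℕ × ℕ => |C| * (f p.1 * (f p.2.1 * f p.2.2)) :=
    (hf.mul_of_nonneg (hf.mul_of_nonneg hf hf0 hf0) hf0
      (fun p => mul_nonneg (hf0 _) (hf0 _))).mul_left _
  have hint : ∀ p : ℕ × ℕ × ℕ, ∫⁻ ω, ENNReal.ofReal (D p.1 p.2.1 p.2.2 ω / w p) ∂P ≤
      ENNReal.ofReal (|C| * (f p.1 * (f p.2.1 * f p.2.2))) := by
    intro p
    rw [← ofReal_integral_eq_lintegral_ofReal ((hDi _ _ _).div_const _)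
      (Eventually.of_forall fun ω => div_nonneg (hD0 _ _ _ ω) (hw p).le)]
    refine ENNReal.ofReal_le_ofReal ?_
    rw [integral_div, div_le_iff₀ (hw p)]
    refine (hDint p.1 p.2.1 p.2.2).trans ?_
    refine (mul_le_mul_of_nonneg_right (le_abs_self C) (by positivity)).trans (le_of_eq ?_)
    simp only [f, w]
    field_simp
  have hfin : ∫⁻ ω, ∑' p : ℕ × ℕ × ℕ, ENNReal.ofReal (D p.1 p.2.1 p.2.2 ω / w p) ∂P ≠ ⊤ := by
    rw [lintegral_tsum fun p => ((hDi _ _ _).div_const _).1.aemeasurable.ennreal_ofReal]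
    refine ne_top_of_le_ne_top ?_ (ENNReal.tsum_le_tsum hint)
    rw [← ENNReal.ofReal_tsum_of_nonneg (fun p => by
      exact mul_nonneg (abs_nonneg _) (mul_nonneg (hf0 _) (mul_nonneg (hf0 _) (hf0 _)))) hfff]
    exact ENNReal.ofReal_ne_top
  have hae := ae_lt_top' (AEMeasurable.tsum fun p : ℕ × ℕ × ℕ =>
    ((hDi p.1 p.2.1 p.2.2).div_const (w p)).1.aemeasurable.ennreal_ofReal) hfin
  filter_upwards [hae] with ω hω
  set K₀ := (∑' p : ℕ × ℕ × ℕ, ENNReal.ofReal (D p.1 p.2.1 p.2.2 ω / w p)).toReal with hK₀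
  have hDK : ∀ p : ℕ × ℕ × ℕ, D p.1 p.2.1 p.2.2 ω ≤ K₀ * w p := by
    intro p
    have h1 := ENNReal.le_tsum (f := fun p : ℕ × ℕ × ℕ =>
      ENNReal.ofReal (D p.1 p.2.1 p.2.2 ω / w p)) p
    have h2 := ENNReal.toReal_mono hω.ne h1
    rw [ENNReal.toReal_ofReal (div_nonneg (hD0 _ _ _ ω) (hw p).le), div_le_iff₀ (hw p)] at h2
    exact h2
  have hK₀' : 0 ≤ K₀ := ENNReal.toReal_nonneg
  -- The cost, per index, of enlarging n to the next dyadic size, which is at most 2n.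
  set B : ℝ := 2 ^ γ * 2 ^ s with hB
  refine ⟨K₀ * (B * B * B), by positivity, fun n₁ n₂ n₃ h₁ h₂ h₃ => ?_⟩
  have hup : ∀ n : ℕ, n ≤ 2 ^ (Nat.log 2 n + 1) := fun n =>
    (Nat.lt_pow_succ_log_self one_lt_two n).le
  have hlo : ∀ n : ℕ, 0 < n → ∀ δ ≤ γ, ((2 : ℝ) ^ (Nat.log 2 n + 1)) ^ δ *
      (r ^ (Nat.log 2 n + 1))⁻¹ ≤ B * ((n : ℝ) ^ δ * (n : ℝ) ^ s) := by
    intro n hn δ hδ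
    have h1 : (2 : ℝ) ^ (Nat.log 2 n + 1) ≤ 2 * n := by
      rw [pow_succ, mul_comm]
      have : (2 : ℝ) ^ Nat.log 2 n ≤ n := by exact_mod_cast Nat.pow_log_le_self 2 hn.ne'
      linarith
    have h2 : (r ^ (Nat.log 2 n + 1))⁻¹ = ((2 : ℝ) ^ (Nat.log 2 n + 1)) ^ s := by
      rw [hr, ← Real.rpow_natCast, ← Real.rpow_mul (by norm_num), ← Real.rpow_neg (by norm_num),
        ← Real.rpow_natCast, ← Real.rpow_mul (by norm_num)]
      congr 1; ring
    rw [h2]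
    calc _ ≤ (2 * (n : ℝ)) ^ δ * (2 * (n : ℝ)) ^ s := by gcongr
      _ = 2 ^ δ * 2 ^ s * ((n : ℝ) ^ δ * (n : ℝ) ^ s) := by
          rw [mul_pow, Real.mul_rpow (by norm_num) (Nat.cast_nonneg n)]; ring
      _ ≤ _ := by
          have : (2 : ℝ) ^ δ ≤ 2 ^ γ := pow_le_pow_right₀ (by norm_num) hδ
          rw [hB]; gcongr
  refine (hYD (Nat.log 2 n₁ + 1) (Nat.log 2 n₂ + 1) (Nat.log 2 n₃ + 1) ω n₁ n₂ n₃ (hup _) (hup _)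
    (hup _)).trans ?_
  refine (hDK (Nat.log 2 n₁ + 1, Nat.log 2 n₂ + 1, Nat.log 2 n₃ + 1)).trans ?_
  rw [Real.mul_rpow (by positivity) (by positivity), Real.mul_rpow (by positivity) (by positivity)]
  simp only [w]
  calc _ = K₀ * ((((2 : ℝ) ^ (Nat.log 2 n₁ + 1)) ^ δ₁ * (r ^ (Nat.log 2 n₁ + 1))⁻¹) *
        (((2 : ℝ) ^ (Nat.log 2 n₂ + 1)) ^ δ₂ * (r ^ (Nat.log 2 n₂ + 1))⁻¹) *
        (((2 : ℝ) ^ (Nat.log 2 n₃ + 1)) ^ δ₃ * (r ^ (Nat.log 2 n₃ + 1))⁻¹)) := by ring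
    _ ≤ K₀ * ((B * ((n₁ : ℝ) ^ δ₁ * (n₁ : ℝ) ^ s)) * (B * ((n₂ : ℝ) ^ δ₂ * (n₂ : ℝ) ^ s)) *
        (B * ((n₃ : ℝ) ^ δ₃ * (n₃ : ℝ) ^ s))) := by
        have g1 := hlo n₁ h₁ δ₁ hδ₁
        have g2 := hlo n₂ h₂ δ₂ hδ₂
        have g3 := hlo n₃ h₃ δ₃ hδ₃
        gcongr
    _ = _ := by ring

end Chaining

/-! ### Quadratic forms through Gram matrices. -/

section QuadraticForms

/-- A sum of squares of linear forms is controlled by the deviation of its Gram matrix from a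
matrix with bounded row sums. -/
lemma sum_sq_linear_le {ι κ : Type*} [Fintype ι] (s : Finset κ) (u : ι → κ → ℝ) (m : ι → ι → ℝ)
    (hm : ∀ i l, m i l = m l i) {c : ℝ} (hc : ∀ i, ∑ l, |m i l| ≤ c) (x : ι → ℝ) :
    ∑ k ∈ s, (∑ i, x i * u i k) ^ 2 ≤
      (c + √(∑ i, ∑ l, (∑ k ∈ s, u i k * u l k - m i l) ^ 2)) * ∑ i, x i ^ 2 := by
  have e1 : ∑ k ∈ s, (∑ i, x i * u i k) ^ 2 =
      ∑ i, ∑ l, (x i * x l) * (∑ k ∈ s, u i k * u l k - m i l) + ∑ i, ∑ l, (x i * x l) * m i l := by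
    rw [← Finset.sum_add_distrib]
    simp only [← Finset.sum_add_distrib, ← mul_add, sub_add_cancel]
    simp only [sq, Finset.sum_mul_sum]
    simp only [Finset.mul_sum]
    rw [Finset.sum_comm]
    refine Finset.sum_congr rfl fun i _ => ?_
    rw [Finset.sum_comm]
    refine Finset.sum_congr rfl fun l _ => Finset.sum_congr rfl fun k _ => by ring
  -- The deviation is controlled by its Frobenius norm through Cauchy–Schwarz, the matrix m by
  -- Schur's test in `h2`.
  have h1 : ∑ i, ∑ l, (x i * x l) * (∑ k ∈ s, u i k * u l k - m i l) ≤
      (∑ i, x i ^ 2) * √(∑ i, ∑ l, (∑ k ∈ s, u i k * u l k - m i l) ^ 2) := by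
    have := Real.sum_mul_le_sqrt_mul_sqrt (Finset.univ ×ˢ Finset.univ : Finset (ι × ι))
      (fun q => x q.1 * x q.2) (fun q => ∑ k ∈ s, u q.1 k * u q.2 k - m q.1 q.2)
    simp only [Finset.sum_product] at this
    refine this.trans (le_of_eq ?_)
    congr 1
    have : ∑ i, ∑ l, (x i * x l) ^ 2 = (∑ i, x i ^ 2) ^ 2 := by
      rw [sq (∑ i, x i ^ 2), Finset.sum_mul_sum]
      simp only [mul_pow]
    rw [this, Real.sqrt_sq (Finset.sum_nonneg fun i _ => sq_nonneg _)]
  have h2 : ∑ i, ∑ l, (x i * x l) * m i l ≤ c * ∑ i, x i ^ 2 := by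
    have h3 : ∀ i l, (x i * x l) * m i l ≤ |m i l| * x i ^ 2 / 2 + |m l i| * x l ^ 2 / 2 := by
      intro i l
      rw [hm l i]
      have h4 : (x i * x l) * m i l ≤ |x i * x l| * |m i l| := by
        rw [← abs_mul]; exact le_abs_self _
      have h5 : |x i * x l| ≤ (x i ^ 2 + x l ^ 2) / 2 := by
        rw [abs_le]; constructor <;> nlinarith [sq_nonneg (x i + x l), sq_nonneg (x i - x l)]
      nlinarith [abs_nonneg (m i l)]
    calc _ ≤ ∑ i, ∑ l, (|m i l| * x i ^ 2 / 2 + |m l i| * x l ^ 2 / 2) :=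
          Finset.sum_le_sum fun i _ => Finset.sum_le_sum fun l _ => h3 i l
      _ = ∑ i, (∑ l, |m i l|) * x i ^ 2 := by
          simp only [Finset.sum_add_distrib]
          rw [Finset.sum_comm (f := fun i l => |m l i| * x l ^ 2 / 2), ← Finset.sum_add_distrib]
          refine Finset.sum_congr rfl fun i _ => ?_
          rw [← Finset.sum_add_distrib, Finset.sum_mul]
          exact Finset.sum_congr rfl fun l _ => by ring
      _ ≤ ∑ i, c * x i ^ 2 := Finset.sum_le_sum fun i _ =>
          mul_le_mul_of_nonneg_right (hc i) (sq_nonneg _)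
      _ = _ := by rw [Finset.mul_sum]
  rw [e1]; nlinarith

end QuadraticForms

/-! ### Almost sure bounds for sums of error products. -/

section Errors

variable {Ω : Type*} [MeasurableSpace Ω] {P : Measure Ω}

/-- The part of the error conditions on which the spectral bounds rest. -/
structure WeakDependence (e : ℕ → ℕ → ℕ → Ω → ℝ) (P : Measure Ω) : Prop where
  meas : ∀ i j t, Measurable (e i j t)
  int : ∀ i j t, Integrable (fun ω => e i j t ω ^ 4) P
  weak_row : ∃ c : ℝ, ∀ p, ∀ i < p, ∀ j t, ∑ l ∈ Finset.range p,
    |∫ ω, e i j t ω * e l j t ω ∂P| ≤ c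
  weak_col : ∃ c : ℝ, ∀ p, ∀ j < p, ∀ i t, ∑ h ∈ Finset.range p,
    |∫ ω, e i j t ω * e i h t ω ∂P| ≤ c
  cov_row : ∃ c : ℝ, ∀ i l p T, ∀ j < p, ∀ t < T, ∑ s ∈ Finset.range T, ∑ h ∈ Finset.range p,
    |covariance (fun ω => e i j t ω * e l j t ω) (fun ω => e i h s ω * e l h s ω) P| ≤ c
  cov_col : ∃ c : ℝ, ∀ j h p T, ∀ i < p, ∀ t < T, ∑ s ∈ Finset.range T, ∑ l ∈ Finset.range p,
    |covariance (fun ω => e i j t ω * e i h t ω) (fun ω => e l j s ω * e l h s ω) P| ≤ c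

/-- The conditions come in transposed pairs, so every row estimate yields its column counterpart. -/
lemma WeakDependence.swap {e : ℕ → ℕ → ℕ → Ω → ℝ} (h : WeakDependence e P) :
    WeakDependence (fun i j t => e j i t) P :=
  ⟨fun i j t => h.meas j i t, fun i j t => h.int j i t, h.weak_col, h.weak_row, h.cov_col,
    h.cov_row⟩

lemma FactorModel.ErrorCond.weakDependence {k₁ k₂ : ℕ} {S : FactorModel Ω k₁ k₂}
    [IsProbabilityMeasure P] (h : S.ErrorCond P) : WeakDependence S.e P where
  meas := h.meas
  int i j t := by
    obtain ⟨c, hc⟩ := h.moment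
    refine Integrable.mono' ((integrable_const (1 : ℝ)).add (hc i j t).1)
      ((h.meas i j t).pow_const 4).aestronglyMeasurable (Eventually.of_forall fun ω => ?_)
    simp only [Real.norm_eq_abs, Pi.add_apply]
    rw [abs_of_nonneg (by positivity)]
    nlinarith [sq_nonneg (S.e i j t ω ^ 4 - 1)]
  weak_row := by
    obtain ⟨c, hc⟩ := h.weak_all
    -- The box with sides p, j + 1, t + 1 is the smallest admissible one containing the indices; the
    -- slice h = j, s = t is a subsum of nonnegative terms.
    refine ⟨c, fun p i hi j t => le_trans ?_ (hc p (j + 1) (t + 1) i hi j (by omega) t (by omega))⟩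
    refine le_trans ?_ (Finset.single_le_sum (f := fun s => ∑ l ∈ Finset.range p,
      ∑ h ∈ Finset.range (j + 1), |∫ ω, S.e i j t ω * S.e l h s ω ∂P|)
      (fun _ _ => by positivity) (Finset.mem_range.2 (Nat.lt_succ_self t)))
    refine Finset.sum_le_sum fun l _ => ?_
    exact Finset.single_le_sum (f := fun h => |∫ ω, S.e i j t ω * S.e l h t ω ∂P|)
      (fun _ _ => abs_nonneg _) (Finset.mem_range.2 (Nat.lt_succ_self j))
  weak_col := by
    obtain ⟨c, hc⟩ := h.weak_all
    refine ⟨c, fun p j hj i t => le_trans ?_ (hc (i + 1) p (t + 1) i (by omega) j hj t (by omega))⟩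
    refine le_trans ?_ (Finset.single_le_sum (f := fun s => ∑ l ∈ Finset.range (i + 1),
      ∑ h ∈ Finset.range p, |∫ ω, S.e i j t ω * S.e l h s ω ∂P|)
      (fun _ _ => by positivity) (Finset.mem_range.2 (Nat.lt_succ_self t)))
    exact Finset.single_le_sum (f := fun l => ∑ h ∈ Finset.range p,
      |∫ ω, S.e i j t ω * S.e l h t ω ∂P|)
      (fun _ _ => by positivity) (Finset.mem_range.2 (Nat.lt_succ_self i))
  cov_row := by
    obtain ⟨c, hc⟩ := h.cov_row
    -- The side i + l + 1 exceeds both row indices, so the term l₂ = l occurs in the sum.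
    refine ⟨c, fun i l p T j hj t ht => le_trans ?_
      (hc (i + l + 1) p T i (by omega) l (by omega) j hj t ht)⟩
    refine Finset.sum_le_sum fun s _ => ?_
    exact Finset.single_le_sum (f := fun l₂ => ∑ h ∈ Finset.range p,
      |covariance (fun ω => S.e i j t ω * S.e l j t ω)
        (fun ω => S.e i h s ω * S.e l₂ h s ω) P|)
      (fun _ _ => by positivity) (Finset.mem_range.2 (by omega : l < i + l + 1))
  cov_col := by
    obtain ⟨c, hc⟩ := h.cov_col
    refine ⟨c, fun j h p T i hi t ht => le_trans ?_
      (hc p (j + h + 1) T i hi j (by omega) h (by omega) t ht)⟩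
    refine Finset.sum_le_sum fun s _ => Finset.sum_le_sum fun l _ => ?_
    exact Finset.single_le_sum (f := fun h₂ =>
      |covariance (fun ω => S.e i j t ω * S.e i h t ω)
        (fun ω => S.e l j s ω * S.e l h₂ s ω) P|)
      (fun _ _ => abs_nonneg _) (Finset.mem_range.2 (by omega : h < j + h + 1))

/-- Centred products of errors in a common column. -/
def rowDev (e : ℕ → ℕ → ℕ → Ω → ℝ) (P : Measure Ω) (i l j t : ℕ) (ω : Ω) : ℝ :=
  e i j t ω * e l j t ω - ∫ ω', e i j t ω' * e l j t ω' ∂P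

variable {e : ℕ → ℕ → ℕ → Ω → ℝ}

lemma memLp_two_mul {f g : Ω → ℝ} (hf : Measurable f) (hg : Measurable g)
    (hf4 : Integrable (fun ω => f ω ^ 4) P) (hg4 : Integrable (fun ω => g ω ^ 4) P) :
    MemLp (fun ω => f ω * g ω) 2 P := by
  refine (memLp_two_iff_integrable_sq (hf.mul hg).aestronglyMeasurable).2 ?_
  refine Integrable.mono' (hf4.add hg4) ((hf.mul hg).pow_const 2).aestronglyMeasurable
    (Eventually.of_forall fun ω => ?_)
  simp only [Real.norm_eq_abs, Pi.add_apply]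
  rw [abs_of_nonneg (by positivity)]
  rw [Pi.mul_apply]
  nlinarith [sq_nonneg (f ω ^ 2 - g ω ^ 2), sq_nonneg (f ω ^ 2), sq_nonneg (g ω ^ 2)]

lemma WeakDependence.memLp_mul (h : WeakDependence e P) (i j t l m s : ℕ) :
    MemLp (fun ω => e i j t ω * e l m s ω) 2 P :=
  memLp_two_mul (h.meas _ _ _) (h.meas _ _ _) (h.int _ _ _) (h.int _ _ _)

lemma integral_sq_box_le {X : ℕ → ℕ → ℕ → Ω → ℝ} (hX : ∀ i j t, MemLp (X i j t) 2 P) {C : ℝ}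
    {a b c : ℕ} {s₁ s₂ s₃ : Finset ℕ} (h₁ : s₁ ⊆ Finset.range a) (h₂ : s₂ ⊆ Finset.range b)
    (h₃ : s₃ ⊆ Finset.range c)
    (h : ∀ i < a, ∀ j < b, ∀ t < c, ∑ s ∈ Finset.range c, ∑ l ∈ Finset.range a,
      ∑ m ∈ Finset.range b, |∫ ω, X i j t ω * X l m s ω ∂P| ≤ C) :
    ∫ ω, (∑ i ∈ s₁, ∑ j ∈ s₂, ∑ t ∈ s₃, X i j t ω) ^ 2 ∂P ≤
      C * (s₁.card * s₂.card * s₃.card) := by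
  have key := integral_sq_sum_le (s := s₁ ×ˢ s₂ ×ˢ s₃) (X := fun q => X q.1 q.2.1 q.2.2)
    (fun q _ => hX _ _ _) (C := C) (fun q hq => by
      simp only [Finset.mem_product] at hq
      refine le_trans ?_ (h q.1 (Finset.mem_range.1 (h₁ hq.1)) q.2.1
        (Finset.mem_range.1 (h₂ hq.2.1)) q.2.2 (Finset.mem_range.1 (h₃ hq.2.2)))
      rw [Finset.sum_product]
      simp only [Finset.sum_product]
      have e1 : ∑ s ∈ Finset.range c, ∑ l ∈ Finset.range a, ∑ m ∈ Finset.range b,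
          |∫ ω, X q.1 q.2.1 q.2.2 ω * X l m s ω ∂P| = ∑ l ∈ Finset.range a,
          ∑ m ∈ Finset.range b, ∑ s ∈ Finset.range c,
          |∫ ω, X q.1 q.2.1 q.2.2 ω * X l m s ω ∂P| := by
        rw [Finset.sum_comm]
        exact Finset.sum_congr rfl fun l _ => Finset.sum_comm
      rw [e1]
      refine (Finset.sum_le_sum_of_subset_of_nonneg h₁ fun _ _ _ => by positivity).trans ?_
      refine Finset.sum_le_sum fun l _ => ?_
      refine (Finset.sum_le_sum_of_subset_of_nonneg h₂ fun _ _ _ => by positivity).trans ?_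
      refine Finset.sum_le_sum fun m _ => ?_
      exact Finset.sum_le_sum_of_subset_of_nonneg h₃ fun _ _ _ => by positivity)
  simp only [Finset.sum_product, Finset.card_product] at key
  push_cast at key
  refine key.trans (le_of_eq (by ring))

variable [IsProbabilityMeasure P]

lemma WeakDependence.memLp_rowDev (h : WeakDependence e P) (i l j t : ℕ) :
    MemLp (rowDev e P i l j t) 2 P := (h.memLp_mul i j t l j t).sub (memLp_const _)

/-- The squared Frobenius norm of the centred p₁ × p₁ Gram matrix: n₁² entries, each of second
moment O(n₂n₃). Chaining is needed only in j and t, as the sum over (i, l) is monotone in n₁. -/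
lemma WeakDependence.ae_sum_sq_rowDev_le (h : WeakDependence e P) {s : ℝ} (hs : 0 < s) :
    ∀ᵐ ω ∂P, ∃ K : ℝ, 0 ≤ K ∧ ∀ n₁ n₂ n₃ : ℕ, 0 < n₁ → 0 < n₂ → 0 < n₃ →
      ∑ i ∈ Finset.range n₁, ∑ l ∈ Finset.range n₁,
        (∑ j ∈ Finset.range n₂, ∑ t ∈ Finset.range n₃, rowDev e P i l j t ω) ^ 2 ≤
      K * ((n₁ : ℝ) ^ 2 * n₂ * n₃) * ((n₁ : ℝ) * n₂ * n₃) ^ s := by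
  obtain ⟨C, hC⟩ := h.cov_row
  have := ae_exists_bound_of_dominating (P := P) 2 2 1 1 le_rfl (by norm_num) (by norm_num)
    (Y := fun n₁ n₂ n₃ ω => ∑ i ∈ Finset.range n₁, ∑ l ∈ Finset.range n₁,
        (∑ j ∈ Finset.range n₂, ∑ t ∈ Finset.range n₃, rowDev e P i l j t ω) ^ 2) (C := |C|) ?_ hs
  · simpa only [pow_one] using this
  intro a b c
  have hD : ∀ i l, _ := fun i l => exists_dominating_sq_sum (P := P)
    (X := fun _ j t => rowDev e P i l j t) (fun _ j t => h.memLp_rowDev i l j t) (C := |C|)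
    -- The first index is a dummy, with a single value.
    (a := 0) (b := b) (c := c) fun s₁ h₁ s₂ h₂ s₃ h₃ => by
      refine integral_sq_box_le (fun _ j t => h.memLp_rowDev i l j t) h₁ h₂ h₃ ?_
      intro _ _ j hj t ht
      simp only [pow_zero, Finset.sum_range_one]
      exact (hC i l _ _ j hj t ht).trans (le_abs_self C)
  choose D hDi hD0 hDint hDY using hD
  refine ⟨fun ω => ∑ i ∈ Finset.range (2 ^ a), ∑ l ∈ Finset.range (2 ^ a), D i l ω,
    integrable_finsetSum _ fun i _ => integrable_finsetSum _ fun l _ => hDi i l,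
    fun ω => Finset.sum_nonneg fun i _ => Finset.sum_nonneg fun l _ => hD0 i l ω, ?_, ?_⟩
  · rw [integral_finsetSum _ fun i _ => integrable_finsetSum _ fun l _ => hDi i l]
    calc _ ≤ ∑ i ∈ Finset.range (2 ^ a), ∑ l ∈ Finset.range (2 ^ a),
          |C| * ((b + 1) ^ 2 * (c + 1) ^ 2 * 2 ^ (b + c)) := by
          refine Finset.sum_le_sum fun i _ => ?_
          rw [integral_finsetSum _ fun l _ => hDi i l]
          refine Finset.sum_le_sum fun l _ => (hDint i l).trans (le_of_eq ?_)
          simp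
      _ = |C| * (1 * (b + 1) ^ 2 * (c + 1) ^ 2 * ((2 ^ a) ^ 2 * (2 ^ b) ^ 1 * (2 ^ c) ^ 1)) := by
          simp [pow_add]; ring
      _ ≤ _ := by
          gcongr
          exact one_le_pow₀ (by linarith [(Nat.cast_nonneg a : (0 : ℝ) ≤ a)])
  · intro ω n₁ n₂ n₃ h₁ h₂ h₃
    have hsub : Finset.range n₁ ⊆ Finset.range (2 ^ a) := Finset.range_subset_range.2 h₁
    calc _ ≤ ∑ i ∈ Finset.range n₁, ∑ l ∈ Finset.range n₁, D i l ω := by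
          refine Finset.sum_le_sum fun i _ => Finset.sum_le_sum fun l _ => ?_
          simpa using hDY i l ω 1 n₂ n₃ (by simp) h₂ h₃
      _ ≤ ∑ i ∈ Finset.range n₁, ∑ l ∈ Finset.range (2 ^ a), D i l ω :=
          Finset.sum_le_sum fun i _ => Finset.sum_le_sum_of_subset_of_nonneg hsub
            fun l _ _ => hD0 i l ω
      _ ≤ _ := Finset.sum_le_sum_of_subset_of_nonneg hsub
            fun i _ _ => Finset.sum_nonneg fun l _ => hD0 i l ω

/-- The counterpart for the p₂ × p₂ Gram matrices of the separate periods. Only the sum over i is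
signed and needs chaining; those over t, j, m are monotone. -/
lemma WeakDependence.ae_sum_sq_colDev_le (h : WeakDependence e P) {s : ℝ} (hs : 0 < s) :
    ∀ᵐ ω ∂P, ∃ K : ℝ, 0 ≤ K ∧ ∀ n₁ n₂ n₃ : ℕ, 0 < n₁ → 0 < n₂ → 0 < n₃ →
      ∑ t ∈ Finset.range n₃, ∑ j ∈ Finset.range n₂, ∑ m ∈ Finset.range n₂,
        (∑ i ∈ Finset.range n₁, rowDev (fun i j t => e j i t) P j m i t ω) ^ 2 ≤
      K * (n₁ * (n₂ : ℝ) ^ 2 * n₃) * ((n₁ : ℝ) * n₂ * n₃) ^ s := by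
  have h' := h.swap
  obtain ⟨C, hC⟩ := h'.cov_row
  have := ae_exists_bound_of_dominating (P := P) 2 1 2 1 (by norm_num) le_rfl (by norm_num)
    (Y := fun n₁ n₂ n₃ ω => ∑ t ∈ Finset.range n₃, ∑ j ∈ Finset.range n₂, ∑ m ∈ Finset.range n₂,
        (∑ i ∈ Finset.range n₁, rowDev (fun i j t => e j i t) P j m i t ω) ^ 2) (C := |C|) ?_ hs
  · simpa only [pow_one] using this
  intro a b c
  have hD : ∀ t j m, _ := fun t j m => exists_dominating_sq_sum (P := P)
    (X := fun i _ _ => rowDev (fun i j t => e j i t) P j m i t)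
    (fun i _ _ => h'.memLp_rowDev j m i t) (C := |C|)
    (a := a) (b := 0) (c := 0) fun s₁ h₁ s₂ h₂ s₃ h₃ => by
      refine integral_sq_box_le (fun i _ _ => h'.memLp_rowDev j m i t) h₁ h₂ h₃ ?_
      intro i hi _ _ _ _
      simp only [pow_zero, Finset.sum_range_one]
      -- Within one period only the term s = t of the covariance bound is used.
      refine le_trans ?_ ((hC j m _ (t + 1) i hi t (by omega)).trans (le_abs_self C))
      exact Finset.single_le_sum (f := fun s => ∑ l ∈ Finset.range (2 ^ a),
        |covariance (fun ω => e i j t ω * e i m t ω) (fun ω => e l j s ω * e l m s ω) P|)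
        (fun _ _ => by positivity) (Finset.mem_range.2 (Nat.lt_succ_self t))
  choose D hDi hD0 hDint hDY using hD
  refine ⟨fun ω => ∑ t ∈ Finset.range (2 ^ c), ∑ j ∈ Finset.range (2 ^ b),
      ∑ m ∈ Finset.range (2 ^ b), D t j m ω,
    integrable_finsetSum _ fun t _ => integrable_finsetSum _ fun j _ =>
      integrable_finsetSum _ fun m _ => hDi t j m,
    fun ω => Finset.sum_nonneg fun t _ => Finset.sum_nonneg fun j _ =>
      Finset.sum_nonneg fun m _ => hD0 t j m ω, ?_, ?_⟩
  · rw [integral_finsetSum _ fun t _ => integrable_finsetSum _ fun j _ =>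
      integrable_finsetSum _ fun m _ => hDi t j m]
    calc _ ≤ ∑ t ∈ Finset.range (2 ^ c), ∑ j ∈ Finset.range (2 ^ b), ∑ m ∈ Finset.range (2 ^ b),
          |C| * ((a + 1) ^ 2 * 2 ^ a) := by
          refine Finset.sum_le_sum fun t _ => ?_
          rw [integral_finsetSum _ fun j _ => integrable_finsetSum _ fun m _ => hDi t j m]
          refine Finset.sum_le_sum fun j _ => ?_
          rw [integral_finsetSum _ fun m _ => hDi t j m]
          refine Finset.sum_le_sum fun m _ => (hDint t j m).trans (le_of_eq ?_)
          simp
      _ = |C| * ((a + 1) ^ 2 * 1 * 1 * ((2 ^ a) ^ 1 * (2 ^ b) ^ 2 * (2 ^ c) ^ 1)) := by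
          simp; ring
      _ ≤ _ := by
          gcongr
          · exact one_le_pow₀ (by linarith [(Nat.cast_nonneg b : (0 : ℝ) ≤ b)])
          · exact one_le_pow₀ (by linarith [(Nat.cast_nonneg c : (0 : ℝ) ≤ c)])
  · intro ω n₁ n₂ n₃ h₁ h₂ h₃
    have hsub : Finset.range n₂ ⊆ Finset.range (2 ^ b) := Finset.range_subset_range.2 h₂
    have hsub3 : Finset.range n₃ ⊆ Finset.range (2 ^ c) := Finset.range_subset_range.2 h₃
    calc _ ≤ ∑ t ∈ Finset.range n₃, ∑ j ∈ Finset.range n₂, ∑ m ∈ Finset.range n₂, D t j m ω := by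
          refine Finset.sum_le_sum fun t _ => Finset.sum_le_sum fun j _ =>
            Finset.sum_le_sum fun m _ => ?_
          simpa using hDY t j m ω n₁ 1 1 h₁ (by simp) (by simp)
      _ ≤ ∑ t ∈ Finset.range n₃, ∑ j ∈ Finset.range (2 ^ b), ∑ m ∈ Finset.range (2 ^ b),
            D t j m ω := by
          refine Finset.sum_le_sum fun t _ => ?_
          refine (Finset.sum_le_sum fun j _ => Finset.sum_le_sum_of_subset_of_nonneg hsub
            fun m _ _ => hD0 t j m ω).trans ?_
          exact Finset.sum_le_sum_of_subset_of_nonneg hsub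
            fun j _ _ => Finset.sum_nonneg fun m _ => hD0 t j m ω
      _ ≤ _ := Finset.sum_le_sum_of_subset_of_nonneg hsub3
            fun t _ _ => Finset.sum_nonneg fun j _ => Finset.sum_nonneg fun m _ => hD0 t j m ω

/-- Here all three sums are signed, so the full three-index chaining is used; it feeds the strong
law for the average squared error. -/
lemma FactorModel.ErrorCond.ae_sq_sum_le {k₁ k₂ : ℕ} {S : FactorModel Ω k₁ k₂}
    (h : S.ErrorCond P) {s : ℝ} (hs : 0 < s) :
    ∀ᵐ ω ∂P, ∃ K : ℝ, 0 ≤ K ∧ ∀ n₁ n₂ n₃ : ℕ, 0 < n₁ → 0 < n₂ → 0 < n₃ →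
      (∑ i ∈ Finset.range n₁, ∑ j ∈ Finset.range n₂, ∑ t ∈ Finset.range n₃,
        rowDev S.e P i i j t ω) ^ 2 ≤
      K * ((n₁ : ℝ) * n₂ * n₃) * ((n₁ : ℝ) * n₂ * n₃) ^ s := by
  obtain ⟨C, hC⟩ := h.cov_sq
  have hw := h.weakDependence
  have := ae_exists_bound_of_dominating (P := P) 1 1 1 1 le_rfl le_rfl le_rfl
    (Y := fun n₁ n₂ n₃ ω => (∑ i ∈ Finset.range n₁, ∑ j ∈ Finset.range n₂,
      ∑ t ∈ Finset.range n₃, rowDev S.e P i i j t ω) ^ 2) (C := C) ?_ hs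
  · simpa only [pow_one] using this
  intro a b c
  obtain ⟨D, hDi, hD0, hDint, hDY⟩ := exists_dominating_sq_sum (P := P)
    (X := fun i j t => rowDev S.e P i i j t) (fun i j t => hw.memLp_rowDev i i j t) (C := C)
    (a := a) (b := b) (c := c) fun s₁ h₁ s₂ h₂ s₃ h₃ =>
      integral_sq_box_le (fun i j t => hw.memLp_rowDev i i j t) h₁ h₂ h₃
        fun i hi j hj t ht => hC _ _ _ i hi j hj t ht
  refine ⟨D, hDi, hD0, hDint.trans (le_of_eq ?_), fun ω n₁ n₂ n₃ h₁ h₂ h₃ =>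
    hDY ω n₁ n₂ n₃ h₁ h₂ h₃⟩
  simp [pow_add]

end Errors

/-! ### Operator bounds for the error part. -/

/-- The quadratic form `∑ₜ |E_t' x|²`. -/
def errForm (e : ℕ → ℕ → ℕ → ℝ) (p₁ p₂ T : ℕ) (x : Fin p₁ → ℝ) : ℝ :=
  ∑ t ∈ Finset.range T, ∑ j : Fin p₂, (∑ i : Fin p₁, x i * e i j t) ^ 2

lemma tendsto_triple_fst : Tendsto (fun p : ℕ × ℕ × ℕ => p.1) atTop atTop := by
  rw [← prod_atTop_atTop_eq]; exact tendsto_fst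

lemma tendsto_triple_snd : Tendsto (fun p : ℕ × ℕ × ℕ => p.2.1) atTop atTop := by
  rw [← prod_atTop_atTop_eq, ← prod_atTop_atTop_eq]; exact tendsto_fst.comp tendsto_snd

lemma tendsto_triple_thd : Tendsto (fun p : ℕ × ℕ × ℕ => p.2.2) atTop atTop := by
  rw [← prod_atTop_atTop_eq, ← prod_atTop_atTop_eq]; exact tendsto_snd.comp tendsto_snd

lemma eventually_triple_pos : ∀ᶠ p : ℕ × ℕ × ℕ in atTop, 0 < p.1 ∧ 0 < p.2.1 ∧ 0 < p.2.2 :=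
  (tendsto_triple_fst.eventually_gt_atTop 0).and
    ((tendsto_triple_snd.eventually_gt_atTop 0).and (tendsto_triple_thd.eventually_gt_atTop 0))

lemma tendsto_natCast_triple_fst : Tendsto (fun p : ℕ × ℕ × ℕ => (p.1 : ℝ)) atTop atTop :=
  tendsto_natCast_atTop_atTop.comp tendsto_triple_fst

lemma tendsto_natCast_triple_snd : Tendsto (fun p : ℕ × ℕ × ℕ => (p.2.1 : ℝ)) atTop atTop :=
  tendsto_natCast_atTop_atTop.comp tendsto_triple_snd

lemma tendsto_natCast_triple_thd : Tendsto (fun p : ℕ × ℕ × ℕ => (p.2.2 : ℝ)) atTop atTop :=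
  tendsto_natCast_atTop_atTop.comp tendsto_triple_thd

section Bounds

variable {Ω : Type*} [MeasurableSpace Ω] {P : Measure Ω}
  {e : ℕ → ℕ → ℕ → Ω → ℝ}

/-- The pair (t, j) indexes the linear forms in `sum_sq_linear_le`; the mean Gram matrix has row
sums at most T p₂ c. -/
lemma errForm_le_of_row {c D : ℝ} {p₁ p₂ T : ℕ}
    (hc : ∀ i < p₁, ∀ j t, ∑ l ∈ Finset.range p₁, |∫ ω, e i j t ω * e l j t ω ∂P| ≤ c) {ω : Ω}
    (hD : ∑ i ∈ Finset.range p₁, ∑ l ∈ Finset.range p₁,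
        (∑ j ∈ Finset.range p₂, ∑ t ∈ Finset.range T, rowDev e P i l j t ω) ^ 2 ≤ D)
    (x : Fin p₁ → ℝ) :
    errForm (fun i j t => e i j t ω) p₁ p₂ T x ≤ (T * p₂ * c + √D) * ∑ i, x i ^ 2 := by
  have key := sum_sq_linear_le (Finset.range T ×ˢ (Finset.univ : Finset (Fin p₂)))
    (fun (i : Fin p₁) k => e i k.2 k.1 ω)
    (fun i l => ∑ t ∈ Finset.range T, ∑ j : Fin p₂, ∫ ω, e i j t ω * e l j t ω ∂P)
    (fun i l => by simp only [mul_comm]) (c := T * p₂ * c) (fun i => by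
      calc _ ≤ ∑ l : Fin p₁, ∑ t ∈ Finset.range T, ∑ j : Fin p₂,
            |∫ ω, e i j t ω * e l j t ω ∂P| := Finset.sum_le_sum fun l _ =>
            (Finset.abs_sum_le_sum_abs _ _).trans (Finset.sum_le_sum fun t _ =>
              Finset.abs_sum_le_sum_abs _ _)
        _ = ∑ t ∈ Finset.range T, ∑ j : Fin p₂, ∑ l : Fin p₁,
            |∫ ω, e i j t ω * e l j t ω ∂P| := by
            rw [Finset.sum_comm]
            exact Finset.sum_congr rfl fun t _ => Finset.sum_comm
        _ ≤ ∑ t ∈ Finset.range T, ∑ j : Fin p₂, c := Finset.sum_le_sum fun t _ =>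
            Finset.sum_le_sum fun j _ => by
              rw [← Finset.sum_range (fun l => |∫ ω, e i j t ω * e l j t ω ∂P|)]
              exact hc i i.2 j t
        _ = T * p₂ * c := by simp [mul_assoc]) x
  simp only [Finset.sum_product] at key
  refine key.trans ?_
  refine mul_le_mul_of_nonneg_right (add_le_add le_rfl (Real.sqrt_le_sqrt ?_))
    (Finset.sum_nonneg fun i _ => sq_nonneg _)
  refine le_trans (le_of_eq ?_) hD
  rw [Finset.sum_range]
  refine Finset.sum_congr rfl fun i _ => ?_
  rw [Finset.sum_range]
  refine Finset.sum_congr rfl fun l _ => ?_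
  congr 1
  rw [← Finset.sum_sub_distrib, Finset.sum_comm (s := Finset.range p₂)]
  refine Finset.sum_congr rfl fun t _ => ?_
  rw [← Finset.sum_sub_distrib, Finset.sum_range]
  rfl

/-- Useful when p₁ is large compared with p₂T, where the row Gram deviation is too big. In each
period E_t'E_t has the same top eigenvalue as E_tE_t', so the p₂ × p₂ Gram matrix can be used
instead. -/
lemma errForm_le_of_col {c D : ℝ} {p₁ p₂ T : ℕ} (hp : 0 < p₂)
    (hc : ∀ j < p₂, ∀ i t, ∑ h ∈ Finset.range p₂, |∫ ω, e i j t ω * e i h t ω ∂P| ≤ c) {ω : Ω}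
    (hD : ∑ t ∈ Finset.range T, ∑ j ∈ Finset.range p₂, ∑ m ∈ Finset.range p₂,
        (∑ i ∈ Finset.range p₁, rowDev (fun i j t => e j i t) P j m i t ω) ^ 2 ≤ D)
    (x : Fin p₁ → ℝ) :
    errForm (fun i j t => e i j t ω) p₁ p₂ T x ≤ (T * p₁ * c + √(T * D)) * ∑ i, x i ^ 2 := by
  set d : ℕ → ℝ := fun t => ∑ j ∈ Finset.range p₂, ∑ m ∈ Finset.range p₂,
        (∑ i ∈ Finset.range p₁, rowDev (fun i j t => e j i t) P j m i t ω) ^ 2 with hd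
  have hd0 : ∀ t, 0 ≤ d t := fun t => by positivity
  have hx0 : 0 ≤ ∑ i, x i ^ 2 := Finset.sum_nonneg fun i _ => sq_nonneg _
  have hq : ∀ t, ∑ j : Fin p₂, (∑ i : Fin p₁, x i * e i j t ω) ^ 2 ≤
      (p₁ * c + √(d t)) * ∑ i, x i ^ 2 := by
    intro t
    set y : Fin p₂ → ℝ := fun j => ∑ i : Fin p₁, x i * e i j t ω
    have h1 := errForm_le_of_row (P := P) (e := fun i j _ => e j i t) (p₁ := p₂) (p₂ := p₁)
      (T := 1) (c := c) (D := d t) (fun j hj i _ => hc j hj i t) (ω := ω)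
      (by simp only [Finset.sum_range_one]; exact le_rfl) y
    simp only [errForm, Finset.sum_range_one, Nat.cast_one, one_mul] at h1
    -- Duality: with y = E_t'x, |y|² = ⟨x, E_t y⟩, then Cauchy–Schwarz. Dividing by |y|² below
    -- bounds |E_t'x|² by the form in y.
    have h2 : (∑ j, y j ^ 2) ^ 2 ≤
        (∑ i, x i ^ 2) * ∑ i : Fin p₁, (∑ j, y j * e i j t ω) ^ 2 := by
      have e1 : ∑ j, y j ^ 2 = ∑ i, x i * ∑ j, y j * e i j t ω := by
        simp only [Finset.mul_sum]
        rw [Finset.sum_comm]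
        refine Finset.sum_congr rfl fun j _ => ?_
        rw [sq]
        nth_rewrite 2 [show y j = ∑ i : Fin p₁, x i * e i j t ω from rfl]
        rw [Finset.mul_sum]
        exact Finset.sum_congr rfl fun i _ => by ring
      rw [e1]
      exact Finset.sum_mul_sq_le_sq_mul_sq _ _ _
    have hy0 : 0 ≤ ∑ j, y j ^ 2 := Finset.sum_nonneg fun i _ => sq_nonneg _
    rcases hy0.eq_or_lt with h0 | h0
    · rw [← h0]
      have hc0 : 0 ≤ c := le_trans (by positivity) (hc 0 hp 0 0)
      positivity
    · have h3 : (∑ j, y j ^ 2) * (∑ j, y j ^ 2) ≤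
          ((p₁ * c + √(d t)) * ∑ i, x i ^ 2) * ∑ j, y j ^ 2 := by
        calc _ = (∑ j, y j ^ 2) ^ 2 := by ring
          _ ≤ _ := h2
          _ ≤ (∑ i, x i ^ 2) * ((p₁ * c + √(d t)) * ∑ j, y j ^ 2) :=
              mul_le_mul_of_nonneg_left h1 hx0
          _ = _ := by ring
      exact le_of_mul_le_mul_right h3 h0
  calc errForm (fun i j t => e i j t ω) p₁ p₂ T x
      ≤ ∑ t ∈ Finset.range T, (p₁ * c + √(d t)) * ∑ i, x i ^ 2 :=
        Finset.sum_le_sum fun t _ => hq t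
    _ = (T * p₁ * c + ∑ t ∈ Finset.range T, √(d t)) * ∑ i, x i ^ 2 := by
        rw [← Finset.sum_mul, Finset.sum_add_distrib]; simp [mul_assoc]
    _ ≤ _ := by
        refine mul_le_mul_of_nonneg_right (add_le_add le_rfl ?_) hx0
        -- Cauchy–Schwarz over the T periods.
        refine Real.le_sqrt_of_sq_le ?_
        refine sq_sum_le_card_mul_sum_sq.trans ?_
        rw [Finset.card_range]
        refine mul_le_mul_of_nonneg_left ?_ (Nat.cast_nonneg T)
        refine le_trans (le_of_eq (Finset.sum_congr rfl fun t _ => ?_)) hD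
        exact Real.sq_sqrt (hd0 t)

end Bounds

lemma tendsto_natCast_triple_mul :
    Tendsto (fun p : ℕ × ℕ × ℕ => (p.2.1 : ℝ) * p.2.2) atTop atTop :=
  tendsto_natCast_triple_snd.atTop_mul_atTop₀ tendsto_natCast_triple_thd

section Bounds

variable {Ω : Type*} [MeasurableSpace Ω] {P : Measure Ω} [IsProbabilityMeasure P]
  {e : ℕ → ℕ → ℕ → Ω → ℝ}

lemma rpow_quarter_le_sqrt {x y : ℝ} (hx : 0 ≤ x) (hy : 0 ≤ y) (h : x ≤ y ^ 2) :
    x ^ (1 / 4 : ℝ) ≤ √y := by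
  calc x ^ (1 / 4 : ℝ) ≤ (y ^ 2) ^ (1 / 4 : ℝ) := Real.rpow_le_rpow hx h (by norm_num)
    _ = √y := by
        rw [← Real.rpow_natCast, ← Real.rpow_mul hy, Real.sqrt_eq_rpow]; norm_num

/-- Uniformly in the errors, `λ_max (∑ₜ E_t E_t') = o(p₁ p₂ T)`. -/
lemma WeakDependence.ae_errForm_isLittleO (h : WeakDependence e P) :
    ∀ᵐ ω ∂P, ∃ B : ℕ × ℕ × ℕ → ℝ, (∀ p, 0 ≤ B p) ∧
      (∀ p : ℕ × ℕ × ℕ, 0 < p.1 → 0 < p.2.1 → 0 < p.2.2 → ∀ x,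
        errForm (fun i j t => e i j t ω) p.1 p.2.1 p.2.2 x ≤
          p.2.2 * p.2.1 * B p * ∑ i, x i ^ 2) ∧
      Tendsto (fun p => B p / p.1) atTop (𝓝 0) := by
  obtain ⟨c₁, hc₁⟩ := h.weak_row
  obtain ⟨c₂, hc₂⟩ := h.weak_col
  filter_upwards [h.ae_sum_sq_rowDev_le (s := 1 / 4) (by norm_num),
    h.ae_sum_sq_colDev_le (s := 1 / 4) (by norm_num)] with ω h₁ h₂
  obtain ⟨K₁, hK₁, h₁⟩ := h₁
  obtain ⟨K₂, hK₂, h₂⟩ := h₂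
  -- With N = p₁p₂T and power loss N^{1/4}: if p₁ ≤ p₂T then N ≤ (p₂T)² and the row bound is o(p₁);
  -- otherwise N ≤ p₁² and the column bound is.
  let B : ℕ × ℕ × ℕ → ℝ := fun p =>
    if (p.1 : ℝ) ≤ p.2.1 * p.2.2 then |c₁| + p.1 * √(K₁ / √(p.2.1 * p.2.2))
    else |c₂| * p.1 / p.2.1 + p.1 * √(K₂ / √p.1)
  have hB : ∀ p, 0 ≤ B p := fun p => by simp only [B]; split_ifs <;> positivity
  refine ⟨B, hB, ?_, ?_⟩
  · rintro ⟨p₁, p₂, T⟩ hp₁ hp₂ hT x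
    simp only at hp₁ hp₂ hT ⊢
    have q₁ : (0 : ℝ) < p₁ := by exact_mod_cast hp₁
    have q₂ : (0 : ℝ) < p₂ := by exact_mod_cast hp₂
    have qT : (0 : ℝ) < T := by exact_mod_cast hT
    have hx0 : 0 ≤ ∑ i, x i ^ 2 := Finset.sum_nonneg fun i _ => sq_nonneg _
    by_cases hc : (p₁ : ℝ) ≤ p₂ * T
    · refine (errForm_le_of_row (hc₁ p₁) (h₁ p₁ p₂ T hp₁ hp₂ hT) x).trans ?_
      refine mul_le_mul_of_nonneg_right ?_ hx0
      simp only [B, if_pos hc]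
      have hN : ((p₁ : ℝ) * p₂ * T) ^ (1 / 4 : ℝ) ≤ √(p₂ * T) :=
        rpow_quarter_le_sqrt (by positivity) (by positivity) (by
          rw [mul_assoc, sq]; gcongr)
      have hD : √(K₁ * ((p₁ : ℝ) ^ 2 * p₂ * T) * ((p₁ : ℝ) * p₂ * T) ^ (1 / 4 : ℝ)) ≤
          T * p₂ * (p₁ * √(K₁ / √(p₂ * T))) := by
        rw [Real.sqrt_le_left (by positivity)]
        have hs : 0 < √((p₂ : ℝ) * T) := Real.sqrt_pos.2 (by positivity)
        have e1 : ((T : ℝ) * p₂ * (p₁ * √(K₁ / √(p₂ * T)))) ^ 2 =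
            K₁ * ((p₁ : ℝ) ^ 2 * p₂ * T) * √(p₂ * T) := by
          rw [mul_pow, mul_pow _ (√(K₁ / _)), Real.sq_sqrt (by positivity)]
          field_simp
          rw [sq (√_), Real.mul_self_sqrt (by positivity)]; ring
        rw [e1]
        gcongr
      have : (T : ℝ) * p₂ * c₁ ≤ T * p₂ * |c₁| := by gcongr; exact le_abs_self _
      nlinarith
    · refine (errForm_le_of_col hp₂ (hc₂ p₂) (h₂ p₁ p₂ T hp₁ hp₂ hT) x).trans ?_
      refine mul_le_mul_of_nonneg_right ?_ hx0
      simp only [B, if_neg hc]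
      push Not at hc
      have hN : ((p₁ : ℝ) * p₂ * T) ^ (1 / 4 : ℝ) ≤ √p₁ :=
        rpow_quarter_le_sqrt (by positivity) (by positivity) (by
          rw [mul_assoc, sq]; gcongr)
      have hD : √(T * (K₂ * (p₁ * (p₂ : ℝ) ^ 2 * T) * ((p₁ : ℝ) * p₂ * T) ^ (1 / 4 : ℝ))) ≤
          T * p₂ * (p₁ * √(K₂ / √p₁)) := by
        rw [Real.sqrt_le_left (by positivity)]
        have hs : 0 < √(p₁ : ℝ) := Real.sqrt_pos.2 (by positivity)
        have e1 : ((T : ℝ) * p₂ * (p₁ * √(K₂ / √p₁))) ^ 2 =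
            T * (K₂ * (p₁ * (p₂ : ℝ) ^ 2 * T) * √p₁) := by
          rw [mul_pow, mul_pow _ (√(K₂ / _)), Real.sq_sqrt (by positivity)]
          field_simp
          rw [sq (√_), Real.mul_self_sqrt (by positivity)]; ring
        rw [e1]
        gcongr
      have h3 : (T : ℝ) * p₁ * c₂ ≤ T * p₁ * |c₂| := by gcongr; exact le_abs_self _
      have h4 : (T : ℝ) * p₂ * (|c₂| * p₁ / p₂) = T * p₁ * |c₂| := by field_simp
      nlinarith
  · have hlim : Tendsto (fun p : ℕ × ℕ × ℕ => |c₁| / (p.1 : ℝ) + |c₂| / (p.2.1 : ℝ) +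
        √(K₁ / √(p.2.1 * p.2.2)) + √(K₂ / √p.1)) atTop (𝓝 0) := by
      have t1 : Tendsto (fun p : ℕ × ℕ × ℕ => |c₁| / (p.1 : ℝ)) atTop (𝓝 0) :=
        tendsto_natCast_triple_fst.const_div_atTop _
      have t2 : Tendsto (fun p : ℕ × ℕ × ℕ => |c₂| / (p.2.1 : ℝ)) atTop (𝓝 0) :=
        tendsto_natCast_triple_snd.const_div_atTop _
      have t3 : Tendsto (fun p : ℕ × ℕ × ℕ => √(K₁ / √((p.2.1 : ℝ) * p.2.2))) atTop (𝓝 0) := by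
        have := (Real.tendsto_sqrt_atTop.comp tendsto_natCast_triple_mul).const_div_atTop K₁
        simpa using this.sqrt
      have t4 : Tendsto (fun p : ℕ × ℕ × ℕ => √(K₂ / √(p.1 : ℝ))) atTop (𝓝 0) := by
        have := (Real.tendsto_sqrt_atTop.comp tendsto_natCast_triple_fst).const_div_atTop K₂
        simpa using this.sqrt
      simpa using ((t1.add t2).add t3).add t4
    refine squeeze_zero' (Eventually.of_forall fun p => div_nonneg (hB p) (Nat.cast_nonneg _))
      ?_ hlim
    filter_upwards [eventually_triple_pos] with p hp
    have q₁ : (0 : ℝ) < p.1 := by exact_mod_cast hp.1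
    have q₂ : (0 : ℝ) < p.2.1 := by exact_mod_cast hp.2.1
    have n1 : 0 ≤ |c₁| / (p.1 : ℝ) := by positivity
    have n2 : 0 ≤ |c₂| / (p.2.1 : ℝ) := by positivity
    have n3 := Real.sqrt_nonneg (K₁ / √((p.2.1 : ℝ) * p.2.2))
    have n4 := Real.sqrt_nonneg (K₂ / √(p.1 : ℝ))
    by_cases hc : (p.1 : ℝ) ≤ p.2.1 * p.2.2
    · simp only [B, if_pos hc]
      rw [add_div, mul_div_cancel_left₀ _ q₁.ne']
      linarith
    · simp only [B, if_neg hc]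
      rw [add_div, mul_div_cancel_left₀ _ q₁.ne']
      have : |c₂| * (p.1 : ℝ) / p.2.1 / p.1 = |c₂| / p.2.1 := by field_simp
      rw [this]; linarith

/-- Since p₁^{1/(2β)} = √(p₂T), the exponent is max(0, 1 - 1/(2β)) + ε, and both bounds hold
whichever branch defines it. -/
lemma rpow_neg_deltaExp_le {ε : ℝ} {p₁ p₂ T : ℕ} (hp₁ : 2 ≤ p₁) (hm : 2 ≤ p₂ * T) :
    (p₁ : ℝ) ^ (-deltaExp ε p₁ p₂ T) ≤ (p₁ : ℝ) ^ (-ε) ∧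
    (p₁ : ℝ) ^ (-deltaExp ε p₁ p₂ T) ≤ (p₁ : ℝ) ^ (-ε) * (√(p₂ * T) / p₁) := by
  have q₁ : (2 : ℝ) ≤ p₁ := by exact_mod_cast hp₁
  have qm : (2 : ℝ) ≤ p₂ * T := by exact_mod_cast hm
  have l₁ : 0 < Real.log p₁ := Real.log_pos (by linarith)
  have lm : 0 < Real.log (p₂ * T) := Real.log_pos (by linarith)
  have hs : (1 : ℝ) ≤ √(p₂ * T) := Real.one_le_sqrt.2 (by linarith)
  have hp0 : (0 : ℝ) < p₁ := by linarith
  have hexp : (p₁ : ℝ) ^ (1 / (2 * (Real.log p₁ / Real.log (p₂ * T)))) = √(p₂ * T) := by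
    rw [Real.rpow_def_of_pos hp0, Real.sqrt_eq_rpow, Real.rpow_def_of_pos (by linarith)]
    congr 1
    field_simp
  unfold deltaExp
  split_ifs with hβ
  · refine ⟨le_rfl, ?_⟩
    have h1 : (1 : ℝ) ≤ √(p₂ * T) / p₁ := by
      rw [one_le_div hp0, ← hexp]
      nth_rewrite 1 [← Real.rpow_one (p₁ : ℝ)]
      refine Real.rpow_le_rpow_of_exponent_le (by linarith) ?_
      rw [one_le_div (by positivity)]; linarith
    have := Real.rpow_nonneg hp0.le (-ε)
    nlinarith
  · push Not at hβ
    constructor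
    · refine Real.rpow_le_rpow_of_exponent_le (by linarith) ?_
      have : 1 / (2 * (Real.log p₁ / Real.log (p₂ * T))) ≤ 1 := by
        rw [div_le_one (by positivity)]; linarith
      linarith
    · rw [show -(1 - 1 / (2 * (Real.log p₁ / Real.log (p₂ * T))) + ε) =
        -ε + (1 / (2 * (Real.log p₁ / Real.log (p₂ * T))) - 1) by ring,
        Real.rpow_add hp0, Real.rpow_sub hp0, hexp, Real.rpow_one]

/-- The spectral norm of the error part is negligible at the scale `p₁ ^ δ`. -/
lemma WeakDependence.ae_errForm_deltaExp (h : WeakDependence e P) {ε : ℝ} (hε : 0 < ε) :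
    ∀ᵐ ω ∂P, ∃ B : ℕ × ℕ × ℕ → ℝ, (∀ p, 0 ≤ B p) ∧
      (∀ p : ℕ × ℕ × ℕ, 0 < p.1 → 0 < p.2.1 → 0 < p.2.2 → ∀ x,
        errForm (fun i j t => e i j t ω) p.1 p.2.1 p.2.2 x ≤
          p.2.2 * p.2.1 * B p * ∑ i, x i ^ 2) ∧
      Tendsto (fun p : ℕ × ℕ × ℕ => (p.1 : ℝ) ^ (-deltaExp ε p.1 p.2.1 p.2.2) * B p)
        atTop (𝓝 0) := by
  obtain ⟨c₁, hc₁⟩ := h.weak_row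
  -- The two bounds on s serve the two cases below: (5/4)(s/2) ≤ 1/8 and 5(s/2) ≤ ε/2.
  set s : ℝ := min (1 / 5) (ε / 5) with hs
  have hs0 : 0 < s := lt_min (by norm_num) (by positivity)
  have hs1 : s ≤ 1 / 5 := min_le_left _ _
  have hs2 : s ≤ ε / 5 := min_le_right _ _
  filter_upwards [h.ae_sum_sq_rowDev_le hs0] with ω h₁
  obtain ⟨K, hK, h₁⟩ := h₁
  let B : ℕ × ℕ × ℕ → ℝ := fun p =>
    |c₁| + √K * (p.1 * ((p.1 : ℝ) * p.2.1 * p.2.2) ^ (s / 2) / √(p.2.1 * p.2.2))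
  have hB : ∀ p, 0 ≤ B p := fun p => by simp only [B]; positivity
  refine ⟨B, hB, ?_, ?_⟩
  · rintro ⟨p₁, p₂, T⟩ hp₁ hp₂ hT x
    simp only at hp₁ hp₂ hT ⊢
    have q₁ : (0 : ℝ) < p₁ := by exact_mod_cast hp₁
    have q₂ : (0 : ℝ) < p₂ := by exact_mod_cast hp₂
    have qT : (0 : ℝ) < T := by exact_mod_cast hT
    have hx0 : 0 ≤ ∑ i, x i ^ 2 := Finset.sum_nonneg fun i _ => sq_nonneg _
    refine (errForm_le_of_row (hc₁ p₁) (h₁ p₁ p₂ T hp₁ hp₂ hT) x).trans ?_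
    refine mul_le_mul_of_nonneg_right ?_ hx0
    have hD : √(K * ((p₁ : ℝ) ^ 2 * p₂ * T) * ((p₁ : ℝ) * p₂ * T) ^ s) =
        T * p₂ * (√K * (p₁ * ((p₁ : ℝ) * p₂ * T) ^ (s / 2) / √(p₂ * T))) := by
      rw [Real.sqrt_eq_iff_eq_sq (by positivity) (by positivity)]
      have e0 : (((p₁ : ℝ) * p₂ * T) ^ (s / 2)) ^ 2 = ((p₁ : ℝ) * p₂ * T) ^ s := by
        rw [← Real.rpow_natCast, ← Real.rpow_mul (by positivity)]; congr 1; push_cast; ring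
      rw [mul_pow, mul_pow (√K), Real.sq_sqrt hK, div_pow, Real.sq_sqrt (by positivity), mul_pow,
        mul_pow (p₁ : ℝ), e0]
      field_simp
    have : (T : ℝ) * p₂ * c₁ ≤ T * p₂ * |c₁| := by gcongr; exact le_abs_self _
    simp only [B]
    rw [hD]; nlinarith
  · have hlim : Tendsto (fun p : ℕ × ℕ × ℕ => |c₁| * (p.1 : ℝ) ^ (-ε) +
        √K * ((((p.2.1 : ℝ) * p.2.2) ^ (-(1 / 8) : ℝ)) + (p.1 : ℝ) ^ (-(ε / 2)))) atTop (𝓝 0) := by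
      have t1 := (tendsto_rpow_neg_atTop hε).comp tendsto_natCast_triple_fst
      have t2 := (tendsto_rpow_neg_atTop (show (0 : ℝ) < 1 / 8 by norm_num)).comp
        tendsto_natCast_triple_mul
      have t3 := (tendsto_rpow_neg_atTop (half_pos hε)).comp tendsto_natCast_triple_fst
      simpa using (t1.const_mul |c₁|).add ((t2.add t3).const_mul (√K))
    refine squeeze_zero' (Eventually.of_forall fun p => mul_nonneg (by positivity) (hB p)) ?_ hlim
    filter_upwards [eventually_triple_pos, tendsto_triple_fst.eventually_ge_atTop 2,
      tendsto_triple_snd.eventually_ge_atTop 2] with p hp hp1 hp2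
    obtain ⟨p₁, p₂, T⟩ := p
    simp only at hp hp1 hp2 ⊢
    have hm2 : 2 ≤ p₂ * T := by nlinarith [hp.2.2]
    obtain ⟨d1, d2⟩ := rpow_neg_deltaExp_le (ε := ε) hp1 hm2
    have q₁ : (2 : ℝ) ≤ p₁ := by exact_mod_cast hp1
    have qm : (2 : ℝ) ≤ p₂ * T := by exact_mod_cast hm2
    set m : ℝ := (p₂ : ℝ) * T with hm
    set δ := deltaExp ε p₁ p₂ T
    have hp0 : (0 : ℝ) < p₁ := by linarith
    have hm0 : 0 < m := by linarith
    have hsm : 0 < √m := Real.sqrt_pos.2 hm0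
    have hmain : (p₁ : ℝ) ^ (-δ) * (p₁ * ((p₁ : ℝ) * p₂ * T) ^ (s / 2) / √m) ≤
        m ^ (-(1 / 8) : ℝ) + (p₁ : ℝ) ^ (-(ε / 2)) := by
      rw [mul_assoc (p₁ : ℝ) p₂ T, ← hm]
      have n1 : 0 ≤ m ^ (-(1 / 8) : ℝ) := by positivity
      have n2 : 0 ≤ (p₁ : ℝ) ^ (-(ε / 2)) := by positivity
      -- The gain p₁^{-ε} absorbs the loss (p₁m)^{s/2} only if m is at most a power of p₁. Otherwise
      -- p₁/√m ≤ m^{-1/4} decays by itself.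
      by_cases hc : (p₁ : ℝ) ≤ m ^ (1 / 4 : ℝ)
      · have h3 : (p₁ : ℝ) ^ (-δ) ≤ 1 := d1.trans
          (Real.rpow_le_one_of_one_le_of_nonpos (by linarith) (by linarith))
        have h4 : ((p₁ : ℝ) * m) ^ (s / 2) ≤ m ^ (1 / 8 : ℝ) := by
          calc ((p₁ : ℝ) * m) ^ (s / 2) ≤ (m ^ (1 / 4 : ℝ) * m) ^ (s / 2) := by gcongr
            _ = m ^ ((5 / 4) * (s / 2)) := by
                nth_rewrite 2 [← Real.rpow_one m]
                rw [← Real.rpow_add hm0, ← Real.rpow_mul hm0.le]; norm_num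
            _ ≤ m ^ (1 / 8 : ℝ) := Real.rpow_le_rpow_of_exponent_le (by linarith) (by linarith)
        calc _ ≤ 1 * (m ^ (1 / 4 : ℝ) * m ^ (1 / 8 : ℝ) / √m) := by gcongr
          _ = m ^ (-(1 / 8) : ℝ) := by
              rw [one_mul, Real.sqrt_eq_rpow, ← Real.rpow_add hm0, ← Real.rpow_sub hm0]; norm_num
          _ ≤ _ := by linarith
      · push Not at hc
        have h3 : m ≤ (p₁ : ℝ) ^ (4 : ℝ) := by
          calc m = (m ^ (1 / 4 : ℝ)) ^ (4 : ℝ) := by rw [← Real.rpow_mul hm0.le]; norm_num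
            _ ≤ _ := Real.rpow_le_rpow (by positivity) hc.le (by norm_num)
        have h4 : ((p₁ : ℝ) * m) ^ (s / 2) ≤ (p₁ : ℝ) ^ (ε / 2) := by
          calc ((p₁ : ℝ) * m) ^ (s / 2) ≤ (p₁ * (p₁ : ℝ) ^ (4 : ℝ)) ^ (s / 2) := by gcongr
            _ = (p₁ : ℝ) ^ (5 * (s / 2)) := by
                nth_rewrite 1 [← Real.rpow_one (p₁ : ℝ)]
                rw [← Real.rpow_add hp0, ← Real.rpow_mul hp0.le]; norm_num
            _ ≤ _ := Real.rpow_le_rpow_of_exponent_le (by linarith) (by linarith)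
        calc _ ≤ (p₁ : ℝ) ^ (-ε) * (√m / p₁) * (p₁ * (p₁ : ℝ) ^ (ε / 2) / √m) := by gcongr
          _ = (p₁ : ℝ) ^ (-ε) * (p₁ : ℝ) ^ (ε / 2) := by field_simp
          _ = (p₁ : ℝ) ^ (-(ε / 2)) := by rw [← Real.rpow_add hp0]; congr 1; ring
          _ ≤ _ := by linarith
    simp only [B]
    calc _ = |c₁| * (p₁ : ℝ) ^ (-δ) +
          √K * ((p₁ : ℝ) ^ (-δ) * (p₁ * ((p₁ : ℝ) * p₂ * T) ^ (s / 2) / √m)) := by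
          rw [hm]; ring
      _ ≤ _ := by gcongr

end Bounds

open Matrix

/-! ### Elementary inequalities for matrices and dot products. -/

section Algebra

lemma dotProduct_mul_transpose_mulVec {m n : Type*} [Fintype m] [Fintype n]
    (A : Matrix m n ℝ) (x : m → ℝ) : x ⬝ᵥ (A * Aᵀ) *ᵥ x = (Aᵀ *ᵥ x) ⬝ᵥ (Aᵀ *ᵥ x) := by
  rw [← mulVec_mulVec, dotProduct_mulVec, ← mulVec_transpose]

lemma dotProduct_transpose_mul_mulVec {m n : Type*} [Fintype m] [Fintype n]
    (A : Matrix m n ℝ) (x : n → ℝ) : x ⬝ᵥ (Aᵀ * A) *ᵥ x = (A *ᵥ x) ⬝ᵥ (A *ᵥ x) := by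
  simpa using dotProduct_mul_transpose_mulVec Aᵀ x

lemma dotProduct_self_eq_sum_sq {ι : Type*} [Fintype ι] (x : ι → ℝ) :
    x ⬝ᵥ x = ∑ i, x i ^ 2 := by simp [dotProduct, sq]

/-- Expand the squared norms of θf ± g. -/
lemma abs_two_mul_dotProduct_le {ι : Type*} [Fintype ι] (f g : ι → ℝ) {θ : ℝ} (hθ : 0 < θ) :
    |2 * (f ⬝ᵥ g)| ≤ θ * (f ⬝ᵥ f) + 1 / θ * (g ⬝ᵥ g) := by
  have e1 : (θ • f - g) ⬝ᵥ (θ • f - g) = θ ^ 2 * (f ⬝ᵥ f) - 2 * θ * (f ⬝ᵥ g) + g ⬝ᵥ g := by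
    simp only [sub_dotProduct, dotProduct_sub, smul_dotProduct, dotProduct_smul, smul_eq_mul]
    rw [dotProduct_comm g f]; ring
  have e2 : (θ • f + g) ⬝ᵥ (θ • f + g) = θ ^ 2 * (f ⬝ᵥ f) + 2 * θ * (f ⬝ᵥ g) + g ⬝ᵥ g := by
    simp only [add_dotProduct, dotProduct_add, smul_dotProduct, dotProduct_smul, smul_eq_mul]
    rw [dotProduct_comm g f]; ring
  have h1 := dotProduct_self_nonneg' (θ • f - g)
  have h2 := dotProduct_self_nonneg' (θ • f + g)
  rw [e1] at h1
  rw [e2] at h2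
  have e3 : θ * (f ⬝ᵥ f) + 1 / θ * (g ⬝ᵥ g) = (θ ^ 2 * (f ⬝ᵥ f) + g ⬝ᵥ g) / θ := by
    field_simp
  rw [e3]
  exact abs_le.2 ⟨by rw [neg_le, le_div_iff₀ hθ]; linarith, by rw [le_div_iff₀ hθ]; linarith⟩

lemma add_dotProduct_self_le {ι : Type*} [Fintype ι] (f g : ι → ℝ) :
    (f + g) ⬝ᵥ (f + g) ≤ 2 * (f ⬝ᵥ f) + 2 * (g ⬝ᵥ g) := by
  have h := (abs_le.1 (abs_two_mul_dotProduct_le f g one_pos)).2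
  have e : (f + g) ⬝ᵥ (f + g) = f ⬝ᵥ f + 2 * (f ⬝ᵥ g) + g ⬝ᵥ g := by
    simp only [add_dotProduct, dotProduct_add]; rw [dotProduct_comm g f]; ring
  rw [e]; linarith

/-- The entrywise `ℓ¹` norm. -/
def entrySum {m n : Type*} [Fintype m] [Fintype n] (A : Matrix m n ℝ) : ℝ := ∑ i, ∑ j, |A i j|

lemma entrySum_nonneg {m n : Type*} [Fintype m] [Fintype n] (A : Matrix m n ℝ) :
    0 ≤ entrySum A := Finset.sum_nonneg fun _ _ => Finset.sum_nonneg fun _ _ => abs_nonneg _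

/-- A crude bound, applied only to matrices of the fixed factor dimension, where entrywise
convergence is enough. -/
lemma abs_dotProduct_mulVec_le {n : Type*} [Fintype n] (A : Matrix n n ℝ) (y : n → ℝ) :
    |y ⬝ᵥ A *ᵥ y| ≤ entrySum A * (y ⬝ᵥ y) := by
  have h1 : y ⬝ᵥ A *ᵥ y = ∑ i, ∑ j, y i * A i j * y j := by
    simp only [dotProduct, mulVec, Finset.mul_sum, mul_assoc]
  have h2 : ∀ i, y i ^ 2 ≤ y ⬝ᵥ y := fun i => by
    rw [dotProduct_self_eq_sum_sq]
    exact Finset.single_le_sum (f := fun i => y i ^ 2) (fun _ _ => sq_nonneg _) (Finset.mem_univ i)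
  rw [h1, entrySum, Finset.sum_mul]
  refine (Finset.abs_sum_le_sum_abs _ _).trans (Finset.sum_le_sum fun i _ => ?_)
  rw [Finset.sum_mul]
  refine (Finset.abs_sum_le_sum_abs _ _).trans (Finset.sum_le_sum fun j _ => ?_)
  rw [abs_mul, abs_mul]
  have h3 : |y i| * |y j| ≤ y ⬝ᵥ y := by
    have := sq_nonneg (|y i| - |y j|)
    nlinarith [h2 i, h2 j, sq_abs (y i), sq_abs (y j)]
  calc |y i| * |A i j| * |y j| = |A i j| * (|y i| * |y j|) := by ring
    _ ≤ _ := mul_le_mul_of_nonneg_left h3 (abs_nonneg _)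

/-- Cauchy–Schwarz for each column of A. -/
lemma transpose_mulVec_dotProduct_self_le {m n : Type*} [Fintype m] [Fintype n]
    (A : Matrix m n ℝ) (x : m → ℝ) :
    (Aᵀ *ᵥ x) ⬝ᵥ (Aᵀ *ᵥ x) ≤ (Aᵀ * A).trace * (x ⬝ᵥ x) := by
  rw [dotProduct_self_eq_sum_sq, dotProduct_self_eq_sum_sq, trace, Finset.sum_mul]
  refine Finset.sum_le_sum fun a _ => ?_
  have := Finset.sum_mul_sq_le_sq_mul_sq Finset.univ (fun i => A i a) x
  simpa [mulVec, dotProduct, mul_apply, sq] using this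

lemma mulVec_dotProduct_self_le {m n : Type*} [Fintype m] [Fintype n]
    (A : Matrix m n ℝ) (w : n → ℝ) :
    (A *ᵥ w) ⬝ᵥ (A *ᵥ w) ≤ (Aᵀ * A).trace * (w ⬝ᵥ w) := by
  have := transpose_mulVec_dotProduct_self_le Aᵀ w
  rwa [transpose_transpose, trace_mul_comm] at this

lemma tendsto_entrySum {m n : Type*} [Fintype m] [Fintype n] {ι : Type*} {l : Filter ι}
    {A : ι → Matrix m n ℝ} {B : Matrix m n ℝ} (h : Tendsto A l (𝓝 B)) :
    Tendsto (fun p => entrySum (A p - B)) l (𝓝 0) := by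
  have h1 : ∀ i j, Tendsto (fun p => |(A p - B) i j|) l (𝓝 0) := fun i j => by
    have := ((tendsto_pi_nhds.1 (tendsto_pi_nhds.1 h i) j).sub_const (B i j)).abs
    simpa using this
  have := tendsto_finsetSum (s := Finset.univ) fun i _ =>
    tendsto_finsetSum (s := Finset.univ) fun j _ => h1 i j
  simpa [entrySum] using this

/-- σ is the smallest eigenvalue; in dimension 0 any positive number will do. -/
lemma PosDef.exists_lower_bound {k : ℕ} {A : Matrix (Fin k) (Fin k) ℝ} (hA : A.PosDef) :
    ∃ σ : ℝ, 0 < σ ∧ ∀ y, σ * (y ⬝ᵥ y) ≤ y ⬝ᵥ A *ᵥ y := by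
  rcases Nat.eq_zero_or_pos k with rfl | hk
  · exact ⟨1, one_pos, fun y => by simp⟩
  obtain ⟨V, hVV, hV, hAV⟩ := exists_orthogonal_diagonalization hA.1
  refine ⟨kthEig A k, ?_, fun y => ?_⟩
  · have := kthEig_eq hA.1 ⟨k - 1, by omega⟩
    simp only [Nat.sub_add_cancel hk] at this
    rw [this]
    have h2 := hA.eigenvalues_pos
      ((Fintype.equivOfCardEq (Fintype.card_fin _)) (Fin.cast (Fintype.card_fin k).symm ⟨k - 1, by omega⟩))
    simpa [IsHermitian.eigenvalues] using h2
  · rw [dotProduct_diagonalization hAV, dotProduct_orthogonal hV, Finset.mul_sum]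
    refine Finset.sum_le_sum fun i _ => mul_le_mul_of_nonneg_right ?_ (sq_nonneg _)
    have := kthEig_antitone hA.1 (a := i) (b := ⟨k - 1, by omega⟩) (by rw [Fin.le_def]; simp; omega)
    simpa [Nat.sub_add_cancel hk] using this

end Algebra

/-! ### Splitting `Mc` into a factor part and an error part. -/

namespace FactorModel

variable {Ω : Type*} {k₁ k₂ : ℕ} (S : FactorModel Ω k₁ k₂)

/-- The model with the roles of rows and columns exchanged. -/
def swap : FactorModel Ω k₂ k₁ := ⟨S.C, S.R, fun t ω => (S.F t ω)ᵀ, fun i j t => S.e j i t⟩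

lemma obs_swap (p₁ p₂ t : ℕ) (ω : Ω) : S.swap.obs p₂ p₁ t ω = (S.obs p₁ p₂ t ω)ᵀ := by
  simp only [obs, transpose_add, transpose_mul, transpose_transpose, Matrix.mul_assoc]
  rfl

lemma Mc_swap (p₁ p₂ T : ℕ) (ω : Ω) : S.swap.Mc p₂ p₁ T ω = S.Mr p₁ p₂ T ω := by
  simp only [Mc, Mr, obs_swap, transpose_transpose]

/-- The matrix `C F_t'`. -/
def colFac (p₂ t : ℕ) (ω : Ω) : Matrix (Fin p₂) (Fin k₁) ℝ := S.colLoad p₂ * (S.F t ω)ᵀ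

/-- The matrix `T⁻¹ ∑ₜ F_t (C'C / p₂) F_t'`. -/
def facGram (p₂ T : ℕ) (ω : Ω) : Matrix (Fin k₁) (Fin k₁) ℝ :=
  ((T : ℝ) * p₂)⁻¹ • ∑ t ∈ Finset.range T, (S.colFac p₂ t ω)ᵀ * S.colFac p₂ t ω

lemma transpose_obs (p₁ p₂ t : ℕ) (ω : Ω) :
    (S.obs p₁ p₂ t ω)ᵀ = S.colFac p₂ t ω * (S.rowLoad p₁)ᵀ + (S.err p₁ p₂ t ω)ᵀ := by
  simp only [obs, colFac, transpose_add, transpose_mul, transpose_transpose, Matrix.mul_assoc]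

lemma Mc_isHermitian (p₁ p₂ T : ℕ) (ω : Ω) : (S.Mc p₁ p₂ T ω).IsHermitian := by
  rw [IsHermitian, conjTranspose_eq_transpose_of_trivial]
  simp [Mc, transpose_sum]

lemma Mtilde_isHermitian (p₁ p₂ T : ℕ) (Q : Matrix (Fin p₂) (Fin k₂) ℝ) (ω : Ω) :
    (S.Mtilde p₁ p₂ T Q ω).IsHermitian := by
  rw [IsHermitian, conjTranspose_eq_transpose_of_trivial]
  simp [Mtilde, transpose_sum]

lemma form_smul_sum {m ι : Type*} [Fintype m] (s : Finset ι) (c : ℝ) (A : ι → Matrix m m ℝ)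
    (x : m → ℝ) : x ⬝ᵥ (c • ∑ t ∈ s, A t) *ᵥ x = c * ∑ t ∈ s, x ⬝ᵥ A t *ᵥ x := by
  rw [smul_mulVec, dotProduct_smul, sum_mulVec, dotProduct_sum, smul_eq_mul]

lemma Mc_form (p₁ p₂ T : ℕ) (ω : Ω) (x : Fin p₁ → ℝ) :
    x ⬝ᵥ S.Mc p₁ p₂ T ω *ᵥ x = ((T : ℝ) * p₂)⁻¹ * ∑ t ∈ Finset.range T,
      ((S.obs p₁ p₂ t ω)ᵀ *ᵥ x) ⬝ᵥ ((S.obs p₁ p₂ t ω)ᵀ *ᵥ x) := by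
  simp only [Mc, form_smul_sum, dotProduct_mul_transpose_mulVec]

lemma facGram_form (p₂ T : ℕ) (ω : Ω) (y : Fin k₁ → ℝ) :
    y ⬝ᵥ S.facGram p₂ T ω *ᵥ y = ((T : ℝ) * p₂)⁻¹ * ∑ t ∈ Finset.range T,
      (S.colFac p₂ t ω *ᵥ y) ⬝ᵥ (S.colFac p₂ t ω *ᵥ y) := by
  simp only [facGram, form_smul_sum, dotProduct_transpose_mul_mulVec]

lemma errForm_eq (p₁ p₂ T : ℕ) (ω : Ω) (x : Fin p₁ → ℝ) :
    errForm (fun i j t => S.e i j t ω) p₁ p₂ T x = ∑ t ∈ Finset.range T,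
      ((S.err p₁ p₂ t ω)ᵀ *ᵥ x) ⬝ᵥ ((S.err p₁ p₂ t ω)ᵀ *ᵥ x) := by
  simp only [errForm, dotProduct_self_eq_sum_sq]
  refine Finset.sum_congr rfl fun t _ => Finset.sum_congr rfl fun j _ => ?_
  congr 1
  simp [mulVec, dotProduct, err, mul_comm]

/-- Young's inequality period by period leaves only the sizes of the signal and error forms. The
parameter θ is chosen later as a function of the dimensions. -/
lemma abs_Mc_form_sub_le (p₁ p₂ T : ℕ) (ω : Ω) (x : Fin p₁ → ℝ) {θ : ℝ} (hθ : 0 < θ) :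
    |x ⬝ᵥ S.Mc p₁ p₂ T ω *ᵥ x -
        ((S.rowLoad p₁)ᵀ *ᵥ x) ⬝ᵥ S.facGram p₂ T ω *ᵥ ((S.rowLoad p₁)ᵀ *ᵥ x)| ≤
      θ * (((S.rowLoad p₁)ᵀ *ᵥ x) ⬝ᵥ S.facGram p₂ T ω *ᵥ ((S.rowLoad p₁)ᵀ *ᵥ x)) +
      (1 + 1 / θ) * (((T : ℝ) * p₂)⁻¹ * errForm (fun i j t => S.e i j t ω) p₁ p₂ T x) := by
  rw [Mc_form, facGram_form, errForm_eq]
  set y := (S.rowLoad p₁)ᵀ *ᵥ x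
  set c := ((T : ℝ) * p₂)⁻¹ with hc
  have hc0 : 0 ≤ c := by positivity
  have e : ∀ t, ((S.obs p₁ p₂ t ω)ᵀ *ᵥ x) ⬝ᵥ ((S.obs p₁ p₂ t ω)ᵀ *ᵥ x) =
      (S.colFac p₂ t ω *ᵥ y) ⬝ᵥ (S.colFac p₂ t ω *ᵥ y) +
      2 * ((S.colFac p₂ t ω *ᵥ y) ⬝ᵥ ((S.err p₁ p₂ t ω)ᵀ *ᵥ x)) +
      ((S.err p₁ p₂ t ω)ᵀ *ᵥ x) ⬝ᵥ ((S.err p₁ p₂ t ω)ᵀ *ᵥ x) := by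
    intro t
    rw [transpose_obs, add_mulVec, ← mulVec_mulVec]
    simp only [add_dotProduct, dotProduct_add]
    rw [dotProduct_comm ((S.err p₁ p₂ t ω)ᵀ *ᵥ x)]; ring
  simp only [e]
  rw [← mul_sub, ← Finset.sum_sub_distrib, abs_mul, abs_of_nonneg hc0]
  have h1 : |∑ t ∈ Finset.range T, ((S.colFac p₂ t ω *ᵥ y) ⬝ᵥ (S.colFac p₂ t ω *ᵥ y) +
      2 * ((S.colFac p₂ t ω *ᵥ y) ⬝ᵥ ((S.err p₁ p₂ t ω)ᵀ *ᵥ x)) +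
      ((S.err p₁ p₂ t ω)ᵀ *ᵥ x) ⬝ᵥ ((S.err p₁ p₂ t ω)ᵀ *ᵥ x) -
      (S.colFac p₂ t ω *ᵥ y) ⬝ᵥ (S.colFac p₂ t ω *ᵥ y))| ≤
      θ * (∑ t ∈ Finset.range T, (S.colFac p₂ t ω *ᵥ y) ⬝ᵥ (S.colFac p₂ t ω *ᵥ y)) +
      (1 + 1 / θ) * ∑ t ∈ Finset.range T,
        ((S.err p₁ p₂ t ω)ᵀ *ᵥ x) ⬝ᵥ ((S.err p₁ p₂ t ω)ᵀ *ᵥ x) := by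
    refine (Finset.abs_sum_le_sum_abs _ _).trans ?_
    rw [Finset.mul_sum, Finset.mul_sum, ← Finset.sum_add_distrib]
    refine Finset.sum_le_sum fun t _ => ?_
    have h2 := abs_two_mul_dotProduct_le (S.colFac p₂ t ω *ᵥ y) ((S.err p₁ p₂ t ω)ᵀ *ᵥ x) hθ
    have h3 := dotProduct_self_nonneg' ((S.err p₁ p₂ t ω)ᵀ *ᵥ x)
    rw [abs_le] at h2 ⊢
    constructor <;> nlinarith
  calc _ ≤ c * _ := mul_le_mul_of_nonneg_left h1 hc0
    _ = _ := by ring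

lemma trace_mul_transpose_eq {m n : Type*} [Fintype m] [Fintype n] (A : Matrix m n ℝ) :
    (A * Aᵀ).trace = ∑ i, ∑ j, A i j ^ 2 := by
  simp [trace, mul_apply, sq]

/-- The cross term sees the errors only along the k₁ columns of R, so the operator bound makes it
negligible. The squared errors have a trace of the order of p₁ in general and are kept. -/
lemma abs_trace_Mc_sub_le (p₁ p₂ T : ℕ) (ω : Ω) {θ : ℝ} (hθ : 0 < θ) :
    |(S.Mc p₁ p₂ T ω).trace - (S.facGram p₂ T ω * ((S.rowLoad p₁)ᵀ * S.rowLoad p₁)).trace -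
        ((T : ℝ) * p₂)⁻¹ * ∑ t ∈ Finset.range T, ∑ i : Fin p₁, ∑ j : Fin p₂, S.e i j t ω ^ 2| ≤
      θ * (S.facGram p₂ T ω).trace + 1 / θ * (((T : ℝ) * p₂)⁻¹ *
        ∑ a, errForm (fun i j t => S.e i j t ω) p₁ p₂ T ((S.rowLoad p₁)ᵀ a)) := by
  set c := ((T : ℝ) * p₂)⁻¹ with hc
  have hc0 : 0 ≤ c := by positivity
  set R := S.rowLoad p₁
  set H := fun t => S.colFac p₂ t ω
  set E := fun t => S.err p₁ p₂ t ω
  have e1 : ∀ t, (S.obs p₁ p₂ t ω * (S.obs p₁ p₂ t ω)ᵀ).trace =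
      ((H t)ᵀ * H t * (Rᵀ * R)).trace + 2 * (∑ a, (fun j => H t j a) ⬝ᵥ ((E t)ᵀ *ᵥ (Rᵀ a))) +
      ∑ i : Fin p₁, ∑ j : Fin p₂, S.e i j t ω ^ 2 := by
    intro t
    have h1 : S.obs p₁ p₂ t ω = R * (H t)ᵀ + E t := by
      rw [← transpose_transpose (S.obs p₁ p₂ t ω), transpose_obs]
      simp [transpose_add, transpose_mul, R, H, E]
    have h2 : (R * (H t)ᵀ * (E t)ᵀ).trace = ∑ a, (fun j => H t j a) ⬝ᵥ ((E t)ᵀ *ᵥ (Rᵀ a)) := by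
      rw [Matrix.mul_assoc, trace_mul_comm, Matrix.mul_assoc]
      simp only [trace, diag_apply, mul_apply, dotProduct, mulVec, transpose_apply]
    have h3 : (E t * (E t)ᵀ).trace = ∑ i : Fin p₁, ∑ j : Fin p₂, S.e i j t ω ^ 2 :=
      trace_mul_transpose_eq _
    have h4 : (E t * (H t * Rᵀ)).trace = (R * (H t)ᵀ * (E t)ᵀ).trace := by
      rw [← trace_transpose]; simp [transpose_mul]
    have h5 : (R * (H t)ᵀ * (H t * Rᵀ)).trace = ((H t)ᵀ * H t * (Rᵀ * R)).trace := by
      rw [Matrix.mul_assoc, trace_mul_comm]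
      simp only [Matrix.mul_assoc]
    rw [h1, transpose_add, transpose_mul, transpose_transpose, Matrix.add_mul, Matrix.mul_add,
      Matrix.mul_add, trace_add, trace_add, trace_add, h3, h4, h5, h2]
    ring
  have e2 : (S.Mc p₁ p₂ T ω).trace - (S.facGram p₂ T ω * (Rᵀ * R)).trace -
      c * ∑ t ∈ Finset.range T, ∑ i : Fin p₁, ∑ j : Fin p₂, S.e i j t ω ^ 2 =
      c * ∑ t ∈ Finset.range T, 2 * ∑ a, (fun j => H t j a) ⬝ᵥ ((E t)ᵀ *ᵥ (Rᵀ a)) := by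
    rw [Mc, facGram, smul_mul, trace_smul, trace_smul, trace_sum, Matrix.sum_mul, trace_sum]
    simp only [e1, smul_eq_mul, Finset.sum_add_distrib]
    ring
  have e3 : (S.facGram p₂ T ω).trace = c * ∑ t ∈ Finset.range T, ∑ a,
      (fun j => H t j a) ⬝ᵥ (fun j => H t j a) := by
    rw [facGram, trace_smul, trace_sum, smul_eq_mul]
    simp only [trace, diag_apply, mul_apply, dotProduct, transpose_apply, H, hc]
  have e4 : ∑ a, errForm (fun i j t => S.e i j t ω) p₁ p₂ T (Rᵀ a) =
      ∑ t ∈ Finset.range T, ∑ a, ((E t)ᵀ *ᵥ (Rᵀ a)) ⬝ᵥ ((E t)ᵀ *ᵥ (Rᵀ a)) := by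
    simp only [errForm_eq]
    rw [Finset.sum_comm]
  rw [e2, e3, e4, abs_mul, abs_of_nonneg hc0]
  have h1 : |∑ t ∈ Finset.range T, 2 * ∑ a, (fun j => H t j a) ⬝ᵥ ((E t)ᵀ *ᵥ (Rᵀ a))| ≤
      θ * (∑ t ∈ Finset.range T, ∑ a, (fun j => H t j a) ⬝ᵥ (fun j => H t j a)) +
      1 / θ * ∑ t ∈ Finset.range T, ∑ a, ((E t)ᵀ *ᵥ (Rᵀ a)) ⬝ᵥ ((E t)ᵀ *ᵥ (Rᵀ a)) := by
    refine (Finset.abs_sum_le_sum_abs _ _).trans ?_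
    rw [Finset.mul_sum, Finset.mul_sum, ← Finset.sum_add_distrib]
    refine Finset.sum_le_sum fun t _ => ?_
    rw [Finset.mul_sum]
    refine (Finset.abs_sum_le_sum_abs _ _).trans ?_
    rw [Finset.mul_sum, Finset.mul_sum, ← Finset.sum_add_distrib]
    exact Finset.sum_le_sum fun a _ => abs_two_mul_dotProduct_le _ _ hθ
  calc _ ≤ c * _ := mul_le_mul_of_nonneg_left h1 hc0
    _ = _ := by ring

end FactorModel

lemma abs_le_specNorm {m n : Type*} [Fintype m] [Fintype n] [DecidableEq n] (A : Matrix m n ℝ)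
    (i : m) (j : n) : |A i j| ≤ specNorm A := by
  have h1 := (LinearMap.toContinuousLinearMap (Matrix.toEuclideanLin A)).le_opNorm
    (EuclideanSpace.single j (1 : ℝ))
  have h2 : ‖EuclideanSpace.single j (1 : ℝ)‖ = 1 := by simp
  rw [h2, mul_one] at h1
  refine le_trans ?_ h1
  have h3 := PiLp.norm_apply_le
    ((LinearMap.toContinuousLinearMap (Matrix.toEuclideanLin A)) (EuclideanSpace.single j (1 : ℝ))) i
  refine le_trans (le_of_eq ?_) h3
  simp [Matrix.toLpLin_apply]

lemma specNorm_nonneg {m n : Type*} [Fintype m] [Fintype n] [DecidableEq n] (A : Matrix m n ℝ) :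
    0 ≤ specNorm A := norm_nonneg _

lemma tendsto_of_specNorm {m n : Type*} [Fintype m] [Fintype n] [DecidableEq n] {ι : Type*}
    {l : Filter ι} {A : ι → Matrix m n ℝ} {B : Matrix m n ℝ}
    (h : Tendsto (fun p => specNorm (A p - B)) l (𝓝 0)) : Tendsto A l (𝓝 B) := by
  refine tendsto_pi_nhds.2 fun i => tendsto_pi_nhds.2 fun j => ?_
  rw [tendsto_iff_norm_sub_tendsto_zero]
  exact squeeze_zero (fun _ => norm_nonneg _) (fun p => abs_le_specNorm (A p - B) i j) h

/-! ### Joint limits of weighted factor moments. -/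

section Gram

/-- For K = 1 the sum is the diagonal one, with known limit. The error K - 1 depends on p₂ alone and
multiplies entries dominated by convergent diagonal sums in T, so the limit is joint. -/
lemma tendsto_weighted_gram {k₁ k₂ : ℕ} {V : ℕ → Fin k₁ → Fin k₂ → Fin k₁ → Fin k₂ → ℝ}
    {K : ℕ → Matrix (Fin k₂) (Fin k₂) ℝ} (hK : Tendsto K atTop (𝓝 1))
    {Sig : Matrix (Fin k₁) (Fin k₁) ℝ}
    (hV : ∀ a b, Tendsto (fun T => ∑ c, V T a c b c) atTop (𝓝 (Sig a b)))
    (hb : ∀ T a c b d, |V T a c b d| ≤ (∑ c, V T a c a c + ∑ c, V T b c b c) / 2) :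
    Tendsto (fun p : ℕ × ℕ × ℕ => Matrix.of fun a b =>
      ∑ c, ∑ d, K p.2.1 c d * V p.2.2 a c b d) atTop (𝓝 Sig) := by
  refine tendsto_pi_nhds.2 fun a => tendsto_pi_nhds.2 fun b => ?_
  have e : ∀ p : ℕ × ℕ × ℕ, ∑ c, ∑ d, K p.2.1 c d * V p.2.2 a c b d =
      ∑ c, V p.2.2 a c b c + ∑ c, ∑ d, (K p.2.1 c d - (1 : Matrix _ _ ℝ) c d) * V p.2.2 a c b d := by
    intro p
    rw [← Finset.sum_add_distrib]
    refine Finset.sum_congr rfl fun c _ => ?_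
    simp only [sub_mul, Finset.sum_sub_distrib]
    have : ∑ d, (1 : Matrix (Fin k₂) (Fin k₂) ℝ) c d * V p.2.2 a c b d = V p.2.2 a c b c := by
      simp [Matrix.one_apply]
    rw [this]; ring
  simp only [Matrix.of_apply, e]
  have h0 : ∀ c d, Tendsto (fun p : ℕ × ℕ × ℕ =>
      (K p.2.1 c d - (1 : Matrix _ _ ℝ) c d) * V p.2.2 a c b d) atTop (𝓝 0) := by
    intro c d
    have h1 : Tendsto (fun p : ℕ × ℕ × ℕ => |K p.2.1 c d - (1 : Matrix _ _ ℝ) c d|) atTop (𝓝 0) := by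
      have := (((tendsto_pi_nhds.1 (tendsto_pi_nhds.1 hK c) d).sub_const
        ((1 : Matrix (Fin k₂) (Fin k₂) ℝ) c d)).abs).comp tendsto_triple_snd
      simpa [Function.comp_def] using this
    have h2 : Tendsto (fun p : ℕ × ℕ × ℕ =>
        (∑ c, V p.2.2 a c a c + ∑ c, V p.2.2 b c b c) / 2) atTop (𝓝 ((Sig a a + Sig b b) / 2)) :=
      (((hV a a).add (hV b b)).div_const 2).comp tendsto_triple_thd
    have h3 := h1.mul h2
    rw [zero_mul] at h3
    refine squeeze_zero_norm (fun p => ?_) h3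
    rw [Real.norm_eq_abs, abs_mul]
    exact mul_le_mul_of_nonneg_left (hb _ _ _ _ _) (abs_nonneg _)
  have h4 := tendsto_finsetSum (s := Finset.univ) fun c _ =>
    tendsto_finsetSum (s := Finset.univ) fun d _ => h0 c d
  simpa using ((hV a b).comp tendsto_triple_thd).add h4

end Gram

/-! ### From approximate quadratic forms to eigenvalues. -/

section Core

variable {k : ℕ}

/-- If the quadratic form of `M` is close to that of `R G R'` and `G → Sig`, then `M` is close to
`R Sig R'` in operator norm, relative to `p₁`. -/
lemma exists_form_approx {M : (p : ℕ × ℕ × ℕ) → Matrix (Fin p.1) (Fin p.1) ℝ}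
    {R : (n : ℕ) → Matrix (Fin n) (Fin k) ℝ} {G : ℕ × ℕ × ℕ → Matrix (Fin k) (Fin k) ℝ}
    {Sig : Matrix (Fin k) (Fin k) ℝ} {B : ℕ × ℕ × ℕ → ℝ}
    (hR : Tendsto (fun n : ℕ => (n : ℝ)⁻¹ • ((R n)ᵀ * R n)) atTop (𝓝 1))
    (hG : Tendsto G atTop (𝓝 Sig)) (hB0 : ∀ p, 0 ≤ B p)
    (hB : Tendsto (fun p => B p / p.1) atTop (𝓝 0))
    (hM : ∀ p : ℕ × ℕ × ℕ, 0 < p.1 → 0 < p.2.1 → 0 < p.2.2 → ∀ θ > 0, ∀ x,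
      |x ⬝ᵥ M p *ᵥ x - ((R p.1)ᵀ *ᵥ x) ⬝ᵥ G p *ᵥ ((R p.1)ᵀ *ᵥ x)| ≤
        θ * (((R p.1)ᵀ *ᵥ x) ⬝ᵥ G p *ᵥ ((R p.1)ᵀ *ᵥ x)) + (1 + 1 / θ) * (B p * (x ⬝ᵥ x))) :
    ∃ d : ℕ × ℕ × ℕ → ℝ, Tendsto d atTop (𝓝 0) ∧ ∀ p : ℕ × ℕ × ℕ, 0 < p.1 → 0 < p.2.1 →
      0 < p.2.2 → ∀ x, |x ⬝ᵥ M p *ᵥ x - ((R p.1)ᵀ *ᵥ x) ⬝ᵥ Sig *ᵥ ((R p.1)ᵀ *ᵥ x)| ≤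
        d p * p.1 * (x ⬝ᵥ x) := by
  set N : ℕ × ℕ × ℕ → ℝ := fun p => entrySum (G p - Sig) with hN
  set s := entrySum Sig with hs
  set ρ : ℕ × ℕ × ℕ → ℝ := fun p => ((p.1 : ℝ)⁻¹ • ((R p.1)ᵀ * R p.1)).trace with hρ
  -- Balances θ against (1/θ)B/p₁, both of which must vanish; the summand 1/p₁ keeps θ positive when
  -- B = 0.
  set θ : ℕ × ℕ × ℕ → ℝ := fun p => √(B p / p.1) + 1 / p.1 with hθ
  have tN : Tendsto N atTop (𝓝 0) := tendsto_entrySum hG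
  have tρ : Tendsto ρ atTop (𝓝 k) := by
    have h1 : Tendsto (fun n : ℕ => ((n : ℝ)⁻¹ • ((R n)ᵀ * R n)).trace) atTop
        (𝓝 (1 : Matrix (Fin k) (Fin k) ℝ).trace) :=
      (Continuous.matrix_trace continuous_id).tendsto _ |>.comp hR
    rw [trace_one, Fintype.card_fin] at h1
    exact h1.comp tendsto_triple_fst
  have tB : Tendsto (fun p => √(B p / p.1)) atTop (𝓝 0) := by simpa using hB.sqrt
  have tθ : Tendsto θ atTop (𝓝 0) := by
    simpa only [add_zero] using tB.add (tendsto_natCast_triple_fst.const_div_atTop 1)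
  refine ⟨fun p => N p * ρ p + θ p * ((s + N p) * ρ p) + (B p / p.1 + √(B p / p.1)), ?_, ?_⟩
  · have := ((tN.mul tρ).add (tθ.mul ((tendsto_const_nhds (x := s)).add tN |>.mul tρ))).add
      (hB.add tB)
    simpa using this
  · intro p hp1 hp2 hp3 x
    have q₁ : (0 : ℝ) < p.1 := by exact_mod_cast hp1
    set y := (R p.1)ᵀ *ᵥ x with hy
    have hx0 := dotProduct_self_nonneg' x
    have hy0 := dotProduct_self_nonneg' y
    have hθp : 0 < θ p := by
      have : 0 < 1 / (p.1 : ℝ) := by positivity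
      have := Real.sqrt_nonneg (B p / p.1)
      simp only [hθ]; linarith
    have h1 := hM p hp1 hp2 hp3 (θ p) hθp x
    rw [← hy] at h1
    have h2 : y ⬝ᵥ y ≤ ρ p * p.1 * (x ⬝ᵥ x) := by
      refine (transpose_mulVec_dotProduct_self_le (R p.1) x).trans (le_of_eq ?_)
      simp only [hρ, trace_smul, smul_eq_mul]
      field_simp
    have h3 := abs_dotProduct_mulVec_le (G p - Sig) y
    rw [sub_mulVec, dotProduct_sub] at h3
    have h4 := abs_dotProduct_mulVec_le Sig y
    have hN0 : 0 ≤ N p := entrySum_nonneg _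
    have hs0 : 0 ≤ s := entrySum_nonneg _
    have h5 : y ⬝ᵥ G p *ᵥ y ≤ (s + N p) * (y ⬝ᵥ y) := by
      rw [abs_le] at h3 h4; linarith [h3.2, h4.2]
    have h6 : (1 + 1 / θ p) * (B p * (x ⬝ᵥ x)) ≤
        (B p / p.1 + √(B p / p.1)) * p.1 * (x ⬝ᵥ x) := by
      have hb : 0 ≤ B p / p.1 := div_nonneg (hB0 p) q₁.le
      have h7 : 1 / θ p * (B p / p.1) ≤ √(B p / p.1) := by
        rw [one_div, inv_mul_le_iff₀ hθp]
        have h8 := Real.mul_self_sqrt hb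
        have h9 := Real.sqrt_nonneg (B p / p.1)
        have h10 : 0 < 1 / (p.1 : ℝ) := by positivity
        simp only [hθ]
        nlinarith
      have e : (1 + 1 / θ p) * (B p * (x ⬝ᵥ x)) =
          (B p / p.1 + 1 / θ p * (B p / p.1)) * p.1 * (x ⬝ᵥ x) := by
        field_simp
      rw [e]
      gcongr
    have h11 : |x ⬝ᵥ M p *ᵥ x - y ⬝ᵥ Sig *ᵥ y| ≤
        |x ⬝ᵥ M p *ᵥ x - y ⬝ᵥ G p *ᵥ y| + |y ⬝ᵥ G p *ᵥ y - y ⬝ᵥ Sig *ᵥ y| := abs_sub_le _ _ _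
    have h12 : θ p * (y ⬝ᵥ G p *ᵥ y) ≤ θ p * ((s + N p) * (ρ p * p.1 * (x ⬝ᵥ x))) := by
      refine mul_le_mul_of_nonneg_left (h5.trans ?_) hθp.le
      exact mul_le_mul_of_nonneg_left h2 (by positivity)
    have h13 : N p * (y ⬝ᵥ y) ≤ N p * (ρ p * p.1 * (x ⬝ᵥ x)) := mul_le_mul_of_nonneg_left h2 hN0
    calc _ ≤ _ := h11
      _ ≤ (θ p * ((s + N p) * (ρ p * p.1 * (x ⬝ᵥ x))) +
          (B p / p.1 + √(B p / p.1)) * p.1 * (x ⬝ᵥ x)) + N p * (ρ p * p.1 * (x ⬝ᵥ x)) := by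
          linarith
      _ = _ := by ring

/-- Under the conclusion of `exists_form_approx`, the first `k` eigenvalues grow at rate `p₁`. -/
lemma exists_kthEig_lower_bound {M : (p : ℕ × ℕ × ℕ) → Matrix (Fin p.1) (Fin p.1) ℝ}
    {R : (n : ℕ) → Matrix (Fin n) (Fin k) ℝ} {Sig : Matrix (Fin k) (Fin k) ℝ}
    (hSig : Sig.PosDef)
    (hR : Tendsto (fun n : ℕ => (n : ℝ)⁻¹ • ((R n)ᵀ * R n)) atTop (𝓝 1))
    (hherm : ∀ p, (M p).IsHermitian)
    {d : ℕ × ℕ × ℕ → ℝ} (hd : Tendsto d atTop (𝓝 0))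
    (hM : ∀ p : ℕ × ℕ × ℕ, 0 < p.1 → 0 < p.2.1 →
      0 < p.2.2 → ∀ x, |x ⬝ᵥ M p *ᵥ x - ((R p.1)ᵀ *ᵥ x) ⬝ᵥ Sig *ᵥ ((R p.1)ᵀ *ᵥ x)| ≤
        d p * p.1 * (x ⬝ᵥ x)) :
    ∃ σ : ℝ, 0 < σ ∧ ∀ᶠ p : ℕ × ℕ × ℕ in atTop, ∀ j, 1 ≤ j → j ≤ k →
      σ * p.1 ≤ kthEig (M p) j := by
  obtain ⟨σ, hσ, hσy⟩ := PosDef.exists_lower_bound hSig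
  refine ⟨σ / 4, by positivity, ?_⟩
  have tN := (tendsto_entrySum hR).comp tendsto_triple_fst
  filter_upwards [eventually_triple_pos, tendsto_triple_fst.eventually_ge_atTop k,
    hd.eventually_lt_const (show (0 : ℝ) < σ / 4 by positivity),
    tN.eventually_lt_const (show (0 : ℝ) < 1 / 2 by norm_num)] with p hp hpk hdp hNp j hj hjk
  have q₁ : (0 : ℝ) < p.1 := by exact_mod_cast hp.1
  simp only [Function.comp_apply] at hNp
  set Sm := (p.1 : ℝ)⁻¹ • ((R p.1)ᵀ * R p.1) with hSm
  have hSform : ∀ y, 1 / 2 * (y ⬝ᵥ y) ≤ y ⬝ᵥ Sm *ᵥ y := by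
    intro y
    have h1 := abs_dotProduct_mulVec_le (Sm - 1) y
    rw [sub_mulVec, dotProduct_sub, one_mulVec, abs_le] at h1
    have := dotProduct_self_nonneg' y
    nlinarith [h1.1]
  have hRy : ∀ y, (R p.1 *ᵥ y) ⬝ᵥ (R p.1 *ᵥ y) = p.1 * (y ⬝ᵥ Sm *ᵥ y) := by
    intro y
    rw [← dotProduct_transpose_mul_mulVec, hSm, smul_mulVec, dotProduct_smul, smul_eq_mul]
    field_simp
  have hinj : Function.Injective (R p.1).mulVecLin := by
    rw [← LinearMap.ker_eq_bot, LinearMap.ker_eq_bot']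
    intro y hy
    have h1 : R p.1 *ᵥ y = 0 := by simpa using hy
    have h2 := hRy y
    rw [h1, zero_dotProduct] at h2
    have h3 : y ⬝ᵥ Sm *ᵥ y = 0 := by
      rcases mul_eq_zero.1 h2.symm with h | h
      · exact absurd h q₁.ne'
      · exact h
    have h4 := hSform y
    have h5 : y ⬝ᵥ y = 0 := le_antisymm (by linarith) (dotProduct_self_nonneg' y)
    exact dotProduct_self_eq_zero.1 h5
  -- The test space is the column space of R, of dimension k because R'R/p₁ is close to the
  -- identity.
  refine le_kthEig (hherm p) hj (hjk.trans hpk) (LinearMap.range (R p.1).mulVecLin) ?_ ?_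
  · rw [LinearMap.finrank_range_of_inj hinj]; simpa using hjk
  · rintro x ⟨y, rfl⟩
    simp only [mulVecLin_apply]
    set x := R p.1 *ᵥ y with hx
    have h1 := (abs_le.1 (hM p hp.1 hp.2.1 hp.2.2 x)).1
    have h2 := hσy ((R p.1)ᵀ *ᵥ x)
    have hx0 := dotProduct_self_nonneg' x
    -- R' stretches vectors of the column space: with x = Ry, R'x = p₁z and |x|² = p₁⟨y, z⟩, so the
    -- claim is ⟨y, z⟩/2 ≤ |z|². This follows from Cauchy–Schwarz and |y|²/2 ≤ ⟨y, z⟩.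
    have h3 : 1 / 2 * p.1 * (x ⬝ᵥ x) ≤ ((R p.1)ᵀ *ᵥ x) ⬝ᵥ ((R p.1)ᵀ *ᵥ x) := by
      set z := Sm *ᵥ y with hz
      have e1 : (R p.1)ᵀ *ᵥ x = (p.1 : ℝ) • z := by
        rw [hx, hz, mulVec_mulVec, hSm, smul_mulVec, smul_smul, mul_inv_cancel₀ q₁.ne', one_smul]
      rw [e1, smul_dotProduct, dotProduct_smul, smul_eq_mul, smul_eq_mul, hx, hRy]
      have h4 := hSform y
      have h6 : (y ⬝ᵥ z) ^ 2 ≤ (y ⬝ᵥ y) * (z ⬝ᵥ z) := by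
        have := Finset.sum_mul_sq_le_sq_mul_sq Finset.univ y z
        simpa [dotProduct, sq] using this
      have hyy := dotProduct_self_nonneg' y
      have hzz := dotProduct_self_nonneg' z
      have h7 : 1 / 2 * (y ⬝ᵥ z) ≤ z ⬝ᵥ z := by
        rcases hyy.eq_or_lt with h0 | h0
        · have : y = 0 := dotProduct_self_eq_zero.1 h0.symm
          rw [this, zero_dotProduct]; simpa using hzz
        · have h8 : (y ⬝ᵥ y) * (1 / 2 * (y ⬝ᵥ z)) ≤ (y ⬝ᵥ y) * (z ⬝ᵥ z) := by nlinarith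
          exact le_of_mul_le_mul_left h8 h0
      nlinarith [mul_pos q₁ q₁]
    have h8 : d p * p.1 * (x ⬝ᵥ x) ≤ σ / 4 * p.1 * (x ⬝ᵥ x) := by gcongr
    nlinarith

end Core

/-! ### Factor second moments, pathwise and in expectation. -/

namespace FactorModel

variable {Ω : Type*} {k₁ k₂ : ℕ} (S : FactorModel Ω k₁ k₂)

/-- The time average of `F_{ac,t} F_{bd,t}`. -/
def facMoment (T : ℕ) (ω : Ω) (a : Fin k₁) (c : Fin k₂) (b : Fin k₁) (d : Fin k₂) : ℝ :=
  (T : ℝ)⁻¹ * ∑ t ∈ Finset.range T, S.F t ω a c * S.F t ω b d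

lemma facGram_eq (p₂ T : ℕ) (ω : Ω) :
    S.facGram p₂ T ω = Matrix.of fun a b => ∑ c, ∑ d,
      ((p₂ : ℝ)⁻¹ • ((S.colLoad p₂)ᵀ * S.colLoad p₂)) c d * S.facMoment T ω a c b d := by
  set G := (S.colLoad p₂)ᵀ * S.colLoad p₂ with hG
  have h1 : ∀ t a b, ((S.colFac p₂ t ω)ᵀ * S.colFac p₂ t ω) a b =
      ∑ c, ∑ d, G c d * (S.F t ω a c * S.F t ω b d) := by
    intro t a b
    have e : (S.colFac p₂ t ω)ᵀ * S.colFac p₂ t ω = S.F t ω * G * (S.F t ω)ᵀ := by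
      simp only [colFac, transpose_mul, transpose_transpose, hG, Matrix.mul_assoc]
    rw [e]
    simp only [mul_apply (M := S.F t ω * G), mul_apply (M := S.F t ω), transpose_apply,
      Finset.sum_mul]
    rw [Finset.sum_comm]
    exact Finset.sum_congr rfl fun c _ => Finset.sum_congr rfl fun d _ => by ring
  ext a b
  simp only [facGram, Matrix.smul_apply, Matrix.sum_apply, h1, of_apply, smul_eq_mul, facMoment]
  rw [Finset.sum_comm, Finset.mul_sum]
  refine Finset.sum_congr rfl fun c _ => ?_
  rw [Finset.sum_comm, Finset.mul_sum]
  refine Finset.sum_congr rfl fun d _ => ?_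
  rw [← Finset.mul_sum, mul_inv]
  ring

lemma sum_facMoment (T : ℕ) (ω : Ω) (a b : Fin k₁) :
    ∑ c, S.facMoment T ω a c b c =
      ((T : ℝ)⁻¹ • ∑ t ∈ Finset.range T, S.F t ω * (S.F t ω)ᵀ) a b := by
  simp only [facMoment, Matrix.smul_apply, Matrix.sum_apply, mul_apply, transpose_apply, smul_eq_mul]
  rw [← Finset.mul_sum, Finset.sum_comm]

lemma facMoment_self_nonneg (T : ℕ) (ω : Ω) (a : Fin k₁) (c : Fin k₂) :
    0 ≤ S.facMoment T ω a c a c :=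
  mul_nonneg (by positivity) (Finset.sum_nonneg fun _ _ => mul_self_nonneg _)

lemma abs_facMoment_le (T : ℕ) (ω : Ω) (a : Fin k₁) (c : Fin k₂) (b : Fin k₁) (d : Fin k₂) :
    |S.facMoment T ω a c b d| ≤ (S.facMoment T ω a c a c + S.facMoment T ω b d b d) / 2 := by
  simp only [facMoment]
  rw [abs_mul, abs_of_nonneg (by positivity : 0 ≤ (T : ℝ)⁻¹), ← mul_add,
    ← Finset.sum_add_distrib, mul_div_assoc, Finset.sum_div]
  refine mul_le_mul_of_nonneg_left ?_ (by positivity)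
  refine (Finset.abs_sum_le_sum_abs _ _).trans (Finset.sum_le_sum fun t _ => ?_)
  rw [abs_mul]
  nlinarith [sq_nonneg (|S.F t ω a c| - |S.F t ω b d|), abs_mul_abs_self (S.F t ω a c),
    abs_mul_abs_self (S.F t ω b d)]

lemma tendsto_facGram {ω : Ω} {Sig : Matrix (Fin k₁) (Fin k₁) ℝ}
    (hC : Tendsto (fun p₂ : ℕ => (p₂ : ℝ)⁻¹ • ((S.colLoad p₂)ᵀ * S.colLoad p₂)) atTop (𝓝 1))
    (hF : Tendsto (fun T : ℕ => (T : ℝ)⁻¹ • ∑ t ∈ Finset.range T, S.F t ω * (S.F t ω)ᵀ)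
      atTop (𝓝 Sig)) :
    Tendsto (fun p : ℕ × ℕ × ℕ => S.facGram p.2.1 p.2.2 ω) atTop (𝓝 Sig) := by
  simp only [facGram_eq]
  refine tendsto_weighted_gram (V := fun T => S.facMoment T ω) hC (fun a b => ?_) ?_
  · simp only [sum_facMoment]
    exact tendsto_pi_nhds.1 (tendsto_pi_nhds.1 hF a) b
  · intro T a c b d
    refine (S.abs_facMoment_le T ω a c b d).trans ?_
    have h1 := Finset.single_le_sum (f := fun c => S.facMoment T ω a c a c)
      (fun c _ => S.facMoment_self_nonneg T ω a c) (Finset.mem_univ c)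
    have h2 := Finset.single_le_sum (f := fun c => S.facMoment T ω b c b c)
      (fun c _ => S.facMoment_self_nonneg T ω b c) (Finset.mem_univ d)
    linarith

variable [MeasurableSpace Ω] {P : Measure Ω}

lemma FactorCond.integrable_pow_four [IsProbabilityMeasure P] (h : S.FactorCond P) (t : ℕ)
    (a : Fin k₁) (b : Fin k₂) : Integrable (fun ω => S.F t ω a b ^ 4) P := by
  obtain ⟨ε, hε, c, hc⟩ := h.moment
  refine Integrable.mono' ((integrable_const (1 : ℝ)).add (hc t).1)
    ((h.meas t a b).pow_const 4).aestronglyMeasurable (Eventually.of_forall fun ω => ?_)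
  simp only [Real.norm_eq_abs, Pi.add_apply, abs_pow]
  have h1 := abs_le_specNorm (S.F t ω) a b
  have h0 := specNorm_nonneg (S.F t ω)
  have h2 : |S.F t ω a b| ^ 4 ≤ specNorm (S.F t ω) ^ 4 := by gcongr
  refine h2.trans ?_
  -- x⁴ ≤ 1 + x^{4+ε} for x ≥ 0.
  rcases le_total (specNorm (S.F t ω)) 1 with h3 | h3
  · have := pow_le_one₀ (n := 4) h0 h3
    have : 0 ≤ specNorm (S.F t ω) ^ (4 + ε) := by positivity
    linarith
  · have h4 := Real.rpow_le_rpow_of_exponent_le h3 (by linarith : (4 : ℝ) ≤ 4 + ε)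
    have h5 : specNorm (S.F t ω) ^ (4 : ℝ) = specNorm (S.F t ω) ^ 4 := by
      exact_mod_cast Real.rpow_natCast _ 4
    rw [h5] at h4
    linarith

variable {S}

lemma FactorCond.memLp_mul [IsProbabilityMeasure P] (h : S.FactorCond P) (t : ℕ)
    (a : Fin k₁) (c : Fin k₂) (b : Fin k₁) (d : Fin k₂) :
    MemLp (fun ω => S.F t ω a c * S.F t ω b d) 2 P :=
  memLp_two_mul (h.meas t a c) (h.meas t b d) (h.integrable_pow_four S t a c)
    (h.integrable_pow_four S t b d)

lemma FactorCond.integrable_mul [IsProbabilityMeasure P] (h : S.FactorCond P) (t : ℕ)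
    (a : Fin k₁) (c : Fin k₂) (b : Fin k₁) (d : Fin k₂) :
    Integrable (fun ω => S.F t ω a c * S.F t ω b d) P :=
  (h.memLp_mul t a c b d).integrable one_le_two

lemma FactorCond.integrable_facMoment [IsProbabilityMeasure P] (h : S.FactorCond P) (T : ℕ)
    (a : Fin k₁) (c : Fin k₂) (b : Fin k₁) (d : Fin k₂) :
    Integrable (fun ω => S.facMoment T ω a c b d) P :=
  (integrable_finsetSum _ fun t _ => h.integrable_mul t a c b d).const_mul _

lemma FactorCond.integrable_sq_dev [IsProbabilityMeasure P] (h : S.FactorCond P) (T : ℕ)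
    (a : Fin k₁) (c : Fin k₂) (b : Fin k₁) (d : Fin k₂) :
    Integrable (fun ω => (∑ t ∈ Finset.range T, (S.F t ω a c * S.F t ω b d -
      ∫ ω', S.F t ω' a c * S.F t ω' b d ∂P)) ^ 2) P := by
  have : MemLp (fun ω => ∑ t ∈ Finset.range T, (S.F t ω a c * S.F t ω b d -
      ∫ ω', S.F t ω' a c * S.F t ω' b d ∂P)) 2 P :=
    memLp_finsetSum _ fun t _ => (h.memLp_mul t a c b d).sub (memLp_const _)
  exact this.integrable_sq

/-- The full sum is the term s = T - 1 of the maximum, since the partial sums run over s + 1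
periods. Integrability of the supremum must be checked, as its integral would otherwise be 0 by
convention. -/
lemma FactorCond.exists_integral_sq_dev_le [IsProbabilityMeasure P] (h : S.FactorCond P) :
    ∃ K : ℝ, ∀ (T : ℕ) a c b d, ∫ ω, (∑ t ∈ Finset.range T, (S.F t ω a c * S.F t ω b d -
      ∫ ω', S.F t ω' a c * S.F t ω' b d ∂P)) ^ 2 ∂P ≤ K * T := by
  obtain ⟨K, hK⟩ := h.maximal
  refine ⟨K, fun T a c b d => ?_⟩
  rcases Nat.eq_zero_or_pos T with rfl | hT
  · simp
  refine le_trans ?_ (hK T a b c d)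
  set Y : Fin T → Ω → ℝ := fun s ω => (∑ t ∈ Finset.range ((s : ℕ) + 1), (S.F t ω a c * S.F t ω b d -
      ∫ ω', S.F t ω' a c * S.F t ω' b d ∂P)) ^ 2 with hY
  have hYi : ∀ s, Integrable (Y s) P := fun s => h.integrable_sq_dev _ a c b d
  have hY0 : ∀ s ω, 0 ≤ Y s ω := fun s ω => sq_nonneg _
  have : Nonempty (Fin T) := ⟨⟨0, hT⟩⟩
  have hYm : ∀ s, Measurable (Y s) := fun s => by
    refine (Finset.measurable_sum _ fun t _ => ?_).pow_const 2
    exact ((h.meas t a c).mul (h.meas t b d)).sub_const _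
  refine integral_mono (h.integrable_sq_dev T a c b d) ?_ fun ω => ?_
  · refine Integrable.mono' (integrable_finsetSum Finset.univ fun s _ => hYi s)
      (Measurable.iSup hYm).aestronglyMeasurable (Eventually.of_forall fun ω => ?_)
    rw [Real.norm_eq_abs, abs_of_nonneg (Real.iSup_nonneg fun s => hY0 s ω)]
    refine ciSup_le fun s => ?_
    simpa using Finset.single_le_sum (f := fun s => Y s ω) (fun s _ => hY0 s ω) (Finset.mem_univ s)
  · have h1 : (∑ t ∈ Finset.range T, (S.F t ω a c * S.F t ω b d -
        ∫ ω', S.F t ω' a c * S.F t ω' b d ∂P)) ^ 2 = Y ⟨T - 1, by omega⟩ ω := by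
      simp only [hY, Nat.sub_add_cancel hT]
    simp only [h1]
    exact le_ciSup (f := fun s => Y s ω) (Set.finite_range _).bddAbove _

/-- Almost sure convergence of the averages identifies the limit but does not move inside the
expectation. The variance bound O(1/T) makes the centred averages vanish in measure, hence almost
surely along a subsequence. -/
lemma FactorCond.tendsto_integral_facMoment [IsProbabilityMeasure P] (h : S.FactorCond P)
    {Sig : Matrix (Fin k₁) (Fin k₁) ℝ}
    (hF : ∀ᵐ ω ∂P, Tendsto (fun T : ℕ => (T : ℝ)⁻¹ • ∑ t ∈ Finset.range T, S.F t ω * (S.F t ω)ᵀ)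
      atTop (𝓝 Sig)) (a b : Fin k₁) :
    Tendsto (fun T => ∑ c, ∫ ω, S.facMoment T ω a c b c ∂P) atTop (𝓝 (Sig a b)) := by
  obtain ⟨K, hK⟩ := h.exists_integral_sq_dev_le
  set D : ℕ → Ω → Fin k₂ → ℝ := fun T ω c =>
    S.facMoment T ω a c b c - ∫ ω', S.facMoment T ω' a c b c ∂P with hD
  have hDe : ∀ T ω c, D T ω c = (T : ℝ)⁻¹ * ∑ t ∈ Finset.range T, (S.F t ω a c * S.F t ω b c -
        ∫ ω', S.F t ω' a c * S.F t ω' b c ∂P) := by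
    intro T ω c
    simp only [hD, facMoment]
    rw [integral_const_mul, integral_finsetSum _ fun t _ => h.integrable_mul t a c b c,
      Finset.sum_sub_distrib, mul_sub]
  set Z : ℕ → Ω → ℝ := fun T ω => ∑ c, D T ω c ^ 2 with hZ
  have hDi : ∀ T c, Integrable (fun ω => D T ω c ^ 2) P := fun T c => by
    simp only [hDe, mul_pow]
    exact (h.integrable_sq_dev T a c b c).const_mul _
  have hZi : ∀ T, Integrable (Z T) P := fun T => integrable_finsetSum _ fun c _ => hDi T c
  have hZm : TendstoInMeasure P Z atTop 0 := by
    refine tendstoInMeasure_zero_of_integral_abs hZi ?_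
    have hlim : Tendsto (fun T : ℕ => (k₂ * K) / (T : ℝ)) atTop (𝓝 0) :=
      tendsto_natCast_atTop_atTop.const_div_atTop _
    refine squeeze_zero' (Eventually.of_forall fun T => integral_nonneg fun _ => abs_nonneg _) ?_ hlim
    filter_upwards [eventually_gt_atTop 0] with T hT
    have q : (0 : ℝ) < T := by exact_mod_cast hT
    have e : ∀ ω, |Z T ω| = Z T ω := fun ω => abs_of_nonneg (Finset.sum_nonneg fun _ _ => sq_nonneg _)
    simp only [e]
    simp only [hZ]
    rw [integral_finsetSum _ fun c _ => hDi T c]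
    calc _ ≤ ∑ c : Fin k₂, K / T := Finset.sum_le_sum fun c _ => by
          simp only [hDe, mul_pow]
          rw [integral_const_mul, inv_pow, inv_mul_le_iff₀ (by positivity)]
          refine (hK T a c b c).trans (le_of_eq ?_)
          field_simp
      _ = _ := by simp; ring
  refine tendsto_of_subseq_tendsto fun ns hns => ?_
  obtain ⟨ms, hmono, hms⟩ := (hZm.comp hns).exists_seq_tendsto_ae
  refine ⟨ms, ?_⟩
  have hms' : Tendsto (fun i => ns (ms i)) atTop atTop := hns.comp hmono.tendsto_atTop
  -- The expectations are deterministic, so one ω at which both convergences hold suffices.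
  obtain ⟨ω, hω1, hω2⟩ := (hms.and hF).exists
  have h1 : ∀ c, Tendsto (fun i => D (ns (ms i)) ω c) atTop (𝓝 0) := fun c => by
    refine tendsto_zero_iff_abs_tendsto_zero _ |>.2 ?_
    have h3 : Tendsto (fun i => √(Z (ns (ms i)) ω)) atTop (𝓝 0) := by
      have := hω1.sqrt
      simpa using this
    refine squeeze_zero (fun i => abs_nonneg _) (fun i => ?_) h3
    refine Real.abs_le_sqrt ?_
    exact Finset.single_le_sum (f := fun c => D (ns (ms i)) ω c ^ 2) (fun _ _ => sq_nonneg _)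
      (Finset.mem_univ c)
  have h2 := (tendsto_pi_nhds.1 (tendsto_pi_nhds.1 (hω2.comp hms') a) b).sub
    (tendsto_finsetSum (s := Finset.univ) fun c _ => h1 c)
  simp only [Finset.sum_const_zero, sub_zero, Function.comp_apply, ← sum_facMoment] at h2
  refine h2.congr fun i => ?_
  simp only [hD, Finset.sum_sub_distrib]
  ring

lemma integral_facGram [IsProbabilityMeasure P] (h : S.FactorCond P) (p₂ T : ℕ) :
    (expMat P (S.facGram p₂ T)) = Matrix.of fun a b => ∑ c, ∑ d,
      ((p₂ : ℝ)⁻¹ • ((S.colLoad p₂)ᵀ * S.colLoad p₂)) c d *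
        ∫ ω, S.facMoment T ω a c b d ∂P := by
  ext a b
  simp only [expMat, of_apply, facGram_eq]
  have hi : ∀ c d, Integrable (fun ω => ((p₂ : ℝ)⁻¹ • ((S.colLoad p₂)ᵀ * S.colLoad p₂)) c d *
      S.facMoment T ω a c b d) P := fun c d => (h.integrable_facMoment T a c b d).const_mul _
  exact (integral_finsetSum _ fun c _ => integrable_finsetSum _ fun d _ => hi c d).trans
    (Finset.sum_congr rfl fun c _ => (integral_finsetSum _ fun d _ => hi c d).trans
      (Finset.sum_congr rfl fun d _ => integral_const_mul _ _))

lemma integrable_facGram [IsProbabilityMeasure P] (h : S.FactorCond P) (p₂ T : ℕ) (a b : Fin k₁) :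
    Integrable (fun ω => S.facGram p₂ T ω a b) P := by
  simp only [facGram_eq, of_apply]
  exact integrable_finsetSum _ fun c _ => integrable_finsetSum _ fun d _ =>
    (h.integrable_facMoment T a c b d).const_mul _

lemma tendsto_expMat_facGram [IsProbabilityMeasure P] (h : S.FactorCond P)
    {Sig : Matrix (Fin k₁) (Fin k₁) ℝ}
    (hC : Tendsto (fun p₂ : ℕ => (p₂ : ℝ)⁻¹ • ((S.colLoad p₂)ᵀ * S.colLoad p₂)) atTop (𝓝 1))
    (hF : ∀ᵐ ω ∂P, Tendsto (fun T : ℕ => (T : ℝ)⁻¹ • ∑ t ∈ Finset.range T, S.F t ω * (S.F t ω)ᵀ)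
      atTop (𝓝 Sig)) :
    Tendsto (fun p : ℕ × ℕ × ℕ => expMat P (S.facGram p.2.1 p.2.2)) atTop (𝓝 Sig) := by
  simp only [integral_facGram h]
  refine tendsto_weighted_gram (V := fun T a c b d => ∫ ω, S.facMoment T ω a c b d ∂P) hC
    (h.tendsto_integral_facMoment hF) ?_
  intro T a c b d
  have hi := h.integrable_facMoment T
  have h0 : |∫ ω, S.facMoment T ω a c b d ∂P| ≤
      (∫ ω, S.facMoment T ω a c a c ∂P + ∫ ω, S.facMoment T ω b d b d ∂P) / 2 := by
    refine abs_integral_le_integral_abs.trans ?_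
    rw [← integral_add (hi a c a c) (hi b d b d), ← integral_div]
    exact integral_mono (hi a c b d).abs (((hi a c a c).add (hi b d b d)).div_const 2)
      fun ω => S.abs_facMoment_le T ω a c b d
  refine h0.trans ?_
  have h1 := Finset.single_le_sum (f := fun c => ∫ ω, S.facMoment T ω a c a c ∂P)
    (fun c _ => integral_nonneg fun ω => S.facMoment_self_nonneg T ω a c) (Finset.mem_univ c)
  have h2 := Finset.single_le_sum (f := fun c => ∫ ω, S.facMoment T ω b c b c ∂P)
    (fun c _ => integral_nonneg fun ω => S.facMoment_self_nonneg T ω b c) (Finset.mem_univ d)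
  linarith

end FactorModel

/-- The trace analogue of `exists_form_approx`; m is the average squared error, which need not
vanish and is subtracted. -/
lemma tendsto_trace_sub {k : ℕ} {τ m B : ℕ × ℕ × ℕ → ℝ}
    {R : (n : ℕ) → Matrix (Fin n) (Fin k) ℝ} {G : ℕ × ℕ × ℕ → Matrix (Fin k) (Fin k) ℝ}
    {Sig : Matrix (Fin k) (Fin k) ℝ}
    (hR : Tendsto (fun n : ℕ => (n : ℝ)⁻¹ • ((R n)ᵀ * R n)) atTop (𝓝 1))
    (hG : Tendsto G atTop (𝓝 Sig)) (hB0 : ∀ p, 0 ≤ B p)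
    (hB : Tendsto (fun p => B p / p.1) atTop (𝓝 0))
    (hτ : ∀ p : ℕ × ℕ × ℕ, 0 < p.1 → 0 < p.2.1 → 0 < p.2.2 → ∀ θ > 0,
      |τ p - (G p * ((R p.1)ᵀ * R p.1)).trace - p.1 * m p| ≤
        θ * (G p).trace + 1 / θ * (B p * ((R p.1)ᵀ * R p.1).trace)) :
    Tendsto (fun p => (p.1 : ℝ)⁻¹ * τ p - m p) atTop (𝓝 Sig.trace) := by
  set θ : ℕ × ℕ × ℕ → ℝ := fun p => √(B p / p.1) + 1 / p.1 with hθ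
  set Sm : ℕ × ℕ × ℕ → Matrix (Fin k) (Fin k) ℝ :=
    fun p => (p.1 : ℝ)⁻¹ • ((R p.1)ᵀ * R p.1) with hSm
  have tS : Tendsto Sm atTop (𝓝 1) := hR.comp tendsto_triple_fst
  have ttr : Continuous fun A : Matrix (Fin k) (Fin k) ℝ => A.trace :=
    Continuous.matrix_trace continuous_id
  have tB : Tendsto (fun p => √(B p / p.1)) atTop (𝓝 0) := by simpa using hB.sqrt
  have tθ : Tendsto θ atTop (𝓝 0) := by
    simpa only [add_zero] using tB.add (tendsto_natCast_triple_fst.const_div_atTop 1)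
  have t1 : Tendsto (fun p => (G p * Sm p).trace) atTop (𝓝 Sig.trace) := by
    have := (ttr.tendsto _).comp (hG.mul tS)
    rwa [mul_one] at this
  have t2 : Tendsto (fun p => θ p * (G p).trace + √(B p / p.1) * (Sm p).trace) atTop (𝓝 0) := by
    have := (tθ.mul ((ttr.tendsto _).comp hG)).add (tB.mul ((ttr.tendsto _).comp tS))
    simpa only [zero_mul, add_zero, Function.comp_apply] using this
  have t3 : Tendsto (fun p => (p.1 : ℝ)⁻¹ * τ p - m p - (G p * Sm p).trace) atTop (𝓝 0) := by
    refine squeeze_zero_norm' ?_ t2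
    filter_upwards [eventually_triple_pos] with p hp
    have q₁ : (0 : ℝ) < p.1 := by exact_mod_cast hp.1
    have hb : 0 ≤ B p / p.1 := div_nonneg (hB0 p) q₁.le
    have hθp : 0 < θ p := by
      have : 0 < 1 / (p.1 : ℝ) := by positivity
      have := Real.sqrt_nonneg (B p / p.1)
      simp only [hθ]; linarith
    have h1 := hτ p hp.1 hp.2.1 hp.2.2 (θ p * p.1) (by positivity)
    have e1 : ((R p.1)ᵀ * R p.1) = (p.1 : ℝ) • Sm p := by
      simp only [hSm, smul_smul]
      rw [mul_inv_cancel₀ q₁.ne', one_smul]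
    rw [e1, mul_smul_comm, trace_smul, trace_smul, smul_eq_mul, smul_eq_mul] at h1
    have e2 : τ p - p.1 * (G p * Sm p).trace - p.1 * m p =
        p.1 * ((p.1 : ℝ)⁻¹ * τ p - m p - (G p * Sm p).trace) := by field_simp; ring
    rw [e2, abs_mul, abs_of_pos q₁] at h1
    have htr : 0 ≤ (Sm p).trace := by
      simp only [hSm, trace_smul, smul_eq_mul]
      refine mul_nonneg (by positivity) ?_
      simp only [trace, diag_apply, mul_apply, transpose_apply]
      exact Finset.sum_nonneg fun _ _ => Finset.sum_nonneg fun _ _ => mul_self_nonneg _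
    have h7 : 1 / θ p * (B p / p.1) ≤ √(B p / p.1) := by
      rw [one_div, inv_mul_le_iff₀ hθp]
      have h8 := Real.mul_self_sqrt hb
      have h9 := Real.sqrt_nonneg (B p / p.1)
      have h10 : 0 < 1 / (p.1 : ℝ) := by positivity
      simp only [hθ]
      nlinarith
    have h8 : 1 / θ p * (B p / p.1) * (Sm p).trace ≤ √(B p / p.1) * (Sm p).trace := by gcongr
    have e3 : θ p * p.1 * (G p).trace + 1 / (θ p * p.1) * (B p * (p.1 * (Sm p).trace)) =
        p.1 * (θ p * (G p).trace + 1 / θ p * (B p / p.1) * (Sm p).trace) := by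
      field_simp
    rw [e3] at h1
    have h9 := le_of_mul_le_mul_left h1 q₁
    rw [Real.norm_eq_abs]
    linarith
  have := t3.add t1
  simpa using this

/-! ### Sample and population approximations of `Mc`. -/

namespace FactorModel

variable {Ω : Type*} {k₁ k₂ : ℕ} {S : FactorModel Ω k₁ k₂}

lemma LoadingCond.tendsto_row (h : S.LoadingCond) : Tendsto (fun p₁ : ℕ =>
    (p₁ : ℝ)⁻¹ • ((S.rowLoad p₁)ᵀ * S.rowLoad p₁)) atTop (𝓝 1) := tendsto_of_specNorm h.row_lim

lemma LoadingCond.tendsto_col (h : S.LoadingCond) : Tendsto (fun p₂ : ℕ =>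
    (p₂ : ℝ)⁻¹ • ((S.colLoad p₂)ᵀ * S.colLoad p₂)) atTop (𝓝 1) := tendsto_of_specNorm h.col_lim

variable (S) in
/-- The average squared error. -/
def errMean (p : ℕ × ℕ × ℕ) (ω : Ω) : ℝ :=
  ((p.1 : ℝ) * p.2.1 * p.2.2)⁻¹ * ∑ i ∈ Finset.range p.1, ∑ j ∈ Finset.range p.2.1,
    ∑ t ∈ Finset.range p.2.2, S.e i j t ω ^ 2

lemma errMean_nonneg (p : ℕ × ℕ × ℕ) (ω : Ω) : 0 ≤ S.errMean p ω :=
  mul_nonneg (by positivity) (Finset.sum_nonneg fun _ _ => Finset.sum_nonneg fun _ _ =>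
    Finset.sum_nonneg fun _ _ => sq_nonneg _)

lemma mul_errMean (p : ℕ × ℕ × ℕ) (hp : 0 < p.1) (ω : Ω) :
    p.1 * S.errMean p ω = ((p.2.2 : ℝ) * p.2.1)⁻¹ *
      ∑ t ∈ Finset.range p.2.2, ∑ i : Fin p.1, ∑ j : Fin p.2.1, S.e i j t ω ^ 2 := by
  have q₁ : (p.1 : ℝ) ≠ 0 := by exact_mod_cast hp.ne'
  have e : ∑ t ∈ Finset.range p.2.2, ∑ i : Fin p.1, ∑ j : Fin p.2.1, S.e i j t ω ^ 2 =
      ∑ i ∈ Finset.range p.1, ∑ j ∈ Finset.range p.2.1, ∑ t ∈ Finset.range p.2.2,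
        S.e i j t ω ^ 2 := by
    rw [Finset.sum_comm, Finset.sum_range]
    refine Finset.sum_congr rfl fun i _ => ?_
    rw [Finset.sum_comm, Finset.sum_range]
  rw [e, errMean, ← mul_assoc]
  congr 1
  rw [mul_assoc, mul_inv, ← mul_assoc, mul_inv_cancel₀ q₁, one_mul, mul_comm]

/-- Bound on the error form coming with the rate `B`. -/
lemma inv_mul_errForm_le {B : ℕ × ℕ × ℕ → ℝ} {ω : Ω}
    (hB : ∀ p : ℕ × ℕ × ℕ, 0 < p.1 → 0 < p.2.1 → 0 < p.2.2 → ∀ x,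
        errForm (fun i j t => S.e i j t ω) p.1 p.2.1 p.2.2 x ≤
          p.2.2 * p.2.1 * B p * ∑ i, x i ^ 2) {p : ℕ × ℕ × ℕ} (h1 : 0 < p.1) (h2 : 0 < p.2.1)
    (h3 : 0 < p.2.2) (x : Fin p.1 → ℝ) :
    ((p.2.2 : ℝ) * p.2.1)⁻¹ * errForm (fun i j t => S.e i j t ω) p.1 p.2.1 p.2.2 x ≤
      B p * (x ⬝ᵥ x) := by
  have q2 : (0 : ℝ) < p.2.1 := by exact_mod_cast h2
  have q3 : (0 : ℝ) < p.2.2 := by exact_mod_cast h3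
  rw [inv_mul_le_iff₀ (by positivity), dotProduct_self_eq_sum_sq, ← mul_assoc]
  exact hB p h1 h2 h3 x

lemma sum_col_dotProduct {m n : Type*} [Fintype m] [Fintype n] (A : Matrix m n ℝ) :
    ∑ a, Aᵀ a ⬝ᵥ Aᵀ a = (Aᵀ * A).trace := by
  simp [trace, mul_apply, dotProduct]

section Sample

variable {ω : Ω} {Sig : Matrix (Fin k₁) (Fin k₁) ℝ} {B : ℕ × ℕ × ℕ → ℝ}

lemma exists_Mc_approx (hL : S.LoadingCond)
    (hF : Tendsto (fun T : ℕ => (T : ℝ)⁻¹ • ∑ t ∈ Finset.range T, S.F t ω * (S.F t ω)ᵀ)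
      atTop (𝓝 Sig)) (hB0 : ∀ p, 0 ≤ B p)
    (hB : ∀ p : ℕ × ℕ × ℕ, 0 < p.1 → 0 < p.2.1 → 0 < p.2.2 → ∀ x,
        errForm (fun i j t => S.e i j t ω) p.1 p.2.1 p.2.2 x ≤
          p.2.2 * p.2.1 * B p * ∑ i, x i ^ 2)
    (hBlim : Tendsto (fun p => B p / p.1) atTop (𝓝 0)) :
    ∃ d : ℕ × ℕ × ℕ → ℝ, Tendsto d atTop (𝓝 0) ∧ ∀ p : ℕ × ℕ × ℕ, 0 < p.1 → 0 < p.2.1 →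
      0 < p.2.2 → ∀ x, |x ⬝ᵥ S.Mc p.1 p.2.1 p.2.2 ω *ᵥ x -
        ((S.rowLoad p.1)ᵀ *ᵥ x) ⬝ᵥ Sig *ᵥ ((S.rowLoad p.1)ᵀ *ᵥ x)| ≤ d p * p.1 * (x ⬝ᵥ x) := by
  refine exists_form_approx (M := fun p => S.Mc p.1 p.2.1 p.2.2 ω) (R := S.rowLoad)
    hL.tendsto_row (S.tendsto_facGram hL.tendsto_col hF) hB0 hBlim ?_
  intro p h1 h2 h3 θ hθ x
  refine (S.abs_Mc_form_sub_le p.1 p.2.1 p.2.2 ω x hθ).trans ?_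
  have := inv_mul_errForm_le hB h1 h2 h3 x
  gcongr

lemma tendsto_trace_Mc (hL : S.LoadingCond)
    (hF : Tendsto (fun T : ℕ => (T : ℝ)⁻¹ • ∑ t ∈ Finset.range T, S.F t ω * (S.F t ω)ᵀ)
      atTop (𝓝 Sig)) (hB0 : ∀ p, 0 ≤ B p)
    (hB : ∀ p : ℕ × ℕ × ℕ, 0 < p.1 → 0 < p.2.1 → 0 < p.2.2 → ∀ x,
        errForm (fun i j t => S.e i j t ω) p.1 p.2.1 p.2.2 x ≤
          p.2.2 * p.2.1 * B p * ∑ i, x i ^ 2)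
    (hBlim : Tendsto (fun p => B p / p.1) atTop (𝓝 0)) :
    Tendsto (fun p : ℕ × ℕ × ℕ => (p.1 : ℝ)⁻¹ * (S.Mc p.1 p.2.1 p.2.2 ω).trace - S.errMean p ω)
      atTop (𝓝 Sig.trace) := by
  refine tendsto_trace_sub (R := S.rowLoad) hL.tendsto_row
    (S.tendsto_facGram hL.tendsto_col hF) hB0 hBlim ?_
  intro p h1 h2 h3 θ hθ
  rw [mul_errMean p h1]
  refine (S.abs_trace_Mc_sub_le p.1 p.2.1 p.2.2 ω hθ).trans ?_
  have : ((p.2.2 : ℝ) * p.2.1)⁻¹ * ∑ a, errForm (fun i j t => S.e i j t ω) p.1 p.2.1 p.2.2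
      ((S.rowLoad p.1)ᵀ a) ≤ B p * ((S.rowLoad p.1)ᵀ * S.rowLoad p.1).trace := by
    rw [← sum_col_dotProduct, Finset.mul_sum, Finset.mul_sum]
    exact Finset.sum_le_sum fun a _ => inv_mul_errForm_le hB h1 h2 h3 _
  gcongr

end Sample

section Population

variable [MeasurableSpace Ω] {P : Measure Ω}

lemma memLp_two_of_pow_four [IsProbabilityMeasure P] {f : Ω → ℝ} (hf : Measurable f)
    (h : Integrable (fun ω => f ω ^ 4) P) : MemLp f 2 P := by
  simpa using memLp_two_mul hf measurable_const h (integrable_const ((1 : ℝ) ^ 4))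

lemma memLp_err [IsProbabilityMeasure P] (hE : WeakDependence S.e P) (i j t : ℕ) :
    MemLp (S.e i j t) 2 P := memLp_two_of_pow_four (hE.meas i j t) (hE.int i j t)

lemma memLp_obs [IsProbabilityMeasure P] (hF : S.FactorCond P) (hE : WeakDependence S.e P)
    (p₁ p₂ t : ℕ) (i : Fin p₁) (j : Fin p₂) : MemLp (fun ω => S.obs p₁ p₂ t ω i j) 2 P := by
  have : (fun ω => S.obs p₁ p₂ t ω i j) = fun ω =>
      (∑ b, ∑ a, S.F t ω a b * (S.R i a * S.C j b)) + S.e i j t ω := by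
    funext ω
    simp only [obs, Matrix.add_apply, mul_apply, transpose_apply, rowLoad, colLoad, err, of_apply,
      Finset.sum_mul]
    congr 1
    exact Finset.sum_congr rfl fun b _ => Finset.sum_congr rfl fun a _ => by ring
  rw [this]
  refine MemLp.add (memLp_finsetSum _ fun b _ => memLp_finsetSum _ fun a _ => ?_)
    (memLp_err hE i j t)
  exact (memLp_two_of_pow_four (hF.meas t a b) (hF.integrable_pow_four S t a b)).mul_const _

lemma integrable_Mc [IsProbabilityMeasure P] (hF : S.FactorCond P) (hE : WeakDependence S.e P)
    (p₁ p₂ T : ℕ) (i l : Fin p₁) : Integrable (fun ω => S.Mc p₁ p₂ T ω i l) P := by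
  simp only [Mc, Matrix.smul_apply, Matrix.sum_apply, mul_apply, transpose_apply]
  refine (integrable_finsetSum _ fun t _ => integrable_finsetSum _ fun j _ => ?_).const_mul _
  exact (memLp_obs hF hE p₁ p₂ t i j).integrable_mul (memLp_obs hF hE p₁ p₂ t l j)

lemma integrable_form {n : ℕ} {A : Ω → Matrix (Fin n) (Fin n) ℝ}
    (hA : ∀ i j, Integrable (fun ω => A ω i j) P) (x : Fin n → ℝ) :
    Integrable (fun ω => x ⬝ᵥ A ω *ᵥ x) P := by
  simp only [dotProduct, mulVec]
  exact integrable_finsetSum _ fun i _ =>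
    (integrable_finsetSum _ fun j _ => (hA i j).mul_const _).const_mul _

lemma expMat_form {n : ℕ} {A : Ω → Matrix (Fin n) (Fin n) ℝ}
    (hA : ∀ i j, Integrable (fun ω => A ω i j) P) (x : Fin n → ℝ) :
    x ⬝ᵥ expMat P A *ᵥ x = ∫ ω, x ⬝ᵥ A ω *ᵥ x ∂P := by
  simp only [dotProduct, mulVec, expMat, of_apply]
  rw [integral_finsetSum _ fun i _ =>
    (integrable_finsetSum _ fun j _ => (hA i j).mul_const _).const_mul _]
  refine Finset.sum_congr rfl fun i _ => ?_
  rw [integral_const_mul, integral_finsetSum _ fun j _ => (hA i j).mul_const _]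
  congr 1
  exact Finset.sum_congr rfl fun j _ => (integral_mul_const _ _).symm

lemma expMat_trace {n : ℕ} {A : Ω → Matrix (Fin n) (Fin n) ℝ}
    (hA : ∀ i j, Integrable (fun ω => A ω i j) P) :
    (expMat P A).trace = ∫ ω, (A ω).trace ∂P := by
  simp only [trace, diag_apply, expMat, of_apply]
  rw [integral_finsetSum _ fun i _ => hA i i]

lemma expMat_isHermitian {n : ℕ} {A : Ω → Matrix (Fin n) (Fin n) ℝ}
    (hA : ∀ ω, (A ω).IsHermitian) : (expMat P A).IsHermitian := by
  ext i j
  simp only [conjTranspose_apply, expMat, of_apply, star_trivial]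
  exact integral_congr_ae (Eventually.of_forall fun ω => by simpa using (hA ω).apply i j)

lemma integrable_errForm [IsProbabilityMeasure P] {e : ℕ → ℕ → ℕ → Ω → ℝ}
    (hE : WeakDependence e P) (p₁ p₂ T : ℕ) (x : Fin p₁ → ℝ) :
    Integrable (fun ω => errForm (fun i j t => e i j t ω) p₁ p₂ T x) P := by
  refine integrable_finsetSum _ fun t _ => integrable_finsetSum _ fun j _ => ?_
  exact MemLp.integrable_sq (memLp_finsetSum _ fun i _ =>
    (memLp_two_of_pow_four (hE.meas i j t) (hE.int i j t)).const_mul _)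

/-- Schur's test on the mean Gram matrix. In expectation the error bound is a constant, with no
deviation term. -/
lemma integral_errForm_le [IsProbabilityMeasure P] {e : ℕ → ℕ → ℕ → Ω → ℝ}
    (hE : WeakDependence e P) {c : ℝ} (hc : ∀ p, ∀ i < p, ∀ j t, ∑ l ∈ Finset.range p,
      |∫ ω, e i j t ω * e l j t ω ∂P| ≤ c) (p₁ p₂ T : ℕ) (x : Fin p₁ → ℝ) :
    ∫ ω, errForm (fun i j t => e i j t ω) p₁ p₂ T x ∂P ≤ T * p₂ * c * (x ⬝ᵥ x) := by
  have hi : ∀ (i l : Fin p₁) (j t : ℕ), Integrable (fun ω => e i j t ω * e l j t ω) P :=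
    fun i l j t => (hE.memLp_mul i j t l j t).integrable one_le_two
  have key : ∀ (j t : ℕ), ∫ ω, (∑ i : Fin p₁, x i * e i j t ω) ^ 2 ∂P ≤ c * (x ⬝ᵥ x) := by
    intro j t
    have e1 : ∫ ω, (∑ i : Fin p₁, x i * e i j t ω) ^ 2 ∂P =
        ∑ i : Fin p₁, ∑ l : Fin p₁, x i * x l * ∫ ω, e i j t ω * e l j t ω ∂P := by
      have e2 : ∀ ω, (∑ i : Fin p₁, x i * e i j t ω) ^ 2 =
          ∑ i : Fin p₁, ∑ l : Fin p₁, x i * x l * (e i j t ω * e l j t ω) := fun ω => by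
        rw [sq, Finset.sum_mul_sum]
        exact Finset.sum_congr rfl fun i _ => Finset.sum_congr rfl fun l _ => by ring
      simp only [e2]
      rw [integral_finsetSum _ fun i _ => integrable_finsetSum _ fun l _ => (hi i l j t).const_mul _]
      refine Finset.sum_congr rfl fun i _ => ?_
      rw [integral_finsetSum _ fun l _ => (hi i l j t).const_mul _]
      exact Finset.sum_congr rfl fun l _ => integral_const_mul _ _
    have hrow : ∀ i : Fin p₁, ∑ l : Fin p₁, |∫ ω, e i j t ω * e l j t ω ∂P| ≤ c := fun i => by
      rw [← Finset.sum_range (fun l => |∫ ω, e i j t ω * e l j t ω ∂P|)]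
      exact hc p₁ i i.2 j t
    rw [e1]
    have h1 : ∑ i : Fin p₁, ∑ l : Fin p₁, x i ^ 2 * |∫ ω, e i j t ω * e l j t ω ∂P| ≤
        c * (x ⬝ᵥ x) := by
      rw [dotProduct_self_eq_sum_sq, Finset.mul_sum]
      refine Finset.sum_le_sum fun i _ => ?_
      rw [← Finset.mul_sum, mul_comm]
      exact mul_le_mul_of_nonneg_right (hrow i) (sq_nonneg _)
    have h2 : ∑ i : Fin p₁, ∑ l : Fin p₁, x l ^ 2 * |∫ ω, e i j t ω * e l j t ω ∂P| ≤
        c * (x ⬝ᵥ x) := by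
      rw [Finset.sum_comm]
      refine le_trans (le_of_eq ?_) h1
      refine Finset.sum_congr rfl fun l _ => Finset.sum_congr rfl fun i _ => ?_
      simp only [mul_comm]
    have h3 : ∑ i : Fin p₁, ∑ l : Fin p₁, x i * x l * ∫ ω, e i j t ω * e l j t ω ∂P ≤
        ((∑ i : Fin p₁, ∑ l : Fin p₁, x i ^ 2 * |∫ ω, e i j t ω * e l j t ω ∂P|) +
        ∑ i : Fin p₁, ∑ l : Fin p₁, x l ^ 2 * |∫ ω, e i j t ω * e l j t ω ∂P|) / 2 := by
      rw [← Finset.sum_add_distrib, Finset.sum_div]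
      refine Finset.sum_le_sum fun i _ => ?_
      rw [← Finset.sum_add_distrib, Finset.sum_div]
      refine Finset.sum_le_sum fun l _ => ?_
      set w := ∫ ω, e i j t ω * e l j t ω ∂P
      have h4 : |x i * x l| ≤ (x i ^ 2 + x l ^ 2) / 2 := by
        rw [abs_mul]
        nlinarith [sq_nonneg (|x i| - |x l|), sq_abs (x i), sq_abs (x l)]
      calc x i * x l * w ≤ |x i * x l| * |w| := by rw [← abs_mul]; exact le_abs_self _
        _ ≤ (x i ^ 2 + x l ^ 2) / 2 * |w| := by gcongr
        _ = _ := by ring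
    linarith
  have hi2 : ∀ j t : ℕ, Integrable (fun ω => (∑ i : Fin p₁, x i * e i j t ω) ^ 2) P := fun j t =>
    MemLp.integrable_sq (memLp_finsetSum _ fun i _ =>
      (memLp_two_of_pow_four (hE.meas i j t) (hE.int i j t)).const_mul _)
  simp only [errForm]
  rw [integral_finsetSum _ fun t _ => integrable_finsetSum _ fun j _ => hi2 _ _]
  calc _ ≤ ∑ t ∈ Finset.range T, ∑ j : Fin p₂, c * (x ⬝ᵥ x) := Finset.sum_le_sum fun t _ => by
        rw [integral_finsetSum _ fun j _ => hi2 _ _]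
        exact Finset.sum_le_sum fun j _ => key j t
    _ = _ := by simp; ring

variable {Sig : Matrix (Fin k₁) (Fin k₁) ℝ}

/-- The pathwise inequality with θ integrates term by term, giving the same approximation by RΣ₁R'
for the expectation. -/
lemma exists_expMat_Mc_approx [IsProbabilityMeasure P] (hF : S.FactorCond P) (hL : S.LoadingCond)
    (hE : WeakDependence S.e P)
    (hSig : ∀ᵐ ω ∂P, Tendsto (fun T : ℕ => (T : ℝ)⁻¹ • ∑ t ∈ Finset.range T,
      S.F t ω * (S.F t ω)ᵀ) atTop (𝓝 Sig)) :
    ∃ d : ℕ × ℕ × ℕ → ℝ, Tendsto d atTop (𝓝 0) ∧ ∀ p : ℕ × ℕ × ℕ, 0 < p.1 → 0 < p.2.1 →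
      0 < p.2.2 → ∀ x, |x ⬝ᵥ expMat P (S.Mc p.1 p.2.1 p.2.2) *ᵥ x -
        ((S.rowLoad p.1)ᵀ *ᵥ x) ⬝ᵥ Sig *ᵥ ((S.rowLoad p.1)ᵀ *ᵥ x)| ≤ d p * p.1 * (x ⬝ᵥ x) := by
  obtain ⟨c, hc⟩ := hE.weak_row
  have hc0 : 0 ≤ c := le_trans (by positivity) (hc 1 0 one_pos 0 0)
  refine exists_form_approx (M := fun p => expMat P (S.Mc p.1 p.2.1 p.2.2)) (R := S.rowLoad)
    (B := fun _ => c) hL.tendsto_row (tendsto_expMat_facGram hF hL.tendsto_col hSig)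
    (fun _ => hc0) (tendsto_natCast_triple_fst.const_div_atTop c) ?_
  intro p h1 h2 h3 θ hθ x
  have q2 : (0 : ℝ) < p.2.1 := by exact_mod_cast h2
  have q3 : (0 : ℝ) < p.2.2 := by exact_mod_cast h3
  have i1 := integrable_form (fun i l => integrable_Mc hF hE p.1 p.2.1 p.2.2 i l) x
  have i2 := integrable_form (fun i l => integrable_facGram hF p.2.1 p.2.2 i l)
    ((S.rowLoad p.1)ᵀ *ᵥ x)
  have i3 := integrable_errForm hE p.1 p.2.1 p.2.2 x
  rw [expMat_form (integrable_Mc hF hE p.1 p.2.1 p.2.2),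
    expMat_form (integrable_facGram hF p.2.1 p.2.2), ← integral_sub i1 i2]
  refine abs_integral_le_integral_abs.trans ?_
  refine (integral_mono (i1.sub i2).abs ((i2.const_mul θ).add ((i3.const_mul _).const_mul _))
    fun ω => S.abs_Mc_form_sub_le p.1 p.2.1 p.2.2 ω x hθ).trans ?_
  rw [integral_add' (i2.const_mul θ) ((i3.const_mul _).const_mul _), integral_const_mul,
    integral_const_mul, integral_const_mul]
  have h4 := integral_errForm_le hE hc p.1 p.2.1 p.2.2 x
  have h5 : ((p.2.2 : ℝ) * p.2.1)⁻¹ * ∫ ω, errForm (fun i j t => S.e i j t ω) p.1 p.2.1 p.2.2 x ∂P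
      ≤ c * (x ⬝ᵥ x) := by
    rw [inv_mul_le_iff₀ (by positivity)]
    linarith
  gcongr

lemma abs_trace_expMat_Mc_sub_le [IsProbabilityMeasure P] (hF : S.FactorCond P)
    (hE : WeakDependence S.e P) {c : ℝ} (hc : ∀ p, ∀ i < p, ∀ j t, ∑ l ∈ Finset.range p,
      |∫ ω, S.e i j t ω * S.e l j t ω ∂P| ≤ c) {p₁ p₂ T : ℕ} (h2 : 0 < p₂) (h3 : 0 < T)
    {θ : ℝ} (hθ : 0 < θ) :
    |(expMat P (S.Mc p₁ p₂ T)).trace -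
        (expMat P (S.facGram p₂ T) * ((S.rowLoad p₁)ᵀ * S.rowLoad p₁)).trace -
        ∫ ω, ((T : ℝ) * p₂)⁻¹ * ∑ t ∈ Finset.range T, ∑ i : Fin p₁, ∑ j : Fin p₂,
          S.e i j t ω ^ 2 ∂P| ≤
      θ * (expMat P (S.facGram p₂ T)).trace +
        1 / θ * (c * ((S.rowLoad p₁)ᵀ * S.rowLoad p₁).trace) := by
  have q2 : (0 : ℝ) < p₂ := by exact_mod_cast h2
  have q3 : (0 : ℝ) < T := by exact_mod_cast h3
  have hb := fun ω => S.abs_trace_Mc_sub_le p₁ p₂ T ω hθ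
  have iM := integrable_Mc hF hE p₁ p₂ T
  have iG := integrable_facGram hF p₂ T
  have i1 : Integrable (fun ω => (S.Mc p₁ p₂ T ω).trace) P :=
    integrable_finsetSum _ fun i _ => iM i i
  have i2' : Integrable (fun ω => (S.facGram p₂ T ω).trace) P :=
    integrable_finsetSum _ fun i _ => iG i i
  have i3 : Integrable (fun ω => ((T : ℝ) * p₂)⁻¹ * ∑ t ∈ Finset.range T,
      ∑ i : Fin p₁, ∑ j : Fin p₂, S.e i j t ω ^ 2) P := by
    refine Integrable.const_mul ?_ _
    refine integrable_finsetSum _ fun t _ => integrable_finsetSum _ fun i _ => ?_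
    exact integrable_finsetSum _ fun j _ => (memLp_err hE i j t).integrable_sq
  have i4 : Integrable (fun ω => ((T : ℝ) * p₂)⁻¹ *
      ∑ a, errForm (fun i j t => S.e i j t ω) p₁ p₂ T ((S.rowLoad p₁)ᵀ a)) P :=
    (integrable_finsetSum _ fun a _ => integrable_errForm hE p₁ p₂ T _).const_mul _
  have h5 : ∫ ω, ((T : ℝ) * p₂)⁻¹ * ∑ a, errForm (fun i j t => S.e i j t ω) p₁ p₂ T
      ((S.rowLoad p₁)ᵀ a) ∂P ≤ c * ((S.rowLoad p₁)ᵀ * S.rowLoad p₁).trace := by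
    have e : ∫ ω, ∑ a, errForm (fun i j t => S.e i j t ω) p₁ p₂ T ((S.rowLoad p₁)ᵀ a) ∂P =
        ∑ a, ∫ ω, errForm (fun i j t => S.e i j t ω) p₁ p₂ T ((S.rowLoad p₁)ᵀ a) ∂P :=
      integral_finsetSum _ fun a _ => integrable_errForm hE p₁ p₂ T _
    rw [integral_const_mul, e, inv_mul_le_iff₀ (by positivity), ← sum_col_dotProduct, Finset.mul_sum, Finset.mul_sum]
    refine Finset.sum_le_sum fun a _ => ?_
    have := integral_errForm_le hE hc p₁ p₂ T ((S.rowLoad p₁)ᵀ a)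
    linarith
  generalize (S.rowLoad p₁)ᵀ * S.rowLoad p₁ = N at hb h5 ⊢
  have i2 : Integrable (fun ω => (S.facGram p₂ T ω * N).trace) P := by
    simp only [trace, diag_apply, mul_apply]
    exact integrable_finsetSum _ fun i _ => integrable_finsetSum _ fun j _ => (iG i j).mul_const _
  have e2 : (expMat P (S.facGram p₂ T) * N).trace = ∫ ω, (S.facGram p₂ T ω * N).trace ∂P := by
    simp only [trace, diag_apply, mul_apply]
    rw [integral_finsetSum _ fun i _ => integrable_finsetSum _ fun j _ => (iG i j).mul_const _]
    refine Finset.sum_congr rfl fun i _ => ?_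
    rw [integral_finsetSum _ fun j _ => (iG i j).mul_const _]
    exact Finset.sum_congr rfl fun j _ => (integral_mul_const _ _).symm
  rw [e2, expMat_trace iM, expMat_trace iG, ← integral_sub i1 i2]
  generalize hX : (fun ω => ((T : ℝ) * p₂)⁻¹ * ∑ t ∈ Finset.range T,
      ∑ i : Fin p₁, ∑ j : Fin p₂, S.e i j t ω ^ 2) = X at i3 ⊢
  generalize hY : (fun ω => ((T : ℝ) * p₂)⁻¹ * ∑ a, errForm (fun i j t => S.e i j t ω) p₁ p₂ T
      ((S.rowLoad p₁)ᵀ a)) = Y at i4 h5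
  have hb' : ∀ ω, |(S.Mc p₁ p₂ T ω).trace - (S.facGram p₂ T ω * N).trace - X ω| ≤
      θ * (S.facGram p₂ T ω).trace + 1 / θ * Y ω := by
    intro ω
    rw [← hX, ← hY]
    exact hb ω
  have e5 : ∫ ω, ((S.Mc p₁ p₂ T ω).trace - (S.facGram p₂ T ω * N).trace) ∂P - ∫ ω, X ω ∂P =
      ∫ ω, ((S.Mc p₁ p₂ T ω).trace - (S.facGram p₂ T ω * N).trace - X ω) ∂P :=
    (integral_sub (i1.sub i2) i3).symm
  rw [e5]
  refine abs_integral_le_integral_abs.trans ?_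
  refine (integral_mono ((i1.sub i2).sub i3).abs ((i2'.const_mul θ).add (i4.const_mul (1 / θ)))
    hb').trans ?_
  rw [integral_add' (i2'.const_mul θ) (i4.const_mul _), integral_const_mul, integral_const_mul]
  gcongr

lemma tendsto_trace_expMat_Mc [IsProbabilityMeasure P] (hF : S.FactorCond P) (hL : S.LoadingCond)
    (hE : WeakDependence S.e P)
    (hSig : ∀ᵐ ω ∂P, Tendsto (fun T : ℕ => (T : ℝ)⁻¹ • ∑ t ∈ Finset.range T,
      S.F t ω * (S.F t ω)ᵀ) atTop (𝓝 Sig)) :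
    Tendsto (fun p : ℕ × ℕ × ℕ => (p.1 : ℝ)⁻¹ * (expMat P (S.Mc p.1 p.2.1 p.2.2)).trace -
      ∫ ω, S.errMean p ω ∂P) atTop (𝓝 Sig.trace) := by
  obtain ⟨c, hc⟩ := hE.weak_row
  have hc0 : 0 ≤ c := le_trans (by positivity) (hc 1 0 one_pos 0 0)
  refine tendsto_trace_sub (R := S.rowLoad) (B := fun _ => c) hL.tendsto_row
    (tendsto_expMat_facGram hF hL.tendsto_col hSig) (fun _ => hc0)
    (tendsto_natCast_triple_fst.const_div_atTop c) ?_
  intro p h1 h2 h3 θ hθ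
  have e3 : (p.1 : ℝ) * ∫ ω, S.errMean p ω ∂P = ∫ ω, ((p.2.2 : ℝ) * p.2.1)⁻¹ *
      ∑ t ∈ Finset.range p.2.2, ∑ i : Fin p.1, ∑ j : Fin p.2.1, S.e i j t ω ^ 2 ∂P := by
    rw [← integral_const_mul]
    simp only [mul_errMean p h1]
  rw [e3]
  exact abs_trace_expMat_Mc_sub_le hF hE hc h2 h3 hθ

/-- With N = p₁p₂T and power loss N^{1/2}, the squared deviation is at most K N^{-1/2}. -/
lemma ErrorCond.ae_tendsto_errMean [IsProbabilityMeasure P] (hE : S.ErrorCond P) :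
    ∀ᵐ ω ∂P, Tendsto (fun p => S.errMean p ω - ∫ ω', S.errMean p ω' ∂P) atTop (𝓝 0) := by
  have hw := hE.weakDependence
  filter_upwards [hE.ae_sq_sum_le (s := 1 / 2) (by norm_num)] with ω hω
  obtain ⟨K, hK0, hK⟩ := hω
  set N : ℕ × ℕ × ℕ → ℝ := fun p => (p.1 : ℝ) * p.2.1 * p.2.2 with hN
  have hi : ∀ i j t, Integrable (fun ω => S.e i j t ω ^ 2) P :=
    fun i j t => (memLp_err hw i j t).integrable_sq
  have e1 : ∀ p, S.errMean p ω - ∫ ω', S.errMean p ω' ∂P = (N p)⁻¹ *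
      ∑ i ∈ Finset.range p.1, ∑ j ∈ Finset.range p.2.1, ∑ t ∈ Finset.range p.2.2,
        rowDev S.e P i i j t ω := by
    intro p
    simp only [errMean]
    rw [integral_const_mul, ← mul_sub]
    congr 1
    rw [integral_finsetSum _ fun i _ => integrable_finsetSum _ fun j _ =>
      integrable_finsetSum _ fun t _ => hi i j t, ← Finset.sum_sub_distrib]
    refine Finset.sum_congr rfl fun i _ => ?_
    rw [integral_finsetSum _ fun j _ => integrable_finsetSum _ fun t _ => hi i j t,
      ← Finset.sum_sub_distrib]
    refine Finset.sum_congr rfl fun j _ => ?_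
    rw [integral_finsetSum _ fun t _ => hi i j t, ← Finset.sum_sub_distrib]
    refine Finset.sum_congr rfl fun t _ => ?_
    simp only [rowDev, sq]
  have tN : Tendsto N atTop atTop :=
    (tendsto_natCast_triple_fst.atTop_mul_atTop₀ tendsto_natCast_triple_snd).atTop_mul_atTop₀
      tendsto_natCast_triple_thd
  have t1 : Tendsto (fun p => √(K * (N p) ^ (-(1 / 2 : ℝ)))) atTop (𝓝 0) := by
    have := (((tendsto_rpow_neg_atTop (by norm_num : (0 : ℝ) < 1 / 2)).comp tN).const_mul K).sqrt
    simpa only [mul_zero, Real.sqrt_zero, Function.comp_apply] using this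
  refine squeeze_zero_norm' ?_ t1
  filter_upwards [eventually_triple_pos] with p hp
  have q₁ : (0 : ℝ) < p.1 := by exact_mod_cast hp.1
  have q₂ : (0 : ℝ) < p.2.1 := by exact_mod_cast hp.2.1
  have q₃ : (0 : ℝ) < p.2.2 := by exact_mod_cast hp.2.2
  have hNp : 0 < N p := by positivity
  have h1 := hK p.1 p.2.1 p.2.2 hp.1 hp.2.1 hp.2.2
  rw [Real.norm_eq_abs, e1]
  refine Real.abs_le_sqrt ?_
  rw [mul_pow]
  have h2 : N p ^ (-(1 / 2 : ℝ)) = (N p)⁻¹ ^ 2 * (N p * N p ^ (1 / 2 : ℝ)) := by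
    have h3 : (N p)⁻¹ ^ 2 = N p ^ (-2 : ℝ) := by
      rw [Real.rpow_neg hNp.le, inv_pow]
      norm_cast
    have h4 : N p * N p ^ (1 / 2 : ℝ) = N p ^ (3 / 2 : ℝ) := by
      rw [← Real.rpow_one_add' hNp.le (by norm_num)]; norm_num
    rw [h3, h4, ← Real.rpow_add hNp]; norm_num
  rw [h2]
  calc _ ≤ (N p)⁻¹ ^ 2 * (K * N p * N p ^ (1 / 2 : ℝ)) :=
        mul_le_mul_of_nonneg_left h1 (by positivity)
    _ = _ := by ring

end Population

end FactorModel

/-! ### Projection on leading eigenvectors. -/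

section Projection

variable {n k : ℕ} {Q : Matrix (Fin n) (Fin k) ℝ}

lemma dotProduct_self_sub_proj (hQ : Qᵀ * Q = 1) (w : Fin n → ℝ) :
    (w - Q *ᵥ (Qᵀ *ᵥ w)) ⬝ᵥ (w - Q *ᵥ (Qᵀ *ᵥ w)) = w ⬝ᵥ w - (Qᵀ *ᵥ w) ⬝ᵥ (Qᵀ *ᵥ w) := by
  have h1 : w ⬝ᵥ Q *ᵥ (Qᵀ *ᵥ w) = (Qᵀ *ᵥ w) ⬝ᵥ (Qᵀ *ᵥ w) := by
    rw [dotProduct_mulVec, ← mulVec_transpose]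
  have h2 : (Q *ᵥ (Qᵀ *ᵥ w)) ⬝ᵥ (Q *ᵥ (Qᵀ *ᵥ w)) = (Qᵀ *ᵥ w) ⬝ᵥ (Qᵀ *ᵥ w) := by
    rw [← dotProduct_transpose_mul_mulVec, hQ, one_mulVec]
  simp only [sub_dotProduct, dotProduct_sub]
  rw [h1, h2, dotProduct_comm (Q *ᵥ (Qᵀ *ᵥ w)) w, h1]
  ring

lemma transpose_mulVec_sub_proj (hQ : Qᵀ * Q = 1) (w : Fin n → ℝ) :
    Qᵀ *ᵥ (w - Q *ᵥ (Qᵀ *ᵥ w)) = 0 := by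
  rw [mulVec_sub, mulVec_mulVec _ Qᵀ Q, hQ, one_mulVec, sub_self]

lemma bessel (hQ : Qᵀ * Q = 1) (w : Fin n → ℝ) : (Qᵀ *ᵥ w) ⬝ᵥ (Qᵀ *ᵥ w) ≤ w ⬝ᵥ w := by
  have := dotProduct_self_sub_proj hQ w
  have := dotProduct_self_nonneg' (w - Q *ᵥ (Qᵀ *ᵥ w))
  linarith

lemma sub_proj_dotProduct_self_le (hQ : Qᵀ * Q = 1) (w : Fin n → ℝ) :
    (w - Q *ᵥ (Qᵀ *ᵥ w)) ⬝ᵥ (w - Q *ᵥ (Qᵀ *ᵥ w)) ≤ w ⬝ᵥ w := by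
  rw [dotProduct_self_sub_proj hQ]
  have := dotProduct_self_nonneg' (Qᵀ *ᵥ w)
  linarith

/-- A vector orthogonal to the leading eigenvectors has a small quadratic form, if the form is
small on the orthogonal complement of the `k` columns of `C`. -/
lemma IsLeadingEigenvectors.form_le {A : Matrix (Fin n) (Fin n) ℝ}
    (h : IsLeadingEigenvectors A Q) (hA : Aᵀ = A) {C : Matrix (Fin n) (Fin k) ℝ} {b : ℝ}
    (hC : ∀ y, Cᵀ *ᵥ y = 0 → y ⬝ᵥ A *ᵥ y ≤ b * (y ⬝ᵥ y))
    (hb : ∀ a : Fin k, b < kthEig A ((a : ℕ) + 1)) {z : Fin n → ℝ} (hz : Qᵀ *ᵥ z = 0) :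
    z ⬝ᵥ A *ᵥ z ≤ b * (z ⬝ᵥ z) := by
  by_contra! hlt
  -- If z violated the bound, the form would exceed b on the span of z and the columns of Q. That
  -- span has k + 1 parameters against the k equations C'y = 0, so a nonzero combination lies in the
  -- kernel, where the form is at most b.
  set L : (Fin k → ℝ) × ℝ →ₗ[ℝ] (Fin k → ℝ) :=
    (Cᵀ.mulVecLin ∘ₗ Q.mulVecLin).coprod (LinearMap.toSpanSingleton ℝ _ (Cᵀ *ᵥ z)) with hL
  have hker : LinearMap.ker L ≠ ⊥ := by
    refine LinearMap.ker_ne_bot_of_finrank_lt ?_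
    simp
  obtain ⟨⟨v, s⟩, hvs, hne⟩ := Submodule.exists_mem_ne_zero_of_ne_bot hker
  have h0 : Cᵀ *ᵥ (Q *ᵥ v + s • z) = 0 := by
    have : L (v, s) = 0 := hvs
    simp only [hL, LinearMap.coprod_apply, LinearMap.comp_apply, mulVecLin_apply,
      LinearMap.toSpanSingleton_apply] at this
    rw [mulVec_add, mulVec_smul, this]
  have h1 := hC _ h0
  have zQ : ∀ u, z ⬝ᵥ Q *ᵥ u = 0 := fun u => by
    rw [dotProduct_mulVec, ← mulVec_transpose, hz, zero_dotProduct]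
  have AQ : A *ᵥ (Q *ᵥ v) = Q *ᵥ (fun a : Fin k => kthEig A ((a : ℕ) + 1) * v a) := by
    rw [mulVec_mulVec, h.2, ← mulVec_mulVec]
    congr 1
    ext a
    rw [mulVec_diagonal]
  have QQ : ∀ u w, (Q *ᵥ u) ⬝ᵥ (Q *ᵥ w) = u ⬝ᵥ w := fun u w => by
    rw [dotProduct_mulVec, ← mulVec_transpose, mulVec_mulVec, h.1, one_mulVec]
  have e1 : (Q *ᵥ v) ⬝ᵥ A *ᵥ z = 0 := by
    have : (Q *ᵥ v) ⬝ᵥ A *ᵥ z = z ⬝ᵥ A *ᵥ (Q *ᵥ v) := by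
      rw [dotProduct_mulVec, ← mulVec_transpose, hA, dotProduct_comm]
    rw [this, AQ, zQ]
  have e2 : (Q *ᵥ v + s • z) ⬝ᵥ A *ᵥ (Q *ᵥ v + s • z) =
      ∑ a : Fin k, kthEig A ((a : ℕ) + 1) * v a ^ 2 + s ^ 2 * (z ⬝ᵥ A *ᵥ z) := by
    simp only [mulVec_add, mulVec_smul, add_dotProduct, dotProduct_add, smul_dotProduct,
      dotProduct_smul, smul_eq_mul]
    rw [e1, AQ, zQ, QQ]
    have : (v ⬝ᵥ fun a : Fin k => kthEig A ((a : ℕ) + 1) * v a) =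
        ∑ a : Fin k, kthEig A ((a : ℕ) + 1) * v a ^ 2 :=
      Finset.sum_congr rfl fun a _ => by ring
    rw [this]
    ring
  have e3 : (Q *ᵥ v + s • z) ⬝ᵥ (Q *ᵥ v + s • z) = ∑ a, v a ^ 2 + s ^ 2 * (z ⬝ᵥ z) := by
    simp only [add_dotProduct, dotProduct_add, smul_dotProduct, dotProduct_smul, smul_eq_mul]
    rw [dotProduct_comm (Q *ᵥ v) z, zQ, QQ, dotProduct_self_eq_sum_sq v]
    ring
  rw [e2, e3, mul_add, Finset.mul_sum] at h1
  have h2 : ∑ a, b * v a ^ 2 ≤ ∑ a : Fin k, kthEig A ((a : ℕ) + 1) * v a ^ 2 :=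
    Finset.sum_le_sum fun a _ => mul_le_mul_of_nonneg_right (hb a).le (sq_nonneg _)
  have hs : s = 0 := by
    by_contra hs
    have : 0 < s ^ 2 := by positivity
    nlinarith
  have hv : v ≠ 0 := by
    rintro rfl
    exact hne (by rw [hs]; rfl)
  obtain ⟨a, ha⟩ := Function.ne_iff.1 hv
  have h3 : ∑ a, b * v a ^ 2 < ∑ a : Fin k, kthEig A ((a : ℕ) + 1) * v a ^ 2 := by
    refine Finset.sum_lt_sum (fun a _ => mul_le_mul_of_nonneg_right (hb a).le (sq_nonneg _))
      ⟨a, Finset.mem_univ _, ?_⟩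
    exact mul_lt_mul_of_pos_right (hb a) (by simp only [Pi.zero_apply] at ha; positivity)
  rw [hs] at h1
  linarith

/-- Residuals of the columns of `C` after projection on leading eigenvectors. -/
lemma IsLeadingEigenvectors.residual_le {A : Matrix (Fin n) (Fin n) ℝ}
    (h : IsLeadingEigenvectors A Q) (hA : Aᵀ = A) {C : Matrix (Fin n) (Fin k) ℝ} {b σ D : ℝ}
    (hC : ∀ y, Cᵀ *ᵥ y = 0 → y ⬝ᵥ A *ᵥ y ≤ b * (y ⬝ᵥ y))
    (hb : ∀ a : Fin k, b < kthEig A ((a : ℕ) + 1)) (hσ : 0 < σ)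
    (hlow : ∀ x, σ * ((Cᵀ *ᵥ x) ⬝ᵥ (Cᵀ *ᵥ x)) - D * (x ⬝ᵥ x) ≤ x ⬝ᵥ A *ᵥ x)
    (hbD : 0 ≤ b + D) :
    ((C - Q * (Qᵀ * C))ᵀ * (C - Q * (Qᵀ * C))).trace ≤ k * ((b + D) / σ) := by
  rw [← FactorModel.sum_col_dotProduct]
  have key : ∀ a, (C - Q * (Qᵀ * C))ᵀ a ⬝ᵥ (C - Q * (Qᵀ * C))ᵀ a ≤ (b + D) / σ := by
    intro a
    set w := Cᵀ a with hw
    have e : (C - Q * (Qᵀ * C))ᵀ a = w - Q *ᵥ (Qᵀ *ᵥ w) := by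
      have h0 : Q *ᵥ (Qᵀ *ᵥ w) = fun i => (Q * (Qᵀ * C)) i a := by
        rw [mulVec_mulVec, ← Matrix.mul_assoc]
        rfl
      rw [h0]
      rfl
    rw [e]
    set z := w - Q *ᵥ (Qᵀ *ᵥ w) with hz
    have hQz : Qᵀ *ᵥ z = 0 := transpose_mulVec_sub_proj h.1 w
    have h1 := h.form_le hA hC hb hQz
    have h2 := hlow z
    have hwz : w ⬝ᵥ z = z ⬝ᵥ z := by
      have : (Q *ᵥ (Qᵀ *ᵥ w)) ⬝ᵥ z = 0 := by
        rw [dotProduct_comm, dotProduct_mulVec, ← mulVec_transpose, hQz, zero_dotProduct]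
      conv_rhs => rw [hz, sub_dotProduct, ← hz, this, sub_zero]
    -- |z|² = ⟨w, z⟩ is one coordinate of C'z. With `hlow` and `form_le` this gives σ|z|⁴ ≤ (b +
    -- D)|z|².
    have h3 : (z ⬝ᵥ z) ^ 2 ≤ (Cᵀ *ᵥ z) ⬝ᵥ (Cᵀ *ᵥ z) := by
      rw [dotProduct_self_eq_sum_sq (Cᵀ *ᵥ z), ← hwz]
      exact Finset.single_le_sum (f := fun i => (Cᵀ *ᵥ z) i ^ 2) (fun _ _ => sq_nonneg _)
        (Finset.mem_univ a)
    have hz0 := dotProduct_self_nonneg' z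
    rw [le_div_iff₀ hσ]
    rcases hz0.eq_or_lt with h0 | h0
    · rw [← h0, zero_mul]; exact hbD
    · have h4 : (z ⬝ᵥ z) * ((z ⬝ᵥ z) * σ) ≤ (z ⬝ᵥ z) * (b + D) := by nlinarith
      exact le_of_mul_le_mul_left h4 h0
  calc _ ≤ ∑ _a : Fin k, (b + D) / σ := Finset.sum_le_sum fun a _ => key a
    _ = _ := by simp

end Projection

/-! ### The projected matrix `Mtilde`. -/

namespace FactorModel

variable {Ω : Type*} {k₁ k₂ : ℕ} (S : FactorModel Ω k₁ k₂)

lemma Mtilde_form {p₂ : ℕ} (hp : 0 < p₂) (p₁ T : ℕ) (Q : Matrix (Fin p₂) (Fin k₂) ℝ) (ω : Ω)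
    (x : Fin p₁ → ℝ) :
    x ⬝ᵥ S.Mtilde p₁ p₂ T Q ω *ᵥ x = ((T : ℝ) * p₂)⁻¹ * ∑ t ∈ Finset.range T,
      (Qᵀ *ᵥ ((S.obs p₁ p₂ t ω)ᵀ *ᵥ x)) ⬝ᵥ (Qᵀ *ᵥ ((S.obs p₁ p₂ t ω)ᵀ *ᵥ x)) := by
  have q : (0 : ℝ) < p₂ := by exact_mod_cast hp
  have e : ∀ t, (S.projObs p₁ p₂ t Q ω)ᵀ *ᵥ x =
      ((p₂ : ℝ)⁻¹ * √p₂) • (Qᵀ *ᵥ ((S.obs p₁ p₂ t ω)ᵀ *ᵥ x)) := by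
    intro t
    simp only [projObs, transpose_smul, transpose_mul, smul_mulVec, mulVec_mulVec, smul_mul,
      mul_smul]
  simp only [Mtilde, form_smul_sum, dotProduct_mul_transpose_mulVec, e, smul_dotProduct,
    dotProduct_smul, smul_eq_mul]
  rw [Finset.mul_sum, Finset.mul_sum]
  refine Finset.sum_congr rfl fun t _ => ?_
  have := Real.mul_self_sqrt q.le
  rw [mul_inv]
  field_simp
  rw [Real.sq_sqrt q.le]

lemma Mtilde_form_le {p₂ : ℕ} (hp : 0 < p₂) (p₁ T : ℕ) {Q : Matrix (Fin p₂) (Fin k₂) ℝ}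
    (hQ : Qᵀ * Q = 1) (ω : Ω) (x : Fin p₁ → ℝ) :
    x ⬝ᵥ S.Mtilde p₁ p₂ T Q ω *ᵥ x ≤ x ⬝ᵥ S.Mc p₁ p₂ T ω *ᵥ x := by
  rw [S.Mtilde_form hp, Mc_form]
  gcongr with t
  exact bessel hQ _

lemma Mtilde_form_nonneg (p₁ p₂ T : ℕ) (Q : Matrix (Fin p₂) (Fin k₂) ℝ) (ω : Ω)
    (x : Fin p₁ → ℝ) : 0 ≤ x ⬝ᵥ S.Mtilde p₁ p₂ T Q ω *ᵥ x := by
  simp only [Mtilde, form_smul_sum, dotProduct_mul_transpose_mulVec]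
  exact mul_nonneg (by positivity) (Finset.sum_nonneg fun _ _ => dotProduct_self_nonneg' _)

lemma Mc_form_nonneg (p₁ p₂ T : ℕ) (ω : Ω) (x : Fin p₁ → ℝ) :
    0 ≤ x ⬝ᵥ S.Mc p₁ p₂ T ω *ᵥ x := by
  rw [Mc_form]
  exact mul_nonneg (by positivity) (Finset.sum_nonneg fun _ _ => dotProduct_self_nonneg' _)

/-- By Pythagoras the difference is the part of X_t'x orthogonal to the columns of Q. Its signal
component carries the residual of C, its error component only shrinks under projection. -/
lemma Mc_form_sub_Mtilde_form_le {p₂ : ℕ} (hp : 0 < p₂) (p₁ T : ℕ)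
    {Q : Matrix (Fin p₂) (Fin k₂) ℝ} (hQ : Qᵀ * Q = 1) (ω : Ω) (x : Fin p₁ → ℝ) :
    x ⬝ᵥ S.Mc p₁ p₂ T ω *ᵥ x - x ⬝ᵥ S.Mtilde p₁ p₂ T Q ω *ᵥ x ≤
      2 * ((p₂ : ℝ)⁻¹ * ((S.colLoad p₂ - Q * (Qᵀ * S.colLoad p₂))ᵀ *
        (S.colLoad p₂ - Q * (Qᵀ * S.colLoad p₂))).trace) *
        (((S.rowLoad p₁)ᵀ *ᵥ x) ⬝ᵥ ((T : ℝ)⁻¹ • ∑ t ∈ Finset.range T, S.F t ω * (S.F t ω)ᵀ) *ᵥ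
          ((S.rowLoad p₁)ᵀ *ᵥ x)) +
      2 * (((T : ℝ) * p₂)⁻¹ * errForm (fun i j t => S.e i j t ω) p₁ p₂ T x) := by
  rw [S.Mtilde_form hp, Mc_form, errForm_eq, form_smul_sum]
  set y := (S.rowLoad p₁)ᵀ *ᵥ x
  set Z := S.colLoad p₂ - Q * (Qᵀ * S.colLoad p₂) with hZ
  rw [← mul_sub, ← Finset.sum_sub_distrib]
  have key : ∀ t, ((S.obs p₁ p₂ t ω)ᵀ *ᵥ x) ⬝ᵥ ((S.obs p₁ p₂ t ω)ᵀ *ᵥ x) -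
      (Qᵀ *ᵥ ((S.obs p₁ p₂ t ω)ᵀ *ᵥ x)) ⬝ᵥ (Qᵀ *ᵥ ((S.obs p₁ p₂ t ω)ᵀ *ᵥ x)) ≤
      2 * ((Zᵀ * Z).trace * (y ⬝ᵥ (S.F t ω * (S.F t ω)ᵀ) *ᵥ y)) +
      2 * (((S.err p₁ p₂ t ω)ᵀ *ᵥ x) ⬝ᵥ ((S.err p₁ p₂ t ω)ᵀ *ᵥ x)) := by
    intro t
    rw [← dotProduct_self_sub_proj hQ]
    have e : (S.obs p₁ p₂ t ω)ᵀ *ᵥ x - Q *ᵥ (Qᵀ *ᵥ ((S.obs p₁ p₂ t ω)ᵀ *ᵥ x)) =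
        Z *ᵥ ((S.F t ω)ᵀ *ᵥ y) +
        ((S.err p₁ p₂ t ω)ᵀ *ᵥ x - Q *ᵥ (Qᵀ *ᵥ ((S.err p₁ p₂ t ω)ᵀ *ᵥ x))) := by
      have h1 : (S.obs p₁ p₂ t ω)ᵀ *ᵥ x =
          S.colLoad p₂ *ᵥ ((S.F t ω)ᵀ *ᵥ y) + (S.err p₁ p₂ t ω)ᵀ *ᵥ x := by
        rw [transpose_obs, add_mulVec, colFac, ← mulVec_mulVec, ← mulVec_mulVec]
      rw [h1, hZ, sub_mulVec, mulVec_add, mulVec_add, ← mulVec_mulVec, ← mulVec_mulVec]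
      abel
    rw [e]
    refine (add_dotProduct_self_le _ _).trans ?_
    have h2 := mulVec_dotProduct_self_le Z ((S.F t ω)ᵀ *ᵥ y)
    rw [← dotProduct_mul_transpose_mulVec (S.F t ω) y] at h2
    have h3 := sub_proj_dotProduct_self_le hQ ((S.err p₁ p₂ t ω)ᵀ *ᵥ x)
    linarith
  calc _ ≤ ((T : ℝ) * p₂)⁻¹ * ∑ t ∈ Finset.range T,
        (2 * ((Zᵀ * Z).trace * (y ⬝ᵥ (S.F t ω * (S.F t ω)ᵀ) *ᵥ y)) +
      2 * (((S.err p₁ p₂ t ω)ᵀ *ᵥ x) ⬝ᵥ ((S.err p₁ p₂ t ω)ᵀ *ᵥ x))) := by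
        refine mul_le_mul_of_nonneg_left (Finset.sum_le_sum fun t _ => key t) (by positivity)
    _ = _ := by
        rw [Finset.sum_add_distrib, ← Finset.mul_sum, ← Finset.mul_sum, ← Finset.mul_sum, mul_inv]
        ring

/-- Both sides are tr(Q' `Mr` Q)/p₂, since Q diagonalises `Mr`. This bounds the denominator of the
projected statistic through the spectrum of `Mr`. -/
lemma trace_Mtilde {p₁ p₂ T : ℕ} (hp₁ : 0 < p₁) (hp₂ : 0 < p₂) {Q : Matrix (Fin p₂) (Fin k₂) ℝ}
    {ω : Ω} (hQ : IsLeadingEigenvectors (S.Mr p₁ p₂ T ω) Q) :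
    (p₁ : ℝ)⁻¹ * (S.Mtilde p₁ p₂ T Q ω).trace =
      (p₂ : ℝ)⁻¹ * ∑ a : Fin k₂, kthEig (S.Mr p₁ p₂ T ω) ((a : ℕ) + 1) := by
  have q₁ : (0 : ℝ) < p₁ := by exact_mod_cast hp₁
  have q₂ : (0 : ℝ) < p₂ := by exact_mod_cast hp₂
  have h1 : ∑ a : Fin k₂, kthEig (S.Mr p₁ p₂ T ω) ((a : ℕ) + 1) =
      (Qᵀ * (S.Mr p₁ p₂ T ω * Q)).trace := by
    rw [hQ.2, ← Matrix.mul_assoc, hQ.1, Matrix.one_mul, trace_diagonal]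
  have h2 : ∀ t, (S.projObs p₁ p₂ t Q ω * (S.projObs p₁ p₂ t Q ω)ᵀ).trace =
      (p₂ : ℝ)⁻¹ * (Qᵀ * ((S.obs p₁ p₂ t ω)ᵀ * S.obs p₁ p₂ t ω * Q)).trace := by
    intro t
    have e : S.projObs p₁ p₂ t Q ω = ((p₂ : ℝ)⁻¹ * √p₂) • (S.obs p₁ p₂ t ω * Q) := by
      rw [projObs, Matrix.mul_smul, smul_smul]
    rw [e, transpose_smul, Matrix.smul_mul, Matrix.mul_smul, trace_smul, trace_smul, trace_mul_comm,
      transpose_mul, smul_eq_mul, smul_eq_mul]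
    simp only [Matrix.mul_assoc]
    rw [← mul_assoc]
    congr 1
    field_simp
    rw [Real.sq_sqrt q₂.le]
  rw [h1, Mtilde, trace_smul, trace_sum, smul_eq_mul]
  simp only [h2, Mr, Matrix.smul_mul, Matrix.mul_smul, trace_smul, smul_eq_mul, Matrix.sum_mul, Matrix.mul_sum,
    trace_sum]
  rw [← Finset.mul_sum, mul_inv]
  ring

end FactorModel

lemma tendsto_triple {a b c : ℕ → ℕ} (ha : Tendsto a atTop atTop) (hb : Tendsto b atTop atTop)
    (hc : Tendsto c atTop atTop) : Tendsto (fun n => (a n, b n, c n)) atTop atTop := by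
  rw [← prod_atTop_atTop_eq, ← prod_atTop_atTop_eq]
  exact ha.prodMk (hb.prodMk hc)

lemma tendsto_triple_swap :
    Tendsto (fun p : ℕ × ℕ × ℕ => (p.2.1, p.1, p.2.2)) atTop atTop := by
  have h : Tendsto (fun p : ℕ × ℕ × ℕ => (p.2.1, p.1, p.2.2)) atTop
      (atTop ×ˢ (atTop ×ˢ atTop)) :=
    tendsto_triple_snd.prodMk (tendsto_triple_fst.prodMk tendsto_triple_thd)
  rwa [prod_atTop_atTop_eq, prod_atTop_atTop_eq] at h

lemma kthEig_le_trace {n k : ℕ} {A : Matrix (Fin n) (Fin n) ℝ} (hA : A.IsHermitian)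
    (h0 : ∀ x, 0 ≤ x ⬝ᵥ A *ᵥ x) (hk : 1 ≤ k) (hkn : k ≤ n) : kthEig A k ≤ A.trace := by
  rw [← sum_kthEig hA]
  exact Finset.single_le_sum (f := fun j => kthEig A j) (fun j _ => kthEig_nonneg hA h0 j)
    (Finset.mem_Icc.2 ⟨hk, hkn⟩)

/-! ### The size of φ. -/

section Statistic

variable {p M : ℕ → ℕ} {δ : ℕ → ℝ} {A : (n : ℕ) → Matrix (Fin (p n)) (Fin (p n)) ℝ} {k : ℕ}

lemma phiStat_eq {q : ℕ} {A : Matrix (Fin q) (Fin q) ℝ} (hA : A.IsHermitian) (δ : ℝ) (k : ℕ) :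
    phiStat δ A k = Real.exp ((q : ℝ) ^ (-δ) * kthEig A k / ((q : ℝ)⁻¹ * A.trace)) - 1 := by
  rw [phiStat, sum_kthEig hA]

lemma tendsto_phiStat_zero (hA : ∀ n, (A n).IsHermitian) (h0 : ∀ n x, 0 ≤ x ⬝ᵥ A n *ᵥ x)
    {B : ℕ → ℝ} (hB : Tendsto (fun n => (p n : ℝ) ^ (-δ n) * B n) atTop (𝓝 0))
    (hup : ∀ᶠ n in atTop, kthEig (A n) k ≤ B n) {m : ℝ} (hm : 0 < m)
    (hmean : ∀ᶠ n in atTop, m ≤ (p n : ℝ)⁻¹ * (A n).trace) :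
    Tendsto (fun n => phiStat (δ n) (A n) k) atTop (𝓝 0) := by
  simp only [phiStat_eq (hA _)]
  have h1 : Tendsto (fun n => (p n : ℝ) ^ (-δ n) * kthEig (A n) k / ((p n : ℝ)⁻¹ * (A n).trace))
      atTop (𝓝 0) := by
    have h2 := hB.div_const m
    rw [zero_div] at h2
    refine squeeze_zero' ?_ ?_ h2
    · filter_upwards [hmean] with n hn
      exact div_nonneg (mul_nonneg (by positivity) (kthEig_nonneg (hA n) (h0 n) k))
        (hm.le.trans hn)
    · filter_upwards [hmean, hup] with n hn hn'
      have := (kthEig_nonneg (hA n) (h0 n) k).trans hn'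
      gcongr
  have h3 := (Real.continuous_exp.tendsto 0).comp h1
  simpa [Function.comp_def] using h3.sub_const 1

/-- The strict gap ε₀ < κ absorbs the errors d₁ and d₂: the exponent is eventually at least ε₀
p₁^{1-δ}, whose exponential dominates M. -/
lemma tendsto_phiStat_atTop (hp : Tendsto p atTop atTop) (hM : Tendsto M atTop atTop)
    (hA : ∀ n, (A n).IsHermitian) (h0 : ∀ n x, 0 ≤ x ⬝ᵥ A n *ᵥ x) (hk : 1 ≤ k)
    {c₀ ε₀ κ : ℝ} (hc₀ : 0 < c₀) (hε₀ : 0 < ε₀) (hκ : ε₀ < κ) {d₁ d₂ : ℕ → ℝ}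
    (hd₁ : Tendsto d₁ atTop (𝓝 0)) (hd₂ : Tendsto d₂ atTop (𝓝 0))
    (hlow : ∀ᶠ n in atTop, (c₀ - d₁ n) * p n ≤ kthEig (A n) k)
    (hmean : ∀ᶠ n in atTop, (p n : ℝ)⁻¹ * (A n).trace ≤ c₀ / κ + d₂ n)
    (hg : Tendsto (fun n => (M n : ℝ) * Real.exp (-ε₀ * (p n : ℝ) ^ (1 - δ n))) atTop (𝓝 0)) :
    Tendsto (fun n => phiStat (δ n) (A n) k) atTop atTop ∧
      Tendsto (fun n => (M n : ℝ) / phiStat (δ n) (A n) k) atTop (𝓝 0) := by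
  have hκ0 : 0 < κ := hε₀.trans hκ
  set X : ℕ → ℝ := fun n => Real.exp (ε₀ * (p n : ℝ) ^ (1 - δ n)) with hX
  have hXpos : ∀ n, 0 < X n := fun n => Real.exp_pos _
  have hg' : Tendsto (fun n => (M n : ℝ) / X n) atTop (𝓝 0) := by
    refine hg.congr fun n => ?_
    rw [neg_mul, Real.exp_neg, div_eq_mul_inv]
  have hXtop : Tendsto X atTop atTop := by
    -- Eventually M ≤ X, so the divergence of M forces that of X.
    refine tendsto_atTop_mono' atTop ?_ (tendsto_natCast_atTop_atTop.comp hM)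
    filter_upwards [hg'.eventually_lt_const one_pos] with n hn
    exact ((div_lt_one (hXpos n)).1 hn).le
  have hφ : ∀ᶠ n in atTop, X n - 1 ≤ phiStat (δ n) (A n) k := by
    have l1 : Tendsto (fun n => c₀ - d₁ n - ε₀ * (c₀ / κ + d₂ n)) atTop
        (𝓝 (c₀ - 0 - ε₀ * (c₀ / κ + 0))) :=
      (hd₁.const_sub c₀).sub ((hd₂.const_add _).const_mul _)
    have l2 : 0 < c₀ - 0 - ε₀ * (c₀ / κ + 0) := by
      have : ε₀ * (c₀ / κ) < c₀ := by
        rw [← mul_div_assoc, div_lt_iff₀ hκ0]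
        nlinarith
      simpa using this
    filter_upwards [hp.eventually_ge_atTop k, hlow, hmean, l1.eventually_const_lt l2,
      hd₁.eventually_lt_const hc₀] with n h1 h2 h3 h4 h5
    have q : (0 : ℝ) < p n := by exact_mod_cast (by omega : 0 < p n)
    have h6 : 0 < kthEig (A n) k := lt_of_lt_of_le (mul_pos (by linarith) q) h2
    have h7 : 0 < (p n : ℝ)⁻¹ * (A n).trace :=
      mul_pos (by positivity) (h6.trans_le (kthEig_le_trace (hA n) (h0 n) hk h1))
    rw [phiStat_eq (hA n)]
    refine sub_le_sub_right (Real.exp_le_exp.2 ?_) 1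
    have e : (p n : ℝ) ^ (1 - δ n) = (p n : ℝ) ^ (-δ n) * p n := by
      rw [sub_eq_neg_add, Real.rpow_add q, Real.rpow_one]
    rw [e, mul_div_assoc, mul_left_comm]
    refine mul_le_mul_of_nonneg_left ?_ (by positivity)
    rw [le_div_iff₀ h7]
    calc ε₀ * p n * ((p n : ℝ)⁻¹ * (A n).trace) ≤ ε₀ * p n * (c₀ / κ + d₂ n) := by gcongr
      _ = ε₀ * (c₀ / κ + d₂ n) * p n := by ring
      _ ≤ (c₀ - d₁ n) * p n := by
        refine mul_le_mul_of_nonneg_right ?_ q.le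
        linarith
      _ ≤ _ := h2
  refine ⟨tendsto_atTop_mono' atTop hφ (tendsto_atTop_add_const_right _ (-1) hXtop), ?_⟩
  -- Once X ≥ 2, φ ≥ X - 1 ≥ X/2.
  have h2 := hg'.const_mul 2
  rw [mul_zero] at h2
  refine squeeze_zero' ?_ ?_ h2
  · filter_upwards [hφ, hXtop.eventually_ge_atTop 2] with n h3 h4
    exact div_nonneg (by positivity) (by linarith)
  · filter_upwards [hφ, hXtop.eventually_ge_atTop 2] with n h3 h4
    rw [mul_div_assoc', div_le_div_iff₀ (by linarith) (hXpos n)]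
    have : (0 : ℝ) ≤ M n := by positivity
    nlinarith

end Statistic

/-! ### Consequences at a regular realisation. -/

namespace FactorModel

variable {Ω : Type*} {k₁ k₂ : ℕ} {S : FactorModel Ω k₁ k₂}

lemma LoadingCond.swap (h : S.LoadingCond) : S.swap.LoadingCond :=
  ⟨h.col_bdd, h.row_bdd, h.col_lim, h.row_lim⟩

/-- Realisations at which the second moment of the factors converges and the errors are
asymptotically negligible in operator norm. -/
structure RegularAt (S : FactorModel Ω k₁ k₂) (ω : Ω) (Sig : Matrix (Fin k₁) (Fin k₁) ℝ) :
    Prop where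
  lim : Tendsto (fun T : ℕ => (T : ℝ)⁻¹ • ∑ t ∈ Finset.range T, S.F t ω * (S.F t ω)ᵀ)
    atTop (𝓝 Sig)
  err : ∃ B : ℕ × ℕ × ℕ → ℝ, (∀ p, 0 ≤ B p) ∧
    (∀ p : ℕ × ℕ × ℕ, 0 < p.1 → 0 < p.2.1 → 0 < p.2.2 → ∀ x,
      errForm (fun i j t => S.e i j t ω) p.1 p.2.1 p.2.2 x ≤
        p.2.2 * p.2.1 * B p * ∑ i, x i ^ 2) ∧
    Tendsto (fun p => B p / p.1) atTop (𝓝 0)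

/-- With R'x = 0 the signal form vanishes; θ = 1 produces the factor 2. -/
lemma Mc_form_le_of_transpose_mulVec_eq_zero {B : ℕ × ℕ × ℕ → ℝ} {ω : Ω}
    (hB : ∀ p : ℕ × ℕ × ℕ, 0 < p.1 → 0 < p.2.1 → 0 < p.2.2 → ∀ x,
        errForm (fun i j t => S.e i j t ω) p.1 p.2.1 p.2.2 x ≤
          p.2.2 * p.2.1 * B p * ∑ i, x i ^ 2) {p : ℕ × ℕ × ℕ} (h1 : 0 < p.1) (h2 : 0 < p.2.1)
    (h3 : 0 < p.2.2) {x : Fin p.1 → ℝ} (hx : (S.rowLoad p.1)ᵀ *ᵥ x = 0) :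
    x ⬝ᵥ S.Mc p.1 p.2.1 p.2.2 ω *ᵥ x ≤ 2 * B p * (x ⬝ᵥ x) := by
  have h4 := S.abs_Mc_form_sub_le p.1 p.2.1 p.2.2 ω x one_pos
  have h5 := inv_mul_errForm_le hB h1 h2 h3 x
  rw [hx, zero_dotProduct, sub_zero] at h4
  have := (abs_le.1 h4).2
  linarith

lemma kthEig_Mc_le {B : ℕ × ℕ × ℕ → ℝ} {ω : Ω}
    (hB : ∀ p : ℕ × ℕ × ℕ, 0 < p.1 → 0 < p.2.1 → 0 < p.2.2 → ∀ x,
        errForm (fun i j t => S.e i j t ω) p.1 p.2.1 p.2.2 x ≤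
          p.2.2 * p.2.1 * B p * ∑ i, x i ^ 2) {p : ℕ × ℕ × ℕ} (h1 : 0 < p.1) (h2 : 0 < p.2.1)
    (h3 : 0 < p.2.2) {k : ℕ} (hk : k₁ < k) (hkp : k ≤ p.1) :
    kthEig (S.Mc p.1 p.2.1 p.2.2 ω) k ≤ 2 * B p :=
  kthEig_le (S.Mc_isHermitian _ _ _ _) hk hkp (S.rowLoad p.1)ᵀ.mulVecLin fun _ hx =>
    Mc_form_le_of_transpose_mulVec_eq_zero hB h1 h2 h3 hx

lemma RegularAt.exists_kthEig_ge {ω : Ω} {Sig : Matrix (Fin k₁) (Fin k₁) ℝ}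
    (h : S.RegularAt ω Sig) (hSig : Sig.PosDef) (hL : S.LoadingCond) :
    ∃ σ : ℝ, 0 < σ ∧ ∀ᶠ p : ℕ × ℕ × ℕ in atTop, ∀ j, 1 ≤ j → j ≤ k₁ →
      σ * p.1 ≤ kthEig (S.Mc p.1 p.2.1 p.2.2 ω) j := by
  obtain ⟨B, hB0, hB, hBlim⟩ := h.err
  obtain ⟨d, hd, hM⟩ := exists_Mc_approx hL h.lim hB0 hB hBlim
  exact exists_kthEig_lower_bound hSig hL.tendsto_row (fun _ => S.Mc_isHermitian _ _ _ _) hd hM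

lemma RegularAt.exists_kthEig_Mr_ge {ω : Ω} {Sig : Matrix (Fin k₂) (Fin k₂) ℝ}
    (h : S.swap.RegularAt ω Sig) (hSig : Sig.PosDef) (hL : S.LoadingCond) :
    ∃ σ : ℝ, 0 < σ ∧ ∀ᶠ p : ℕ × ℕ × ℕ in atTop, ∀ j, 1 ≤ j → j ≤ k₂ →
      σ * p.2.1 ≤ kthEig (S.Mr p.1 p.2.1 p.2.2 ω) j := by
  obtain ⟨σ, hσ, hev⟩ := h.exists_kthEig_ge hSig hL.swap
  refine ⟨σ, hσ, ?_⟩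
  filter_upwards [tendsto_triple_swap.eventually hev] with p hp j hj hjk
  have := hp j hj hjk
  simp only [Mc_swap] at this
  exact this

lemma RegularAt.exists_trace_Mtilde_ge {ω : Ω} {Sig : Matrix (Fin k₂) (Fin k₂) ℝ}
    (h : S.swap.RegularAt ω Sig) (hSig : Sig.PosDef) (hL : S.LoadingCond) (hk₂ : 0 < k₂) :
    ∃ σ : ℝ, 0 < σ ∧ ∀ᶠ p : ℕ × ℕ × ℕ in atTop, ∀ Q,
      IsLeadingEigenvectors (S.Mr p.1 p.2.1 p.2.2 ω) Q →
      σ ≤ (p.1 : ℝ)⁻¹ * (S.Mtilde p.1 p.2.1 p.2.2 Q ω).trace := by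
  obtain ⟨σ, hσ, hev⟩ := h.exists_kthEig_Mr_ge hSig hL
  refine ⟨σ, hσ, ?_⟩
  filter_upwards [eventually_triple_pos, hev] with p hp hev Q hQ
  have q₂ : (0 : ℝ) < p.2.1 := by exact_mod_cast hp.2.1
  rw [S.trace_Mtilde hp.1 hp.2.1 hQ, ← div_eq_inv_mul, le_div_iff₀ q₂]
  have h1 : ∀ a : Fin k₂, σ * p.2.1 ≤ kthEig (S.Mr p.1 p.2.1 p.2.2 ω) ((a : ℕ) + 1) :=
    fun a => hev _ (by omega) (by omega)
  refine (h1 ⟨0, hk₂⟩).trans ?_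
  exact Finset.single_le_sum (f := fun a : Fin k₂ =>
    kthEig (S.Mr p.1 p.2.1 p.2.2 ω) ((a : ℕ) + 1))
    (fun a _ => le_trans (by positivity) (h1 a)) (Finset.mem_univ _)

/-- `Mr` is o(p₂) on the kernel of C', while its k₂ leading eigenvalues and its form along C grow
with p₂; hence the residual of C after projection on Q is o(p₂). No convergence of individual
eigenvectors is involved, so any choice of Q is covered. -/
lemma RegularAt.exists_Mc_le_Mtilde {ω : Ω} {Sig₁ : Matrix (Fin k₁) (Fin k₁) ℝ}
    {Sig₂ : Matrix (Fin k₂) (Fin k₂) ℝ} (h₁ : S.RegularAt ω Sig₁) (h₂ : S.swap.RegularAt ω Sig₂)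
    (hSig₂ : Sig₂.PosDef) (hL : S.LoadingCond) :
    ∃ d : ℕ × ℕ × ℕ → ℝ, Tendsto d atTop (𝓝 0) ∧ ∀ᶠ p : ℕ × ℕ × ℕ in atTop, ∀ Q,
      IsLeadingEigenvectors (S.Mr p.1 p.2.1 p.2.2 ω) Q → ∀ x,
      x ⬝ᵥ S.Mc p.1 p.2.1 p.2.2 ω *ᵥ x ≤
        x ⬝ᵥ S.Mtilde p.1 p.2.1 p.2.2 Q ω *ᵥ x + d p * p.1 * (x ⬝ᵥ x) := by
  obtain ⟨B₁, hB₁0, hB₁, hB₁lim⟩ := h₁.err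
  obtain ⟨B₂, hB₂0, hB₂, hB₂lim⟩ := h₂.err
  obtain ⟨d₂, hd₂, hM₂⟩ := exists_Mc_approx hL.swap h₂.lim hB₂0 hB₂ hB₂lim
  obtain ⟨σ, hσ, hσy⟩ := PosDef.exists_lower_bound hSig₂
  obtain ⟨σ', hσ', hev⟩ := h₂.exists_kthEig_Mr_ge hSig₂ hL
  set s : ℕ × ℕ × ℕ → ℕ × ℕ × ℕ := fun p => (p.2.1, p.1, p.2.2) with hs
  set g : ℕ × ℕ × ℕ → ℝ := fun p => entrySum ((p.2.2 : ℝ)⁻¹ • ∑ t ∈ Finset.range p.2.2,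
    S.F t ω * (S.F t ω)ᵀ) with hg
  set ρ : ℕ × ℕ × ℕ → ℝ :=
    fun p => ((p.1 : ℝ)⁻¹ • ((S.rowLoad p.1)ᵀ * S.rowLoad p.1)).trace with hρ
  -- The bound of `residual_le` divided by p₂.
  set ζ : ℕ × ℕ × ℕ → ℝ := fun p => k₂ * ((2 * (B₂ (s p) / p.2.1) + |d₂ (s p)|) / σ) with hζ
  have tρ : Tendsto ρ atTop (𝓝 (1 : Matrix (Fin k₁) (Fin k₁) ℝ).trace) :=
    ((Continuous.matrix_trace continuous_id).tendsto _ |>.comp hL.tendsto_row).comp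
      tendsto_triple_fst
  have tg : Tendsto g atTop (𝓝 (entrySum Sig₁)) := by
    have hc : Continuous fun A : Matrix (Fin k₁) (Fin k₁) ℝ => entrySum A := by
      unfold entrySum; fun_prop
    exact ((hc.tendsto _).comp h₁.lim).comp tendsto_triple_thd
  have tζ : Tendsto ζ atTop (𝓝 0) := by
    have t1 : Tendsto (fun p : ℕ × ℕ × ℕ => B₂ (s p) / p.2.1) atTop (𝓝 0) :=
      hB₂lim.comp tendsto_triple_swap
    have t2 : Tendsto (fun p : ℕ × ℕ × ℕ => |d₂ (s p)|) atTop (𝓝 0) := by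
      simpa only [abs_zero, Function.comp_def] using (hd₂.comp tendsto_triple_swap).abs
    simpa only [mul_zero, add_zero, zero_div] using
      (((t1.const_mul 2).add t2).div_const σ).const_mul (k₂ : ℝ)
  refine ⟨fun p => 2 * ζ p * (g p * ρ p) + 2 * (B₁ p / p.1), ?_, ?_⟩
  · simpa only [mul_zero, zero_mul, add_zero] using
      ((tζ.const_mul 2).mul (tg.mul tρ)).add (hB₁lim.const_mul 2)
  -- Separates the leading eigenvalues of `Mr` from 2B₂, its bound on the kernel of C'.
  have hBσ : ∀ᶠ p : ℕ × ℕ × ℕ in atTop, B₂ (s p) / p.2.1 < σ' / 2 :=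
    (hB₂lim.comp tendsto_triple_swap).eventually_lt_const (by positivity)
  filter_upwards [eventually_triple_pos, hev, hBσ] with p hp hev hBσ Q hQ x
  have q₁ : (0 : ℝ) < p.1 := by exact_mod_cast hp.1
  have q₂ : (0 : ℝ) < p.2.1 := by exact_mod_cast hp.2.1
  have hMr : (S.Mr p.1 p.2.1 p.2.2 ω)ᵀ = S.Mr p.1 p.2.1 p.2.2 ω := by
    rw [← Mc_swap]
    simpa [IsHermitian, conjTranspose_eq_transpose_of_trivial] using
      S.swap.Mc_isHermitian p.2.1 p.1 p.2.2 ω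
  have hres := hQ.residual_le hMr (C := S.colLoad p.2.1) (b := 2 * B₂ (s p)) (σ := σ)
    (D := |d₂ (s p)| * p.2.1) ?_ ?_ hσ ?_ ?_
  rotate_left
  · intro y hy
    rw [← Mc_swap]
    exact Mc_form_le_of_transpose_mulVec_eq_zero hB₂ (p := s p) hp.2.1 hp.1 hp.2.2 hy
  · intro a
    refine lt_of_lt_of_le ?_ (hev _ (by omega) (by omega))
    rw [div_lt_iff₀ q₂] at hBσ
    linarith
  · intro y
    rw [← Mc_swap]
    have h1 := (abs_le.1 (hM₂ (s p) hp.2.1 hp.1 hp.2.2 y)).1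
    have h2 := hσy ((S.swap.rowLoad p.2.1)ᵀ *ᵥ y)
    have h3 : d₂ (s p) * p.2.1 * (y ⬝ᵥ y) ≤ |d₂ (s p)| * p.2.1 * (y ⬝ᵥ y) := by
      have := dotProduct_self_nonneg' y
      gcongr
      exact le_abs_self _
    have h4 : σ * ((S.colLoad p.2.1)ᵀ *ᵥ y ⬝ᵥ (S.colLoad p.2.1)ᵀ *ᵥ y) ≤
      ((S.swap.rowLoad p.2.1)ᵀ *ᵥ y) ⬝ᵥ Sig₂ *ᵥ ((S.swap.rowLoad p.2.1)ᵀ *ᵥ y) := h2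
    simp only [hs] at h1
    linarith
  · have := hB₂0 (s p)
    positivity
  have hform := S.Mc_form_sub_Mtilde_form_le hp.2.1 p.1 p.2.2 hQ.1 ω x
  have herr := inv_mul_errForm_le hB₁ hp.1 hp.2.1 hp.2.2 x
  set y := (S.rowLoad p.1)ᵀ *ᵥ x with hy
  set Z := S.colLoad p.2.1 - Q * (Qᵀ * S.colLoad p.2.1) with hZ
  have hx0 := dotProduct_self_nonneg' x
  have h1 : (p.2.1 : ℝ)⁻¹ * (Zᵀ * Z).trace ≤ ζ p := by
    rw [inv_mul_le_iff₀ q₂]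
    refine hres.trans (le_of_eq ?_)
    simp only [hζ]
    field_simp
  have h2 : y ⬝ᵥ ((p.2.2 : ℝ)⁻¹ • ∑ t ∈ Finset.range p.2.2, S.F t ω * (S.F t ω)ᵀ) *ᵥ y ≤
      g p * (ρ p * p.1 * (x ⬝ᵥ x)) := by
    refine (le_abs_self _).trans ((abs_dotProduct_mulVec_le _ y).trans ?_)
    refine mul_le_mul_of_nonneg_left ?_ (entrySum_nonneg _)
    refine (transpose_mulVec_dotProduct_self_le (S.rowLoad p.1) x).trans (le_of_eq ?_)
    simp only [hρ, trace_smul, smul_eq_mul]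
    field_simp
  have h3 : 0 ≤ (p.2.1 : ℝ)⁻¹ * (Zᵀ * Z).trace := by
    refine mul_nonneg (by positivity) ?_
    rw [← sum_col_dotProduct]
    exact Finset.sum_nonneg fun _ _ => dotProduct_self_nonneg' _
  have h4 : 0 ≤ y ⬝ᵥ ((p.2.2 : ℝ)⁻¹ • ∑ t ∈ Finset.range p.2.2, S.F t ω * (S.F t ω)ᵀ) *ᵥ y := by
    rw [form_smul_sum]
    refine mul_nonneg (by positivity) (Finset.sum_nonneg fun t _ => ?_)
    rw [dotProduct_mul_transpose_mulVec]
    exact dotProduct_self_nonneg' _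
  have h5 := mul_le_mul h1 h2 h4 (h3.trans h1)
  have e : B₁ p / p.1 * p.1 = B₁ p := by field_simp
  have e2 : (2 * ζ p * (g p * ρ p) + 2 * (B₁ p / p.1)) * p.1 * (x ⬝ᵥ x) =
      2 * (ζ p * (g p * (ρ p * p.1 * (x ⬝ᵥ x)))) + 2 * (B₁ p * (x ⬝ᵥ x)) := by
    rw [← e]; field_simp
  simp only [e2]
  linarith

end FactorModel

/-! ### Almost sure behaviour of φ under the two hypotheses. -/

namespace FactorModel

variable {Ω : Type*} {k₁ k₂ : ℕ} {S : FactorModel Ω k₁ k₂} [MeasurableSpace Ω] {P : Measure Ω}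

lemma expMat_Mc_isHermitian (p₁ p₂ T : ℕ) : (expMat P (S.Mc p₁ p₂ T)).IsHermitian :=
  expMat_isHermitian fun ω => S.Mc_isHermitian p₁ p₂ T ω

lemma popEigMean_eq (p₁ p₂ T : ℕ) :
    S.popEigMean P p₁ p₂ T = (p₁ : ℝ)⁻¹ * (expMat P (S.Mc p₁ p₂ T)).trace := by
  simp only [popEigMean, popEig]
  rw [sum_kthEig (expMat_Mc_isHermitian p₁ p₂ T)]

lemma GrowthRestriction.tendsto_phiStat {ε : ℝ} {k : ℕ} (hk : 1 ≤ k) {p₁ p₂ T M : ℕ → ℕ}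
    (h : S.GrowthRestriction P ε k p₁ p₂ T M) (hp₁ : Tendsto p₁ atTop atTop)
    (hM : Tendsto M atTop atTop) {A : (n : ℕ) → Matrix (Fin (p₁ n)) (Fin (p₁ n)) ℝ}
    (hA : ∀ n, (A n).IsHermitian) (h0 : ∀ n x, 0 ≤ x ⬝ᵥ A n *ᵥ x) {d₁ d₂ : ℕ → ℝ}
    (hd₁ : Tendsto d₁ atTop (𝓝 0)) (hd₂ : Tendsto d₂ atTop (𝓝 0))
    (hlow : ∀ᶠ n in atTop, S.popEig P (p₁ n) (p₂ n) (T n) k ≤ kthEig (A n) k + d₁ n * p₁ n)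
    (hmean : ∀ᶠ n in atTop,
      (p₁ n : ℝ)⁻¹ * (A n).trace ≤ S.popEigMean P (p₁ n) (p₂ n) (T n) + d₂ n) :
    Tendsto (fun n => phiStat (deltaExp ε (p₁ n) (p₂ n) (T n)) (A n) k) atTop atTop ∧
      Tendsto (fun n => (M n : ℝ) / phiStat (deltaExp ε (p₁ n) (p₂ n) (T n)) (A n) k)
        atTop (𝓝 0) := by
  obtain ⟨c₀, ε₀, κ, hc₀, hε₀, hκ, h1, h2, h3⟩ := h
  refine tendsto_phiStat_atTop hp₁ hM hA h0 hk hc₀ hε₀ hκ hd₁ hd₂ ?_ ?_ h3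
  · filter_upwards [hlow, h1] with n h4 h5
    rw [sub_mul]; linarith
  · filter_upwards [hmean, h2] with n h4 h5
    have hκ0 := hε₀.trans hκ
    -- Were the mean not positive, c₀/λ̄ would be at most 0, also under division by zero, against κ
    -- > 0.
    have h6 : 0 < S.popEigMean P (p₁ n) (p₂ n) (T n) := by
      by_contra! hneg
      have := div_nonpos_of_nonneg_of_nonpos hc₀.le hneg
      linarith
    have h7 : S.popEigMean P (p₁ n) (p₂ n) (T n) ≤ c₀ / κ := by
      rw [le_div_iff₀ hκ0, mul_comm]
      exact (le_div_iff₀ h6).1 h5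
    linarith

variable [IsProbabilityMeasure P]

lemma ae_regularAt (hE : WeakDependence S.e P) {Sig : Matrix (Fin k₁) (Fin k₁) ℝ}
    (hSig : ∀ᵐ ω ∂P, Tendsto (fun T : ℕ => (T : ℝ)⁻¹ • ∑ t ∈ Finset.range T,
      S.F t ω * (S.F t ω)ᵀ) atTop (𝓝 Sig)) : ∀ᵐ ω ∂P, S.RegularAt ω Sig := by
  filter_upwards [hSig, hE.ae_errForm_isLittleO] with ω h1 h2 using ⟨h1, h2⟩

lemma ae_swap_regularAt (hE : WeakDependence S.e P) {Sig : Matrix (Fin k₂) (Fin k₂) ℝ}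
    (hSig : ∀ᵐ ω ∂P, Tendsto (fun T : ℕ => (T : ℝ)⁻¹ • ∑ t ∈ Finset.range T,
      (S.F t ω)ᵀ * S.F t ω) atTop (𝓝 Sig)) : ∀ᵐ ω ∂P, S.swap.RegularAt ω Sig := by
  refine ae_regularAt (S := S.swap) hE.swap ?_
  filter_upwards [hSig] with ω h
  simpa [swap] using h

/-- Sample eigenvalues are close to population eigenvalues. -/
lemma ae_exists_eigenvalue_bounds (hF : S.FactorCond P) (hL : S.LoadingCond) (hE : S.ErrorCond P)
    {k : ℕ} (hk : 1 ≤ k) :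
    ∀ᵐ ω ∂P, ∃ d₁ d₂ : ℕ × ℕ × ℕ → ℝ, Tendsto d₁ atTop (𝓝 0) ∧ Tendsto d₂ atTop (𝓝 0) ∧
      ∀ᶠ p : ℕ × ℕ × ℕ in atTop,
        S.popEig P p.1 p.2.1 p.2.2 k ≤ kthEig (S.Mc p.1 p.2.1 p.2.2 ω) k + d₁ p * p.1 ∧
        (p.1 : ℝ)⁻¹ * (S.Mc p.1 p.2.1 p.2.2 ω).trace ≤ S.popEigMean P p.1 p.2.1 p.2.2 + d₂ p := by
  obtain ⟨Sig, -, hlim⟩ := hF.limit_row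
  have hw := hE.weakDependence
  obtain ⟨d, hd, hM⟩ := exists_expMat_Mc_approx hF hL hw hlim
  have htr := tendsto_trace_expMat_Mc hF hL hw hlim
  filter_upwards [ae_regularAt hw hlim, hE.ae_tendsto_errMean] with ω hreg herr
  obtain ⟨B, hB0, hB, hBlim⟩ := hreg.err
  obtain ⟨d', hd', hM'⟩ := exists_Mc_approx hL hreg.lim hB0 hB hBlim
  have htr' := tendsto_trace_Mc hL hreg.lim hB0 hB hBlim
  refine ⟨fun p => d p + d' p, fun p => (p.1 : ℝ)⁻¹ * (S.Mc p.1 p.2.1 p.2.2 ω).trace -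
    (p.1 : ℝ)⁻¹ * (expMat P (S.Mc p.1 p.2.1 p.2.2)).trace, by simpa using hd.add hd', ?_, ?_⟩
  · have := (htr'.sub htr).add herr
    rw [sub_self, add_zero] at this
    refine this.congr fun p => ?_
    ring
  · filter_upwards [eventually_triple_pos, tendsto_triple_fst.eventually_ge_atTop k] with p hp hpk
    refine ⟨kthEig_le_add (expMat_Mc_isHermitian _ _ _) (S.Mc_isHermitian _ _ _ _) hk hpk
      fun x => ?_, ?_⟩
    · have h1 := (abs_le.1 (hM p hp.1 hp.2.1 hp.2.2 x)).2
      have h2 := (abs_le.1 (hM' p hp.1 hp.2.1 hp.2.2 x)).1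
      rw [add_mul, add_mul]
      linarith
    · rw [popEigMean_eq]; linarith

lemma ae_null_hat (hF : S.FactorCond P) (hL : S.LoadingCond) (hE : S.ErrorCond P)
    (ε : ℝ) {k : ℕ} (hk : 1 ≤ k) :
    ∀ᵐ ω ∂P, ∀ p₁ p₂ T M : ℕ → ℕ,
      Tendsto p₁ atTop atTop → Tendsto p₂ atTop atTop → Tendsto T atTop atTop →
      Tendsto M atTop atTop → S.GrowthRestriction P ε k p₁ p₂ T M →
      Tendsto (fun n => phiStat (deltaExp ε (p₁ n) (p₂ n) (T n))
        (S.Mc (p₁ n) (p₂ n) (T n) ω) k) atTop atTop ∧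
      Tendsto (fun n => (M n : ℝ) / phiStat (deltaExp ε (p₁ n) (p₂ n) (T n))
        (S.Mc (p₁ n) (p₂ n) (T n) ω) k) atTop (𝓝 0) := by
  filter_upwards [ae_exists_eigenvalue_bounds hF hL hE hk] with ω hω p₁ p₂ T M hp₁ hp₂ hT hM hg
  obtain ⟨d₁, d₂, hd₁, hd₂, hev⟩ := hω
  have ht := tendsto_triple hp₁ hp₂ hT
  have hev' := ht.eventually hev
  exact hg.tendsto_phiStat hk hp₁ hM (fun n => S.Mc_isHermitian _ _ _ ω)
    (fun n x => S.Mc_form_nonneg _ _ _ ω x) (hd₁.comp ht) (hd₂.comp ht)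
    (hev'.mono fun n hn => hn.1) (hev'.mono fun n hn => hn.2)

lemma ae_null_tilde (hF : S.FactorCond P) (hL : S.LoadingCond) (hE : S.ErrorCond P)
    {Q : (p₁ p₂ T : ℕ) → Ω → Matrix (Fin p₂) (Fin k₂) ℝ}
    (hQ : ∀ p₁ p₂ T ω, k₂ ≤ p₂ → IsLeadingEigenvectors (S.Mr p₁ p₂ T ω) (Q p₁ p₂ T ω))
    (ε : ℝ) {k : ℕ} (hk : 1 ≤ k) :
    ∀ᵐ ω ∂P, ∀ p₁ p₂ T M : ℕ → ℕ,
      Tendsto p₁ atTop atTop → Tendsto p₂ atTop atTop → Tendsto T atTop atTop →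
      Tendsto M atTop atTop → S.GrowthRestriction P ε k p₁ p₂ T M →
      Tendsto (fun n => phiStat (deltaExp ε (p₁ n) (p₂ n) (T n))
        (S.Mtilde (p₁ n) (p₂ n) (T n) (Q (p₁ n) (p₂ n) (T n) ω) ω) k) atTop atTop ∧
      Tendsto (fun n => (M n : ℝ) / phiStat (deltaExp ε (p₁ n) (p₂ n) (T n))
        (S.Mtilde (p₁ n) (p₂ n) (T n) (Q (p₁ n) (p₂ n) (T n) ω) ω) k) atTop (𝓝 0) := by
  obtain ⟨Sig₁, -, hlim₁⟩ := hF.limit_row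
  obtain ⟨Sig₂, hSig₂, hlim₂⟩ := hF.limit_col
  have hw := hE.weakDependence
  filter_upwards [ae_exists_eigenvalue_bounds hF hL hE hk, ae_regularAt hw hlim₁,
    ae_swap_regularAt hw hlim₂] with ω hω hr₁ hr₂ p₁ p₂ T M hp₁ hp₂ hT hM hg
  obtain ⟨d₁, d₂, hd₁, hd₂, hev⟩ := hω
  obtain ⟨d₃, hd₃, hev₃⟩ := hr₁.exists_Mc_le_Mtilde hr₂ hSig₂.1 hL
  have ht := tendsto_triple hp₁ hp₂ hT
  have hd : Tendsto (fun p => d₁ p + d₃ p) atTop (𝓝 0) := by simpa using hd₁.add hd₃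
  refine hg.tendsto_phiStat hk hp₁ hM (fun n => S.Mtilde_isHermitian _ _ _ _ ω)
    (fun n x => S.Mtilde_form_nonneg _ _ _ _ ω x) (hd.comp ht) (hd₂.comp ht) ?_ ?_
  · filter_upwards [ht.eventually hev, ht.eventually hev₃, hp₂.eventually_ge_atTop k₂,
      hp₁.eventually_ge_atTop k] with n h1 h2 h3 h4
    refine h1.1.trans ?_
    have h5 := kthEig_le_add (S.Mc_isHermitian (p₁ n) (p₂ n) (T n) ω)
      (S.Mtilde_isHermitian (p₁ n) (p₂ n) (T n) (Q (p₁ n) (p₂ n) (T n) ω) ω) hk h4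
      (h2 _ (hQ _ _ _ ω h3))
    simp only [Function.comp_apply, add_mul] at h5 ⊢
    linarith
  · filter_upwards [ht.eventually hev, hp₂.eventually_ge_atTop k₂, hp₂.eventually_gt_atTop 0]
      with n h1 h3 h4
    refine le_trans ?_ h1.2
    refine mul_le_mul_of_nonneg_left ?_ (by positivity)
    rw [trace, trace]
    refine Finset.sum_le_sum fun i _ => ?_
    -- Testing with unit vectors compares diagonal entries, hence traces.
    have := S.Mtilde_form_le h4 (p₁ n) (T n) (hQ (p₁ n) _ (T n) ω h3).1 ω (Pi.single i 1)
    simpa using this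

/-- If k ≤ k₁, the population λ_k would grow at rate p₁. So the eigenvalue form of the alternative
reduces to the count of factors. -/
lemma lt_of_popEig_le (hF : S.FactorCond P) (hL : S.LoadingCond) (hE : S.ErrorCond P) {k : ℕ}
    (hk : 1 ≤ k) (h : ∃ c : ℝ, ∀ᶠ p : ℕ × ℕ × ℕ in atTop, S.popEig P p.1 p.2.1 p.2.2 k ≤ c) :
    k₁ < k := by
  by_contra! hle
  obtain ⟨c, hc⟩ := h
  obtain ⟨Sig, hSig, hlim⟩ := hF.limit_row
  obtain ⟨d, hd, hM⟩ := exists_expMat_Mc_approx hF hL hE.weakDependence hlim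
  obtain ⟨σ, hσ, hev⟩ := exists_kthEig_lower_bound hSig.1 hL.tendsto_row
    (fun p => expMat_Mc_isHermitian p.1 p.2.1 p.2.2) hd hM
  have ht : Tendsto (fun p : ℕ × ℕ × ℕ => σ * (p.1 : ℝ)) atTop atTop :=
    tendsto_natCast_triple_fst.const_mul_atTop hσ
  obtain ⟨p, h1, h2, h3⟩ := (hc.and (hev.and (ht.eventually_gt_atTop c))).exists
  have := h2 k hk hle
  rw [popEig] at h1
  linarith

/-- The smallest eigenvalue is at most the average one, which is the expected average squared error.
-/
lemma errMinEig_le (hE : WeakDependence S.e P) (p : ℕ × ℕ × ℕ) (hp : 0 < p.1) :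
    S.errMinEig P p.1 p.2.1 p.2.2 ≤ ∫ ω, S.errMean p ω ∂P := by
  have q₁ : (0 : ℝ) < p.1 := by exact_mod_cast hp
  set G : Ω → Matrix (Fin p.1) (Fin p.1) ℝ := fun ω => ((p.2.1 : ℝ) * p.2.2)⁻¹ •
    ∑ t ∈ Finset.range p.2.2, S.err p.1 p.2.1 t ω * (S.err p.1 p.2.1 t ω)ᵀ with hG
  have hGh : ∀ ω, (G ω).IsHermitian := fun ω => by
    rw [IsHermitian, conjTranspose_eq_transpose_of_trivial]
    simp [G, transpose_sum]
  have hGi : ∀ i j, Integrable (fun ω => G ω i j) P := fun i l => by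
    simp only [hG, Matrix.smul_apply, Matrix.sum_apply, mul_apply, transpose_apply, smul_eq_mul]
    refine Integrable.const_mul ?_ _
    refine integrable_finsetSum _ fun t _ => ?_
    exact integrable_finsetSum _ fun j _ => (memLp_err hE i j t).integrable_mul (memLp_err hE l j t)
  have hher : (expMat P G).IsHermitian := expMat_isHermitian hGh
  have htr : ∀ ω, (G ω).trace = p.1 * S.errMean p ω := fun ω => by
    rw [mul_errMean p hp, hG, trace_smul, trace_sum, smul_eq_mul, mul_comm (p.2.1 : ℝ)]
    congr 1
    exact Finset.sum_congr rfl fun t _ => trace_mul_transpose_eq _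
  have h1 : ∑ _j ∈ Finset.Icc 1 p.1, kthEig (expMat P G) p.1 ≤
      ∑ j ∈ Finset.Icc 1 p.1, kthEig (expMat P G) j := by
    refine Finset.sum_le_sum fun j hj => ?_
    rw [Finset.mem_Icc] at hj
    have := kthEig_antitone hher (a := ⟨j - 1, by omega⟩) (b := ⟨p.1 - 1, by omega⟩)
      (by rw [Fin.le_def]; simp only; omega)
    simpa only [Nat.sub_add_cancel hj.1, Nat.sub_add_cancel hp] using this
  rw [sum_kthEig hher, expMat_trace hGi] at h1
  simp only [htr, Finset.sum_const, Nat.card_Icc, Nat.add_sub_cancel, nsmul_eq_mul] at h1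
  rw [integral_const_mul] at h1
  exact le_of_mul_le_mul_left h1 q₁

/-- With factors, tr Σ₁ > 0 supplies the bound; without them it comes from the errors through
`errMinEig_le`. -/
lemma ae_exists_trace_Mc_ge (hF : S.FactorCond P) (hL : S.LoadingCond) (hE : S.ErrorCond P)
    (h : (0 < k₁ ∧ 0 < k₂) ∨ (k₁ = 0 ∧ k₂ = 0 ∧
      ∃ c : ℝ, 0 < c ∧ ∀ᶠ p : ℕ × ℕ × ℕ in atTop, c ≤ S.errMinEig P p.1 p.2.1 p.2.2)) :
    ∀ᵐ ω ∂P, ∃ m : ℝ, 0 < m ∧ ∀ᶠ p : ℕ × ℕ × ℕ in atTop,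
      m ≤ (p.1 : ℝ)⁻¹ * (S.Mc p.1 p.2.1 p.2.2 ω).trace := by
  obtain ⟨Sig, hSig, hlim⟩ := hF.limit_row
  have hw := hE.weakDependence
  filter_upwards [ae_regularAt hw hlim, hE.ae_tendsto_errMean] with ω hreg herr
  obtain ⟨B, hB0, hB, hBlim⟩ := hreg.err
  have htr := tendsto_trace_Mc hL hreg.lim hB0 hB hBlim
  rcases h with ⟨hk₁, -⟩ | ⟨hk₁, -, c, hc, hev⟩
  · have : Nonempty (Fin k₁) := ⟨⟨0, hk₁⟩⟩
    have h0 : 0 < Sig.trace := hSig.1.trace_pos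
    refine ⟨Sig.trace / 2, by positivity, ?_⟩
    filter_upwards [htr.eventually_const_lt (half_lt_self h0)] with p hp
    have := S.errMean_nonneg p ω
    linarith
  · have h0 : Sig.trace = 0 := by
      subst hk₁
      simp [trace]
    refine ⟨c / 2, by positivity, ?_⟩
    have h1 := htr.add herr
    rw [h0, add_zero] at h1
    filter_upwards [hev, eventually_triple_pos,
      h1.eventually_const_lt (show -(c / 2) < 0 by linarith)] with p hp hpos hp'
    have := S.errMinEig_le hw p hpos.1
    linarith

lemma ae_alt_hat (hL : S.LoadingCond) (hE : S.ErrorCond P) (hF : S.FactorCond P)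
    {ε : ℝ} (hε : 0 < ε) {k : ℕ} (hk : k₁ < k)
    (h : (0 < k₁ ∧ 0 < k₂) ∨ (k₁ = 0 ∧ k₂ = 0 ∧
      ∃ c : ℝ, 0 < c ∧ ∀ᶠ p : ℕ × ℕ × ℕ in atTop, c ≤ S.errMinEig P p.1 p.2.1 p.2.2)) :
    ∀ᵐ ω ∂P, ∀ p₁ p₂ T : ℕ → ℕ,
      Tendsto p₁ atTop atTop → Tendsto p₂ atTop atTop → Tendsto T atTop atTop →
      Tendsto (fun n => phiStat (deltaExp ε (p₁ n) (p₂ n) (T n))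
        (S.Mc (p₁ n) (p₂ n) (T n) ω) k) atTop (𝓝 0) := by
  filter_upwards [ae_exists_trace_Mc_ge hF hL hE h, hE.weakDependence.ae_errForm_deltaExp hε]
    with ω h1 h2 p₁ p₂ T hp₁ hp₂ hT
  obtain ⟨m, hm, hm'⟩ := h1
  obtain ⟨B, hB0, hB, hBlim⟩ := h2
  have ht := tendsto_triple hp₁ hp₂ hT
  refine tendsto_phiStat_zero (B := fun n => 2 * B (p₁ n, p₂ n, T n))
    (fun n => S.Mc_isHermitian _ _ _ ω) (fun n x => S.Mc_form_nonneg _ _ _ ω x) ?_ ?_ hm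
    (ht.eventually hm')
  · have := (hBlim.comp ht).const_mul 2
    rw [mul_zero] at this
    refine this.congr fun n => ?_
    simp only [Function.comp_apply]
    ring
  · filter_upwards [ht.eventually eventually_triple_pos, hp₁.eventually_ge_atTop k] with n h3 h4
    exact kthEig_Mc_le hB (p := (p₁ n, p₂ n, T n)) h3.1 h3.2.1 h3.2.2 hk h4

lemma ae_alt_tilde (hL : S.LoadingCond) (hE : S.ErrorCond P) (hF : S.FactorCond P)
    {Q : (p₁ p₂ T : ℕ) → Ω → Matrix (Fin p₂) (Fin k₂) ℝ}
    (hQ : ∀ p₁ p₂ T ω, k₂ ≤ p₂ → IsLeadingEigenvectors (S.Mr p₁ p₂ T ω) (Q p₁ p₂ T ω))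
    {ε : ℝ} (hε : 0 < ε) {k : ℕ} (hk : k₁ < k) (hk₂ : 0 < k₂) :
    ∀ᵐ ω ∂P, ∀ p₁ p₂ T : ℕ → ℕ,
      Tendsto p₁ atTop atTop → Tendsto p₂ atTop atTop → Tendsto T atTop atTop →
      Tendsto (fun n => phiStat (deltaExp ε (p₁ n) (p₂ n) (T n))
        (S.Mtilde (p₁ n) (p₂ n) (T n) (Q (p₁ n) (p₂ n) (T n) ω) ω) k) atTop (𝓝 0) := by
  obtain ⟨Sig₂, hSig₂, hlim₂⟩ := hF.limit_col
  filter_upwards [ae_swap_regularAt hE.weakDependence hlim₂,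
    hE.weakDependence.ae_errForm_deltaExp hε] with ω h1 h2 p₁ p₂ T hp₁ hp₂ hT
  obtain ⟨m, hm, hm'⟩ := h1.exists_trace_Mtilde_ge hSig₂.1 hL hk₂
  obtain ⟨B, hB0, hB, hBlim⟩ := h2
  have ht := tendsto_triple hp₁ hp₂ hT
  refine tendsto_phiStat_zero (B := fun n => 2 * B (p₁ n, p₂ n, T n))
    (fun n => S.Mtilde_isHermitian _ _ _ _ ω) (fun n x => S.Mtilde_form_nonneg _ _ _ _ ω x)
    ?_ ?_ hm ?_
  · have := (hBlim.comp ht).const_mul 2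
    rw [mul_zero] at this
    refine this.congr fun n => ?_
    simp only [Function.comp_apply]
    ring
  · filter_upwards [ht.eventually eventually_triple_pos, hp₁.eventually_ge_atTop k,
      hp₂.eventually_ge_atTop k₂] with n h3 h4 h5
    refine le_trans ?_ (kthEig_Mc_le hB (p := (p₁ n, p₂ n, T n)) h3.1 h3.2.1 h3.2.2 hk h4)
    -- `Mtilde` is dominated by `Mc` as a form, so its λ_k inherits the bound.
    have h6 := kthEig_le_add (m := 0) (S.Mtilde_isHermitian (p₁ n) (p₂ n) (T n)
      (Q (p₁ n) (p₂ n) (T n) ω) ω) (S.Mc_isHermitian (p₁ n) (p₂ n) (T n) ω) (by omega) h4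
      fun x => by
        rw [zero_mul, add_zero]
        exact S.Mtilde_form_le h3.2.1 _ _ (hQ _ _ _ ω h5).1 ω x
    simpa using h6
  · filter_upwards [ht.eventually hm', hp₂.eventually_ge_atTop k₂] with n h3 h4
    exact h3 _ (hQ _ _ _ ω h4)

end FactorModel

end

/-! ### The proposition. -/

theorem proposition1
    {Ω Ω' : Type*} [MeasurableSpace Ω] [MeasurableSpace Ω']
    (P : Measure Ω) [IsProbabilityMeasure P] (P' : Measure Ω') [IsProbabilityMeasure P']
    {k₁ k₂ : ℕ} (S : FactorModel Ω k₁ k₂)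
    (hF : S.FactorCond P) (hL : S.LoadingCond) (hE : S.ErrorCond P) (hFE : S.FactorErrorCond P)
    (W : Measure ℝ) (U : Set ℝ) (hW : WeightCond W U)
    (η : ℕ → Ω' → ℝ) (hη_meas : ∀ m, Measurable (η m)) (hη_indep : iIndepFun η P')
    (hη_law : ∀ m, P'.map (η m) = gaussianReal 0 1)
    (Q : (p₁ p₂ T : ℕ) → Ω → Matrix (Fin p₂) (Fin k₂) ℝ)
    (hQ : ∀ p₁ p₂ T ω, k₂ ≤ p₂ → IsLeadingEigenvectors (S.Mr p₁ p₂ T ω) (Q p₁ p₂ T ω))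
    (ε : ℝ) (hε : 0 < ε) (k : ℕ) (hk : 1 ≤ k) :
    -- null hypothesis
    (0 < k₁ → 0 < k₂ → k ≤ k₁ →
      (∀ᵐ ω ∂P, ∀ p₁ p₂ T M : ℕ → ℕ,
        Tendsto p₁ atTop atTop → Tendsto p₂ atTop atTop → Tendsto T atTop atTop →
        Tendsto M atTop atTop → S.GrowthRestriction P ε k p₁ p₂ T M →
        TendstoInDistribution
          (fun n ω' => S.psiHat W U ε k (p₁ n) (p₂ n) (T n) (M n) ω (fun m => η m ω'))
          atTop (fun z : ℝ => z ^ 2) (fun _ => P') (gaussianReal 0 1)) ∧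
      (∀ᵐ ω ∂P, ∀ p₁ p₂ T M : ℕ → ℕ,
        Tendsto p₁ atTop atTop → Tendsto p₂ atTop atTop → Tendsto T atTop atTop →
        Tendsto M atTop atTop → S.GrowthRestriction P ε k p₁ p₂ T M →
        TendstoInDistribution
          (fun n ω' => S.psiTilde W U ε k (p₁ n) (p₂ n) (T n) (M n)
            (Q (p₁ n) (p₂ n) (T n) ω) ω (fun m => η m ω'))
          atTop (fun z : ℝ => z ^ 2) (fun _ => P') (gaussianReal 0 1))) ∧
    -- alternative hypothesis
    (W ({0} ∩ U) = 0 →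
      (k₁ < k ∨ ∃ c₀ : ℝ, ∀ᶠ p : ℕ × ℕ × ℕ in atTop, S.popEig P p.1 p.2.1 p.2.2 k ≤ c₀) →
      ∃ c₁ : ℝ, 0 < c₁ ∧
        ((0 < k₁ ∧ 0 < k₂) ∨
          (k₁ = 0 ∧ k₂ = 0 ∧
            ∃ c : ℝ, 0 < c ∧ ∀ᶠ p : ℕ × ℕ × ℕ in atTop, c ≤ S.errMinEig P p.1 p.2.1 p.2.2) →
          ∀ᵐ ω ∂P, ∀ p₁ p₂ T M : ℕ → ℕ,
            Tendsto p₁ atTop atTop → Tendsto p₂ atTop atTop → Tendsto T atTop atTop →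
            Tendsto M atTop atTop →
            TendstoInMeasure P'
              (fun n ω' => (M n : ℝ)⁻¹ *
                S.psiHat W U ε k (p₁ n) (p₂ n) (T n) (M n) ω (fun m => η m ω'))
              atTop (fun _ => c₁)) ∧
        (0 < k₁ → 0 < k₂ →
          ∀ᵐ ω ∂P, ∀ p₁ p₂ T M : ℕ → ℕ,
            Tendsto p₁ atTop atTop → Tendsto p₂ atTop atTop → Tendsto T atTop atTop →
            Tendsto M atTop atTop →
            TendstoInMeasure P'
              (fun n ω' => (M n : ℝ)⁻¹ *
                S.psiTilde W U ε k (p₁ n) (p₂ n) (T n) (M n)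
                  (Q (p₁ n) (p₂ n) (T n) ω) ω (fun m => η m ω'))
              atTop (fun _ => c₁))) := by
  refine ⟨fun _ _ _ => ⟨?_, ?_⟩, fun hW0 halt => ?_⟩
  · filter_upwards [FactorModel.ae_null_hat hF hL hE ε hk] with ω hω p₁ p₂ T M hp₁ hp₂ hT hM hg
    obtain ⟨h1, h2⟩ := hω p₁ p₂ T M hp₁ hp₂ hT hM hg
    exact tendstoInDistribution_psiStat hη_meas hη_indep hη_law hW h1 hM h2
  · filter_upwards [FactorModel.ae_null_tilde hF hL hE hQ ε hk]
      with ω hω p₁ p₂ T M hp₁ hp₂ hT hM hg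
    obtain ⟨h1, h2⟩ := hω p₁ p₂ T M hp₁ hp₂ hT hM hg
    exact tendstoInDistribution_psiStat hη_meas hη_indep hη_law hW h1 hM h2
  · have hk₁ : k₁ < k := halt.elim id (FactorModel.lt_of_popEig_le hF hL hE hk)
    -- The constant is 1: ν(u)²/M → 1 for u ≠ 0, and U has total weight 1.
    refine ⟨1, one_pos, fun h => ?_, fun _ hk₂ => ?_⟩
    · filter_upwards [FactorModel.ae_alt_hat hL hE hF hε hk₁ h] with ω hω p₁ p₂ T M hp₁ hp₂ hT hM
      exact tendstoInMeasure_psiStat hη_meas hη_law hW hW0 (hω p₁ p₂ T hp₁ hp₂ hT) hM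
    · filter_upwards [FactorModel.ae_alt_tilde hL hE hF hQ hε hk₁ hk₂]
        with ω hω p₁ p₂ T M hp₁ hp₂ hT hM
      exact tendstoInMeasure_psiStat hη_meas hη_law hW hW0 (hω p₁ p₂ T hp₁ hp₂ hT) hM
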